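/- For integers $n\ge 2$, $k\ge n+1$ let $V(n,k)$ denote the maximum volume of an $n$-dimensional convex polytope in $\mathbb R^n$ with exactly $k$ vertices and diameter $1$. Call a convex polyhedron with $6$ vertices, all of whose faces are triangles, of \emph{octahedral type} if no vertex has valence greater than $4$, and of \emph{pyramidal type} if some vertex has valence $5$. For $r\in[\frac{\sqrt3}{2},1]$ and $x\in[0,\frac12]$ let $$A(r,x)=\tfrac12x\sqrt{3-4x-4x^2}+\tfrac12\sqrt{r^2-x^2},$$ and let $P_1=(\frac12,y)$, $P_2=(x,0)$, $P_3=(-x,0)$, $P_4=(-\frac12,y)$, $P_5=(0,z)$ with $y=\sqrt{1-(\frac12+x)^2}$, $z=\sqrt{r^2-x^2}$ be the symmetric pentagon with parameters $r$, $x$. The maximum $V(3,6)$ exists, and $V(3,6)=0.1954\ldots$, i.e. $0.1954\le V(3,6)<0.1955$. Moreover, with $r=\frac{\sqrt3}{2}$: 1. There is $x_0\in(0,\frac12)$ such that $A(r,x)<A(r,x_0)$ for all $x\in[0,\frac12]$ with $x\ne x_0$, and $V(3,6)=\frac13A(r,x_0)$. 2. Let $P_1,\dots,P_5$ be the symmetric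 pentagon with parameters $r$, $x_0$. Among the distances $d(P_i,P_5)$ $(i\le4)$ exactly $d(P_2,P_5)$ and $d(P_3,P_5)$ are equal to $r$, and among the distances $d(P_i,P_j)$ $(i<j\le 4)$ exactly $d(P_1,P_3)$, $d(P_2,P_4)$ and $d(P_1,P_4)$ are equal to $1$ (so the diameter graph of the pentagon is the five-pointed star $P_2P_4P_1P_3P_5$). 3. Place the pentagon in the plane at height $0$ of $\mathbb R^3$, and let $P$ and $Q$ be the points at heights $\frac12$ and $-\frac12$ above and below $P_5$, so that $h=d(P,Q)=1$. The convex hull of $P,Q,P_1,P_2,P_3,P_4$ is a polyhedron with $6$ vertices and diameter $1$, is of pyramidal type, its vertices of valence $5$ are exactly $P$ and $Q$, and its volume is $V(3,6)$. 4. Every polyhedron with $6$ vertices, diameter $1$ and volume $V(3,6)$ is congruent to the polyhedron in 3. 5. Every polyhedron of octahedral type with $6$ vertices and diameter $1$ has volume at most $\frac16$. -/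

import Mathlib

open Set MeasureTheory

noncomputable section

namespace SmallPolytope

/-- Euclidean `n`-space. -/
abbrev Space (n : ℕ) : Type := EuclideanSpace ℝ (Fin n)

/-- An `n`-dimensional convex polytope in Euclidean `n`-space: the convex hull of a finite set of
points, with nonempty interior. -/
def IsPolytope {n : ℕ} (K : Set (Space n)) : Prop :=
  (∃ s : Finset (Space n), K = convexHull ℝ (s : Set (Space n))) ∧ (interior K).Nonempty

/-- The vertices of a polytope are its extreme points. -/
def vertices {n : ℕ} (K : Set (Space n)) : Set (Space n) := K.extremePoints ℝ

/-- The `n`-dimensional polytopes with exactly `k` vertices and of diameter `1`. -/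
def unitPolytopes (n k : ℕ) : Set (Set (Space n)) :=
  {K | IsPolytope K ∧ (vertices K).ncard = k ∧ Metric.diam K = 1}

/-- `V(n,k)`: the largest volume of an `n`-dimensional polytope with `k` vertices
and of diameter `1`. -/
def V (n k : ℕ) : ℝ := sSup ((fun K : Set (Space n) => volume.real K) '' unitPolytopes n k)

/-! ### Faces and the two combinatorial types -/

/-- Two distinct vertices are joined by an edge if the segment between them is a face. -/
def IsEdge {n : ℕ} (K : Set (Space n)) (u v : Space n) : Prop :=
  u ∈ vertices K ∧ v ∈ vertices K ∧ u ≠ v ∧ IsExposed ℝ K (segment ℝ u v)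

/-- The valence of a vertex: the number of edges containing it. -/
def valence {n : ℕ} (K : Set (Space n)) (u : Space n) : ℕ := {v | IsEdge K u v}.ncard

/-- The two-dimensional faces of a polyhedron in `3`-space. -/
def IsFacet (K F : Set (Space 3)) : Prop :=
  IsExposed ℝ K F ∧ F ≠ K ∧ Module.finrank ℝ (vectorSpan ℝ F) = 2

/-- All two-dimensional faces are triangles. -/
def HasTriangularFaces (K : Set (Space 3)) : Prop :=
  ∀ F, IsFacet K F → (vertices F).ncard = 3

/-- The octahedral type (for polyhedra with six vertices): all faces are triangles and no
vertex has valence greater than `4`. -/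
def IsOctahedral (K : Set (Space 3)) : Prop :=
  HasTriangularFaces K ∧ ∀ u ∈ vertices K, valence K u ≤ 4

/-- The pyramidal type (for polyhedra with six vertices): all faces are triangles and some
vertex has valence `5`. -/
def IsPyramidal (K : Set (Space 3)) : Prop :=
  HasTriangularFaces K ∧ ∃ u ∈ vertices K, valence K u = 5

/-! ### Pentagons

The points `P₁, …, P₅` are indexed by `0, …, 4`. -/

/-- The diameter graph of five points with respect to `r`: `P₅` is joined to the points at
distance `r` from it, and two other points are joined if their distance is `1`. -/
def diameterGraph (r : ℝ) (p : Fin 5 → Space 2) : SimpleGraph (Fin 5) where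
  Adj i j := i ≠ j ∧ dist (p i) (p j) = if i = 4 ∨ j = 4 then r else 1
  symm := ⟨fun i j h => ⟨h.1.symm, by rw [dist_comm, h.2]; simp only [or_comm]⟩⟩
  loopless := ⟨fun _ h => h.1 rfl⟩

/-- The five-pointed star `P₂P₄P₁P₃P₅`. -/
def starGraph : SimpleGraph (Fin 5) :=
  SimpleGraph.fromEdgeSet {s(1, 3), s(3, 0), s(0, 2), s(2, 4), s(4, 1)}

/-- The symmetric pentagon `(1/2, y), (x, 0), (-x, 0), (-1/2, y), (0, z)` with
`y = √(1 - (1/2 + x)²)` and `z = √(r² - x²)`. -/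
def symmetricPentagon (r x : ℝ) : Fin 5 → Space 2 :=
  ![!₂[1 / 2, √(1 - (1 / 2 + x) ^ 2)], !₂[x, 0], !₂[-x, 0],
    !₂[-(1 / 2), √(1 - (1 / 2 + x) ^ 2)], !₂[0, √(r ^ 2 - x ^ 2)]]

/-- The area of the symmetric pentagon. -/
def A (r x : ℝ) : ℝ :=
  1 / 2 * x * √(3 - 4 * x - 4 * x ^ 2) + 1 / 2 * √(r ^ 2 - x ^ 2)

/-- The point of `3`-space at height `t` above the point `q` of the plane. -/
def lift (q : Space 2) (t : ℝ) : Space 3 := !₂[q 0, q 1, t]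

/-- The polyhedron over the pentagon `p` with apexes `P` and `Q`: the vertices `P₁, …, P₄` are
in the plane of `p`, and `P`, `Q` are at the distance `h` from each other, symmetric with
respect to that plane, with midpoint `P₅`. -/
def polyhedronOver (h : ℝ) (p : Fin 5 → Space 2) : Set (Space 3) :=
  convexHull ℝ {lift (p 4) (h / 2), lift (p 4) (-(h / 2)),
    lift (p 0) 0, lift (p 1) 0, lift (p 2) 0, lift (p 3) 0}

end SmallPolytope

end

namespace SmallPolytope

/-! ### The area function -/

/-! The affine dependences of the six vertices form a plane (`finrank_dependences`). As in a Gale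
diagram, the six coordinate functionals on it can be ordered by slope. Since six is even, two cyclic
neighbours fit together in sign (`exists_star_pair`): they belong to vertices `p`, `q` such that no
dependence vanishing at another vertex has opposite signs at `p` and `q`. Moving a convex
combination along such dependences removes two of the other four coefficients, so the polytope is
covered by tetrahedra with the common edge `p q` (`IsStarred.cover`).

Seen along `p q`, the other four vertices are plane vectors that can be ordered by angle
(`hasAngularOrder`). If they go round the origin, four tetrahedra suffice. Their volumes add up to a
sixth of the determinant of `q - p` and two diagonals, hence to at most `1 / 6` by Hadamard. If they
lie in a half-plane (a fan), three tetrahedra suffice, and the volume is at most `h / 3` times the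
area of the projected pentagon, where `h = |p q|`. Its corner under `p q` has distance at most `√(1
- h² / 4)` from the others, whose mutual distances are at most `1`. Rescaling reduces to `h = 1`,
because `h (1 - h² / 4)` is largest there on `[0, 1]`.

The planar problem is `pentagon_bound`. With the side `P₂P₃` horizontal of length `2x`, its midpoint
lies in a lens, and the diagonals `P₁P₃`, `P₂P₄` limit the depth of the pentagon. Optimizing these
two separately leaves a function of `x` and `P₁ - P₄`. Crude bounds dispose of everything far from
the optimum; near it `P₁ - P₄ = (1, 0)` is best, and what remains is `A (√3 / 2) x`, which is
strictly concave and so has a unique maximizer. Tracing equality back determines the pentagon and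
all heights, which gives uniqueness up to congruence; the explicit polyhedron attains the bound.

In a fan whose faces are all triangles, `p` lies on five edges (`IsStarPolytope.four_lt_valence`).
So a polyhedron of octahedral type falls under the bound `1 / 6`. -/

lemma sqrt_three_half_sq : (√3 / 2) ^ 2 = (3 / 4 : ℝ) := by
  rw [div_pow, Real.sq_sqrt (by norm_num)]; norm_num

lemma two_mul_A {x : ℝ} :
    2 * A (√3 / 2) x = 2 * x * √(1 - (1 / 2 + x) ^ 2) + √(3 / 4 - x ^ 2) := by
  have h : √(3 - 4 * x - 4 * x ^ 2) = 2 * √(1 - (1 / 2 + x) ^ 2) := by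
    rw [show 3 - 4 * x - 4 * x ^ 2 = 2 ^ 2 * (1 - (1 / 2 + x) ^ 2) by ring,
      Real.sqrt_mul (by norm_num), Real.sqrt_sq (by norm_num)]
  rw [A, sqrt_three_half_sq, h]; ring

lemma sqrt_mean_le {a b c : ℝ} (ha : 0 ≤ a) (hb : 0 ≤ b) (h : (a + b) / 2 ≤ c) :
    (√a + √b) / 2 ≤ √c := by
  apply Real.le_sqrt_of_sq_le
  nlinarith [Real.sq_sqrt ha, Real.sq_sqrt hb, sq_nonneg (√a - √b)]

lemma sqrt_mean_lt {a b c : ℝ} (ha : 0 ≤ a) (hb : 0 ≤ b) (h : (a + b) / 2 < c) :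
    (√a + √b) / 2 < √c := by
  apply Real.lt_sqrt_of_sq_lt
  nlinarith [Real.sq_sqrt ha, Real.sq_sqrt hb, sq_nonneg (√a - √b)]

/-- Strictness comes from the second root. In the first term an increasing factor meets a decreasing
concave one: the mean of the products is the product of the means plus a quarter of the quantity in
`h3`, which is nonpositive. This concavity is what makes the maximizer unique. -/
lemma A_midpoint_lt {a b : ℝ} (ha : a ∈ Icc (0 : ℝ) (1 / 2)) (hb : b ∈ Icc (0 : ℝ) (1 / 2))
    (hab : a ≠ b) :
    (A (√3 / 2) a + A (√3 / 2) b) / 2 < A (√3 / 2) ((a + b) / 2) := by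
  obtain ⟨ha0, ha1⟩ := ha
  obtain ⟨hb0, hb1⟩ := hb
  have hpos : 0 < (a - b) ^ 2 := by
    have := sub_ne_zero.2 hab
    positivity
  have h1 : (√(3 / 4 - a ^ 2) + √(3 / 4 - b ^ 2)) / 2 < √(3 / 4 - ((a + b) / 2) ^ 2) :=
    sqrt_mean_lt (by nlinarith) (by nlinarith) (by nlinarith)
  have h2 : (√(1 - (1 / 2 + a) ^ 2) + √(1 - (1 / 2 + b) ^ 2)) / 2 ≤
      √(1 - (1 / 2 + (a + b) / 2) ^ 2) :=
    sqrt_mean_le (by nlinarith) (by nlinarith) (by nlinarith)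
  have h3 : (a - b) * (√(1 - (1 / 2 + a) ^ 2) - √(1 - (1 / 2 + b) ^ 2)) ≤ 0 := by
    rcases le_total a b with h | h
    · have : √(1 - (1 / 2 + b) ^ 2) ≤ √(1 - (1 / 2 + a) ^ 2) := Real.sqrt_le_sqrt (by nlinarith)
      nlinarith
    · have : √(1 - (1 / 2 + a) ^ 2) ≤ √(1 - (1 / 2 + b) ^ 2) := Real.sqrt_le_sqrt (by nlinarith)
      nlinarith
  have h4 := mul_le_mul_of_nonneg_left h2 (add_nonneg ha0 hb0)
  have ea := two_mul_A (x := a)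
  have eb := two_mul_A (x := b)
  have em := two_mul_A (x := (a + b) / 2)
  nlinarith

/-- The point `0.3` is close to the maximizer and makes the first root rational; `1.1724 = 6 *
0.1954`. -/
lemma two_mul_A_three_tenths_gt : 1.1724 < 2 * A (√3 / 2) 0.3 := by
  rw [two_mul_A]
  have h1 : √(1 - (1 / 2 + 0.3) ^ 2) = (0.6 : ℝ) := by
    rw [show (1 - (1 / 2 + 0.3) ^ 2 : ℝ) = 0.6 ^ 2 by norm_num, Real.sqrt_sq (by norm_num)]
  have h2 : (0.8124 : ℝ) < √(3 / 4 - 0.3 ^ 2) := Real.lt_sqrt_of_sq_lt (by norm_num)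
  rw [h1]; linarith

lemma A_continuous : Continuous (A (√3 / 2)) := by
  unfold A; fun_prop

lemma exists_A_maximizer : ∃ x₀ ∈ Ioo (0 : ℝ) (1 / 2),
    ∀ x ∈ Icc (0 : ℝ) (1 / 2), x ≠ x₀ → A (√3 / 2) x < A (√3 / 2) x₀ := by
  obtain ⟨x₀, hx₀, hmax⟩ := isCompact_Icc.exists_isMaxOn (s := Icc (0 : ℝ) (1 / 2))
    ⟨0, by norm_num⟩ A_continuous.continuousOn
  have h3 : A (√3 / 2) 0.3 ≤ A (√3 / 2) x₀ := hmax (by norm_num : (0.3 : ℝ) ∈ Icc (0 : ℝ) (1 / 2))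
  have hnum := two_mul_A_three_tenths_gt
  refine ⟨x₀, ⟨lt_of_le_of_ne hx₀.1 ?_, lt_of_le_of_ne hx₀.2 ?_⟩, fun x hx hne => ?_⟩
  · rintro rfl
    have := two_mul_A (x := 0)
    have h : √(3 / 4 - 0 ^ 2) ≤ (1 : ℝ) := Real.sqrt_le_one.2 (by norm_num)
    linarith
  · rintro rfl
    have := two_mul_A (x := 1 / 2)
    have h : √(3 / 4 - (1 / 2) ^ 2) ≤ (1 : ℝ) := Real.sqrt_le_one.2 (by norm_num)
    have h' : √(1 - (1 / 2 + 1 / 2) ^ 2 : ℝ) = 0 := by norm_num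
    rw [h'] at this
    linarith
  · have hle : A (√3 / 2) x ≤ A (√3 / 2) x₀ := hmax hx
    have hm : A (√3 / 2) ((x + x₀) / 2) ≤ A (√3 / 2) x₀ :=
      hmax (show (x + x₀) / 2 ∈ Icc (0 : ℝ) (1 / 2) from
        ⟨by linarith [hx.1, hx₀.1], by linarith [hx.2, hx₀.2]⟩)
    have := A_midpoint_lt hx hx₀ hne
    linarith

/-- By AM-GM, with equality at `μ = √a`. A numerical guess `μ` for the root turns estimates with
roots into polynomial ones. -/
lemma sqrt_le_tangent {a μ : ℝ} (ha : 0 ≤ a) (hμ : 0 < μ) : √a ≤ (a / μ + μ) / 2 := by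
  have : (a / μ + μ) / 2 - √a = (√a - μ) ^ 2 / (2 * μ) := by
    field_simp
    nlinarith [Real.sq_sqrt ha]
  rw [← sub_nonneg, this]; positivity

/-- Here `1.173 = 6 * 0.1955`, and the values of `μ` are the two roots at `x = 0.3` (the second one
rounded). -/
lemma two_mul_A_lt {x : ℝ} (hx : x ∈ Icc (0 : ℝ) (1 / 2)) : 2 * A (√3 / 2) x < 1.173 := by
  obtain ⟨h0, h1⟩ := hx
  have ha := sqrt_le_tangent (a := 1 - (1 / 2 + x) ^ 2) (μ := 0.6) (by nlinarith) (by norm_num)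
  have hb := sqrt_le_tangent (a := 3 / 4 - x ^ 2) (μ := 0.8124) (by nlinarith) (by norm_num)
  have hc := mul_le_mul_of_nonneg_left ha h0
  rw [two_mul_A]
  norm_num at hb hc ⊢
  -- The remaining cubic in `x` has its maximum near `0.304`.
  nlinarith [mul_nonneg h0 (sq_nonneg (x - 0.304)), sq_nonneg (x - 0.304)]

/-! ### The planar problem: the largest area of a pentagon. -/

lemma far_bound_of_large {x c : ℝ} (hx : 0.38 ≤ x) (hx1 : x ≤ 1 / 2) (hc : 0 ≤ c) (hc1 : c ≤ 1) :
    c * √(3 / 4 - x ^ 2) + 2 * x * √(1 - (c / 2 + x) ^ 2) < 1.172 := by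
  have hz : √(3 / 4 - x ^ 2) ≤ 0.7785 := Real.sqrt_le_iff.2 ⟨by norm_num, by nlinarith⟩
  have ha := sqrt_le_tangent (a := 1 - (c / 2 + x) ^ 2) (μ := 0.55) (by nlinarith) (by norm_num)
  have hb := mul_le_mul_of_nonneg_left ha (show 0 ≤ 2 * x by linarith)
  have hd := mul_le_mul_of_nonneg_left hz hc
  have key : c * 0.7785 + 2 * x * (((1 - (c / 2 + x) ^ 2) / 0.55 + 0.55) / 2) < 1.172 := by
    have e : 2 * x * (((1 - (c / 2 + x) ^ 2) / 0.55 + 0.55) / 2)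
      = x * (1 - (c / 2 + x) ^ 2) * (20 / 11) + 0.55 * x := by ring
    rw [e]
    nlinarith [mul_nonneg (sub_nonneg.2 hx) (sub_nonneg.2 hx1), mul_nonneg hc (sub_nonneg.2 hc1),
      mul_nonneg (mul_nonneg hc (sub_nonneg.2 hx)) (sub_nonneg.2 hx1),
      mul_nonneg (mul_nonneg hc (sub_nonneg.2 hc1)) (sub_nonneg.2 hx),
      mul_nonneg (mul_nonneg hc (sub_nonneg.2 hc1)) (sub_nonneg.2 hx1),
      mul_nonneg (sub_nonneg.2 hc1) (sub_nonneg.2 hx), mul_nonneg (sub_nonneg.2 hc1) (sub_nonneg.2 hx1)]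
  linarith

/-- The value at `ρ = 1` dominates, and there a cubic in `x` with its maximum near `0.29` is left.
-/
lemma far_poly_small {x ρ : ℝ} (hx : 0 ≤ x) (hx1 : x ≤ 5 / 12) (hρ1 : ρ ≤ 1) :
    0.8661 * ρ - 2.4 * x ^ 2 * ρ + x * (1 - ρ ^ 2 / 4 - x ^ 2) * (25 / 16) + 0.64 * x < 1.172 := by
  have h1 : 0.8661 * ρ - 2.4 * x ^ 2 * ρ + x * (1 - ρ ^ 2 / 4 - x ^ 2) * (25 / 16) + 0.64 * x ≤
      0.8661 - 2.4 * x ^ 2 + x * (3 / 4 - x ^ 2) * (25 / 16) + 0.64 * x := by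
    have : 0 ≤ (1 - ρ) * (0.8661 - 2.4 * x ^ 2 - x * (25 / 64) * (1 + ρ)) := by
      apply mul_nonneg (by linarith)
      nlinarith [mul_nonneg hx (sub_nonneg.2 hρ1)]
    nlinarith
  have h2 : 0.8661 - 2.4 * x ^ 2 + x * (3 / 4 - x ^ 2) * (25 / 16) + 0.64 * x < 1.172 := by
    nlinarith [mul_nonneg hx (sq_nonneg (x - 0.29)), sq_nonneg (x - 0.29)]
  linarith

lemma far_poly_large {x ρ : ℝ} (hx : 5 / 12 ≤ x) (hx1 : x ≤ 1 / 2) (hρ : 0 ≤ ρ) (hρ1 : ρ ≤ 1) :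
    0.8661 * ρ - x * ρ + x * (1 - ρ ^ 2 / 4 - x ^ 2) * (25 / 16) + 0.64 * x < 1.172 := by
  nlinarith [mul_nonneg (sub_nonneg.2 hx) (sub_nonneg.2 hx1), mul_nonneg hρ (sub_nonneg.2 hρ1),
    mul_nonneg (mul_nonneg hρ (sub_nonneg.2 hρ1)) (sub_nonneg.2 hx),
    mul_nonneg (sub_nonneg.2 hρ1) (sub_nonneg.2 hx1), mul_nonneg (sub_nonneg.2 hρ1) (sub_nonneg.2 hx),
    mul_nonneg (mul_nonneg (sub_nonneg.2 hx) (sub_nonneg.2 hx1)) (by linarith : 0 ≤ x)]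

/-- This is the support function, in the direction `(k, c)`, of the disc about `(-x, 0)` of radius
`√3 / 2 < 0.8661`. -/
lemma lens_support {x l m c k : ℝ} (h : (l + x) ^ 2 + m ^ 2 ≤ 3 / 4) :
    c * m + k * l ≤ √(c ^ 2 + k ^ 2) * 0.8661 - x * k := by
  have h0 : 0 ≤ √(c ^ 2 + k ^ 2) := Real.sqrt_nonneg _
  have hs := Real.sq_sqrt (show 0 ≤ c ^ 2 + k ^ 2 by positivity)
  have : c * m + k * (l + x) ≤ √(c ^ 2 + k ^ 2) * 0.8661 := by
    apply le_of_sq_le_sq _ (by positivity)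
    nlinarith [sq_nonneg (c * (l + x) - k * m), mul_nonneg (show 0 ≤ c ^ 2 + k ^ 2 by positivity) (sub_nonneg.2 h)]
  linarith

/-- Serves to eliminate `c` and `k` from `steep_bound` in favour of `ρ`. After squaring, steepness
pays for the `c ^ 2` terms through the mixed product, and the `k ^ 2` terms need exactly `2.4 * x ≤
1`, that is `x ≤ 5 / 12`. -/
lemma slope_small {x c k z ρ : ℝ} (hx : 0 ≤ x) (h5 : x ≤ 5 / 12) (hc : 0 ≤ c) (hk : 0 ≤ k)
    (hz : z ≤ 0.8661) (hkc : c * (c * x) ≤ c * (k * z)) (hρ : ρ ^ 2 = c ^ 2 + k ^ 2) :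
    2.4 * x * ρ ≤ k + x * c * (25 / 16) := by
  apply le_of_sq_le_sq _ (by positivity)
  rw [mul_pow, hρ]
  have h0 : c * (k * z) ≤ c * (k * 0.8661) := by gcongr
  have h1 := mul_le_mul_of_nonneg_left (hkc.trans h0) hx
  have h3 : 0 ≤ 1 - 5.76 * x ^ 2 := by nlinarith
  have h4 := mul_nonneg h3 (sq_nonneg k)
  linarith [sq_nonneg (c * x)]

/-- The counterpart of `slope_small`: with coefficient `1` in front of `ρ` the `k ^ 2` terms cancel,
and `x ≥ 5 / 12` is large enough for the `c ^ 2` terms. -/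
lemma slope_large {x c k z ρ : ℝ} (h5 : 5 / 12 ≤ x) (hc : 0 ≤ c) (hk : 0 ≤ k)
    (hz : z ≤ 0.76) (hkc : c * (c * x) ≤ c * (k * z)) (hρ : ρ ^ 2 = c ^ 2 + k ^ 2) :
    ρ ≤ k + x * c * (25 / 16) := by
  have hx : 0 ≤ x := by linarith
  apply le_of_sq_le_sq _ (by positivity)
  rw [hρ]
  have h0 : c * (k * z) ≤ c * (k * 0.76) := by gcongr
  have h1 := mul_le_mul_of_nonneg_left (hkc.trans h0) hx
  have h3 : 0 ≤ x ^ 2 - 25 / 144 := by nlinarith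
  have h4 := mul_nonneg h3 (sq_nonneg c)
  linarith [sq_nonneg c]

/-- A steep direction `(k, c)` does not point strictly into the normal cone of the lens at its
corner `(0, z)`, so the support function of a single disc is the right bound. It stays below the
optimum. -/
lemma steep_bound {x l m c k : ℝ} (hx : 0 ≤ x) (hx1 : x ≤ 1 / 2) (hc : 0 ≤ c) (hk : 0 ≤ k)
    (hck : c ^ 2 + k ^ 2 ≤ 1) (h : (l + x) ^ 2 + m ^ 2 ≤ 3 / 4)
    (hsteep : c * x ≤ k * √(3 / 4 - x ^ 2)) :
    c * m + k * l + 2 * x * √(1 - (c / 2 + x) ^ 2 - k ^ 2 / 4) < 1.172 := by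
  have hl := lens_support (c := c) (k := k) h
  have hz0 : 0 < √(3 / 4 - x ^ 2) := Real.sqrt_pos.2 (by nlinarith)
  have hz2 := Real.sq_sqrt (show 0 ≤ 3 / 4 - x ^ 2 by nlinarith)
  set z := √(3 / 4 - x ^ 2)
  have hρ0 : 0 ≤ √(c ^ 2 + k ^ 2) := Real.sqrt_nonneg _
  have hρ1 : √(c ^ 2 + k ^ 2) ≤ 1 := Real.sqrt_le_one.2 hck
  have hρ2 := Real.sq_sqrt (show 0 ≤ c ^ 2 + k ^ 2 by positivity)
  set ρ := √(c ^ 2 + k ^ 2)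
  have hc1 : c ≤ 1 := by nlinarith
  have ha := sqrt_le_tangent (a := 1 - (c / 2 + x) ^ 2 - k ^ 2 / 4) (μ := 0.64)
    (by nlinarith [mul_nonneg hx hc, mul_nonneg hx (sub_nonneg.2 hc1)]) (by norm_num)
  have hb := mul_le_mul_of_nonneg_left ha (show 0 ≤ 2 * x by linarith)
  have e : 2 * x * (((1 - (c / 2 + x) ^ 2 - k ^ 2 / 4) / 0.64 + 0.64) / 2)
      = x * (1 - (c ^ 2 + k ^ 2) / 4 - x ^ 2) * (25 / 16) - x * (x * c * (25 / 16)) + 0.64 * x := by ring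
  rw [e, ← hρ2] at hb
  have hkc : c * (c * x) ≤ c * (k * z) := mul_le_mul_of_nonneg_left hsteep hc
  have hz3 : z ≤ 0.8661 := by nlinarith
  rcases le_total x (5 / 12) with h5 | h5
  · have hmin := slope_small hx h5 hc hk hz3 hkc hρ2
    have := far_poly_small hx h5 hρ1
    linarith [mul_le_mul_of_nonneg_left hmin hx]
  · have hmin := slope_large h5 hc hk (show z ≤ 0.76 by nlinarith) hkc hρ2
    have := far_poly_large h5 hx1 hρ0 hρ1
    linarith [mul_le_mul_of_nonneg_left hmin hx]

/-- At `c = 1` both sides would agree. Lowering `c` costs `(1 - c) * z` in the first term and gains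
`2 * x * (w - y)` in the second, where `w ^ 2 - y ^ 2 ≤ (1 - c) * (1 / 2 + x)`. The loss wins
because `x * (1 + 2 * x) < 2 * y * z` as long as `x ≤ 0.38`. -/
lemma near_bound {x c : ℝ} (hx : 0 ≤ x) (hx1 : x ≤ 0.38) (hc : 0 ≤ c) (hc1 : c < 1) :
    c * √(3 / 4 - x ^ 2) + 2 * x * √(1 - (c / 2 + x) ^ 2) < 2 * A (√3 / 2) x := by
  rw [two_mul_A]
  have hz : 0.778 ≤ √(3 / 4 - x ^ 2) := Real.le_sqrt_of_sq_le (by nlinarith)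
  have hy : 0.474 ≤ √(1 - (1 / 2 + x) ^ 2) := Real.le_sqrt_of_sq_le (by nlinarith)
  have hyw : √(1 - (1 / 2 + x) ^ 2) ≤ √(1 - (c / 2 + x) ^ 2) := Real.sqrt_le_sqrt (by nlinarith)
  have hy2 := Real.sq_sqrt (show 0 ≤ 1 - (1 / 2 + x) ^ 2 by nlinarith)
  have hw2 := Real.sq_sqrt (show 0 ≤ 1 - (c / 2 + x) ^ 2 by nlinarith)
  set z := √(3 / 4 - x ^ 2)
  set y := √(1 - (1 / 2 + x) ^ 2)
  set w := √(1 - (c / 2 + x) ^ 2)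
  have hyz : x * (1 + 2 * x) < 2 * y * z := by nlinarith
  have h1 : (w - y) * (w + y) ≤ (1 - c) * (1 / 2 + x) := by nlinarith
  have h2 : 2 * y * (2 * x * (w - y)) < 2 * y * ((1 - c) * z) := by
    have h3 : (w - y) * (2 * y) ≤ (w - y) * (w + y) :=
      mul_le_mul_of_nonneg_left (by linarith) (sub_nonneg.2 hyw)
    have h4 := mul_le_mul_of_nonneg_left (h3.trans h1) (show 0 ≤ 2 * x by linarith)
    have h5 := mul_lt_mul_of_pos_left hyz (sub_pos.2 hc1)
    linarith
  have := lt_of_mul_lt_mul_left h2 (by linarith)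
  linarith

/-- A shallow direction lies in the normal cone at the corner `(0, z)` of the lens, so the linear
form is largest at that corner. -/
lemma lens_shallow {x l m c k : ℝ} (hx : 0 ≤ x) (hx1 : x ≤ 1 / 2) (hc : 0 ≤ c) (hl : 0 ≤ l)
    (h : (l + x) ^ 2 + m ^ 2 ≤ 3 / 4) (hshallow : k * √(3 / 4 - x ^ 2) ≤ c * x) :
    c * m + k * l ≤ c * √(3 / 4 - x ^ 2) := by
  have hz0 : 0 < √(3 / 4 - x ^ 2) := Real.sqrt_pos.2 (by nlinarith)
  have hz2 := Real.sq_sqrt (show 0 ≤ 3 / 4 - x ^ 2 by nlinarith)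
  set z := √(3 / 4 - x ^ 2)
  -- The disc about `(-x, 0)` lies on one side of its tangent at `(0, z)`.
  have hm : z * m ≤ z * z - l * x := by
    apply le_of_sq_le_sq
    · nlinarith [mul_nonneg (sq_nonneg z) (sq_nonneg l)]
    · rcases le_or_gt l (1/2) with h2 | h2
      · nlinarith
      · by_contra! hcon
        nlinarith [sq_nonneg m]
  have : z * (c * m + k * l) ≤ z * (c * z) := by
    nlinarith [mul_le_mul_of_nonneg_left hm hc, mul_le_mul_of_nonneg_left hshallow hl]
  exact le_of_mul_le_mul_left this hz0

set_option maxHeartbeats 1000000 in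
/-- The area bound for the pentagon with vertices `0`, `u₁`, `u₂ = m + (x, 0)`,
`u₃ = m - (x, 0)`, `u₄`, written in terms of `c = u₁ - u₄` and
`n = (u₁ + u₄ - u₂ - u₃) / 2`. -/
theorem pentagon_bound {x₀ : ℝ} (hx₀ : x₀ ∈ Ioo (0 : ℝ) (1 / 2))
    (hmax : ∀ x ∈ Icc (0 : ℝ) (1 / 2), x ≠ x₀ → A (√3 / 2) x < A (√3 / 2) x₀)
    {x m₁ m₂ c₁ c₂ n₁ n₂ : ℝ} (hx : 0 ≤ x) (hx1 : x ≤ 1 / 2) (hxm : 0 ≤ x * m₂)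
    (h2 : (m₁ + x) ^ 2 + m₂ ^ 2 ≤ 3 / 4) (h3 : (m₁ - x) ^ 2 + m₂ ^ 2 ≤ 3 / 4)
    (ha : (n₁ + (c₁ + 2 * x) / 2) ^ 2 + (n₂ + c₂ / 2) ^ 2 ≤ 1)
    (hb : (n₁ - (c₁ + 2 * x) / 2) ^ 2 + (n₂ - c₂ / 2) ^ 2 ≤ 1)
    (hc : c₁ ^ 2 + c₂ ^ 2 ≤ 1) :
    c₁ * m₂ - c₂ * m₁ - 2 * x * n₂ ≤ 2 * A (√3 / 2) x₀ ∧
    (c₁ * m₂ - c₂ * m₁ - 2 * x * n₂ = 2 * A (√3 / 2) x₀ →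
      x = x₀ ∧ c₁ = 1 ∧ c₂ = 0 ∧ m₁ = 0 ∧ m₂ = √(3 / 4 - x₀ ^ 2) ∧ n₁ = 0 ∧
        n₂ = -√(1 - (1 / 2 + x₀) ^ 2)) := by
  have hz0 : 0 ≤ 3 / 4 - x ^ 2 := by clear * - hx hx1; nlinarith
  have hy0 : 0 ≤ 1 - (1 / 2 + x) ^ 2 := by clear * - hx hx1; nlinarith
  have hA : 1.1724 < 2 * A (√3 / 2) x₀ := by
    have := two_mul_A_three_tenths_gt
    by_cases h : (0.3 : ℝ) = x₀
    · rwa [← h]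
    · linarith [hmax 0.3 (by norm_num) h]
  -- Away from the optimum a numerical bound is enough, and it rules out equality at once.
  suffices H : c₁ * m₂ - c₂ * m₁ - 2 * x * n₂ ≤ 1.1724 ∨
      (c₁ * m₂ - c₂ * m₁ - 2 * x * n₂ ≤ 2 * A (√3 / 2) x₀ ∧
      (c₁ * m₂ - c₂ * m₁ - 2 * x * n₂ = 2 * A (√3 / 2) x₀ →
        x = x₀ ∧ c₁ = 1 ∧ c₂ = 0 ∧ m₁ = 0 ∧ m₂ = √(3 / 4 - x₀ ^ 2) ∧ n₁ = 0 ∧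
        n₂ = -√(1 - (1 / 2 + x₀) ^ 2))) by
    rcases H with H | H
    · exact ⟨by linarith, fun h => by linarith⟩
    · exact H
  have hlm : (|m₁| + x) ^ 2 + m₂ ^ 2 ≤ 3 / 4 := by
    rcases abs_choice m₁ with h | h <;> rw [h]
    · exact h2
    · rwa [show (-m₁ + x) ^ 2 = (m₁ - x) ^ 2 by ring]
  -- The mean of the two diagonal bounds, in which the mixed terms cancel.
  have hW : n₁ ^ 2 + n₂ ^ 2 + c₂ ^ 2 / 4 + (c₁ / 2 + x) ^ 2 ≤ 1 := by linarith
  have hcm : -(c₂ * m₁) ≤ |c₂| * |m₁| := by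
    rw [← abs_mul]; exact neg_le_abs _
  have hk2 : |c₂| ^ 2 = c₂ ^ 2 := sq_abs _
  have hk := abs_nonneg c₂
  have hl := abs_nonneg m₁
  have hc1 : c₁ ≤ 1 := (abs_le_of_sq_le_sq' (by linarith [sq_nonneg c₂]) zero_le_one).2
  have hk1 : |c₂| ≤ 1 := abs_le_of_sq_le_sq (by linarith [sq_nonneg c₁]) zero_le_one
  -- For `c₁ ≤ 0` the first term does not help, and the other two give at most `1`. The case `x = 0`
  -- is separate because `hxm` then says nothing about `m₂`.
  rcases le_or_gt c₁ 0 with hc0 | hc0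
  · left
    rcases hx.eq_or_lt with rfl | hxpos
    · have : (c₁ * m₂ - c₂ * m₁) ^ 2 ≤ 1 := by
        linarith [sq_nonneg (c₁ * m₁ + c₂ * m₂), mul_le_mul hc h2 (by positivity) (by positivity)]
      linarith [le_abs_self (c₁ * m₂ - c₂ * m₁), (sq_le_one_iff_abs_le_one _).1 this]
    have hm2 : 0 ≤ m₂ := nonneg_of_mul_nonneg_right hxm hxpos
    have hn : -n₂ ≤ 1 - |c₂| / 2 := by
      have h5 := (abs_le_of_sq_le_sq' (a := n₂ + c₂ / 2) (b := 1)
        (by linarith [sq_nonneg (n₁ + (c₁ + 2 * x) / 2)]) zero_le_one).1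
      have h6 := (abs_le_of_sq_le_sq' (a := n₂ - c₂ / 2) (b := 1)
        (by linarith [sq_nonneg (n₁ - (c₁ + 2 * x) / 2)]) zero_le_one).1
      rcases abs_choice c₂ with h | h <;> rw [h] <;> linarith
    have hl1 : |m₁| + x ≤ 1 :=
      (abs_le_of_sq_le_sq' (by linarith [sq_nonneg m₂]) zero_le_one).2
    have h5 : x * (-n₂) ≤ x * (1 - |c₂| / 2) := mul_le_mul_of_nonneg_left hn hx
    have p1 := mul_nonneg (neg_nonneg.2 hc0) hm2
    have p2 := mul_nonneg hk (sub_nonneg.2 hl1)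
    have p3 := mul_nonneg (sub_nonneg.2 hk1) (sub_nonneg.2 hx1)
    linarith
  have hnW : -n₂ ≤ √(1 - (c₁ / 2 + x) ^ 2 - |c₂| ^ 2 / 4) :=
    Real.le_sqrt_of_sq_le (by linarith [sq_nonneg n₁, neg_sq n₂])
  have hxn := mul_le_mul_of_nonneg_left hnW (show 0 ≤ 2 * x by linarith)
  -- The midpoint `m` lies in the lens with upper corner `(0, z)`. The split is whether the linear
  -- form in `m` peaks at that corner.
  rcases le_total (c₁ * x) (|c₂| * √(3 / 4 - x ^ 2)) with hs | hs
  · left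
    have := steep_bound hx hx1 hc0.le hk (by rwa [hk2]) hlm hs
    linarith
  have hsh := lens_shallow hx hx1 hc0.le hl hlm hs
  have hWW : √(1 - (c₁ / 2 + x) ^ 2 - |c₂| ^ 2 / 4) ≤ √(1 - (c₁ / 2 + x) ^ 2) :=
    Real.sqrt_le_sqrt (by linarith [sq_nonneg |c₂|])
  have hxW := mul_le_mul_of_nonneg_left hWW (show 0 ≤ 2 * x by linarith)
  rcases le_or_gt 0.38 x with h38 | h38
  · left
    have := far_bound_of_large h38 hx1 hc0.le hc1
    linarith
  right
  have hAx : 2 * A (√3 / 2) x ≤ 2 * A (√3 / 2) x₀ ∧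
      (2 * A (√3 / 2) x = 2 * A (√3 / 2) x₀ → x = x₀) := by
    by_cases h : x = x₀
    · simp [h]
    · have := hmax x ⟨hx, hx1⟩ h
      exact ⟨by linarith, fun h => by linarith⟩
  rcases hc1.lt_or_eq with hlt | rfl
  · have := near_bound hx h38.le hc0.le hlt
    exact ⟨by linarith [hAx.1], fun h => by linarith [hAx.1]⟩
  have hc2 : c₂ = 0 := pow_eq_zero_iff two_ne_zero |>.1 (by linarith [sq_nonneg c₂])
  subst hc2
  have e := two_mul_A (x := x)
  simp only [abs_zero, zero_mul, add_zero, one_mul, sub_zero, ne_eq, OfNat.ofNat_ne_zero,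
    not_false_eq_true, zero_pow, zero_div] at hsh hxn hxW hW
  refine ⟨by linarith, fun h => ?_⟩
  have hxx : x = x₀ := hAx.2 (by linarith)
  subst hxx
  have hm2 : m₂ = √(3 / 4 - x ^ 2) := by linarith
  have hxpos : 0 < x := hx₀.1
  have hn2 : n₂ = -√(1 - (1 / 2 + x) ^ 2) := by
    have : 2 * x * (-n₂) = 2 * x * √(1 - (1 / 2 + x) ^ 2) := by linarith
    linarith [mul_left_cancel₀ (by positivity) this]
  have hz2 := Real.sq_sqrt hz0
  have hy2 := Real.sq_sqrt hy0
  refine ⟨rfl, rfl, rfl, ?_, hm2, ?_, hn2⟩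
  · rw [hm2, hz2] at hlm
    have : |m₁| = 0 := by linarith [sq_nonneg |m₁|, mul_pos hxpos hxpos, hl,
        nonpos_of_mul_nonpos_left (show |m₁| * x ≤ 0 by linarith [sq_nonneg |m₁|]) hxpos]
    exact abs_eq_zero.1 this
  · rw [hn2, neg_sq, hy2] at hW
    exact pow_eq_zero_iff two_ne_zero |>.1 (by linarith [sq_nonneg n₁])

/-! ### Volumes of tetrahedra. -/

lemma lintegral_ofReal_polynomial {f F : ℝ → ℝ} {t : ℝ} (ht : 0 ≤ t) (hf : Continuous f)
    (hF : ∀ x, HasDerivAt F (f x) x) (hpos : ∀ x ∈ Icc 0 t, 0 ≤ f x) :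
    ∫⁻ x in Icc 0 t, ENNReal.ofReal (f x) = ENNReal.ofReal (F t - F 0) := by
  rw [← ofReal_integral_eq_lintegral_ofReal]
  · rw [integral_Icc_eq_integral_Ioc, ← intervalIntegral.integral_of_le ht,
      intervalIntegral.integral_eq_sub_of_hasDerivAt (fun x _ => hF x) (hf.intervalIntegrable _ _)]
  · exact hf.continuousOn.integrableOn_Icc
  · exact (ae_restrict_iff' measurableSet_Icc).2 (ae_of_all _ hpos)

lemma volume_corner_triangle {t : ℝ} (ht : 0 ≤ t) :
    volume {p : ℝ × ℝ | 0 ≤ p.1 ∧ 0 ≤ p.2 ∧ p.1 + p.2 ≤ t} = ENNReal.ofReal (t ^ 2 / 2) := by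
  have hm : MeasurableSet {p : ℝ × ℝ | 0 ≤ p.1 ∧ 0 ≤ p.2 ∧ p.1 + p.2 ≤ t} := by
    apply IsClosed.measurableSet
    apply IsClosed.and (isClosed_le (by fun_prop) (by fun_prop))
    apply IsClosed.and (isClosed_le (by fun_prop) (by fun_prop))
      (isClosed_le (by fun_prop) (by fun_prop))
  rw [Measure.volume_eq_prod, Measure.prod_apply hm]
  have : ∀ x : ℝ, volume (Prod.mk x ⁻¹' {p : ℝ × ℝ | 0 ≤ p.1 ∧ 0 ≤ p.2 ∧ p.1 + p.2 ≤ t}) =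
      (Icc 0 t).indicator (fun x => ENNReal.ofReal (t - x)) x := by
    intro x
    by_cases hx : x ∈ Icc 0 t
    · rw [indicator_of_mem hx, show Prod.mk x ⁻¹' {p : ℝ × ℝ | 0 ≤ p.1 ∧ 0 ≤ p.2 ∧ p.1 + p.2 ≤ t} =
        Icc 0 (t - x) by ext y; simp only [mem_preimage, mem_ofPred_eq, hx.1, mem_Icc]; grind,
        Real.volume_Icc, sub_zero]
    · rw [indicator_of_notMem hx, show Prod.mk x ⁻¹' {p : ℝ × ℝ | 0 ≤ p.1 ∧ 0 ≤ p.2 ∧ p.1 + p.2 ≤ t} =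
        ∅ by ext y; simp only [mem_preimage, mem_ofPred_eq, mem_Icc] at hx ⊢; grind, measure_empty]
  simp_rw [this]
  rw [lintegral_indicator measurableSet_Icc,
    lintegral_ofReal_polynomial (F := fun x => -(t - x) ^ 2 / 2) ht (by fun_prop) _
      (fun x hx => by linarith [hx.2])]
  · congr 1; ring
  · intro x
    have h1 : HasDerivAt (fun x : ℝ => t - x) (-1) x := by simpa using (hasDerivAt_id x).const_sub t
    exact ((h1.pow 2).neg.div_const 2).congr_deriv (by norm_num)

lemma volume_corner_tetrahedron_prod :
    volume {p : ℝ × ℝ × ℝ | 0 ≤ p.1 ∧ 0 ≤ p.2.1 ∧ 0 ≤ p.2.2 ∧ p.1 + p.2.1 + p.2.2 ≤ 1} =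
      ENNReal.ofReal (1 / 6) := by
  have hm : MeasurableSet
      {p : ℝ × ℝ × ℝ | 0 ≤ p.1 ∧ 0 ≤ p.2.1 ∧ 0 ≤ p.2.2 ∧ p.1 + p.2.1 + p.2.2 ≤ 1} := by
    apply IsClosed.measurableSet
    apply IsClosed.and (isClosed_le (by fun_prop) (by fun_prop))
    apply IsClosed.and (isClosed_le (by fun_prop) (by fun_prop))
    apply IsClosed.and (isClosed_le (by fun_prop) (by fun_prop))
      (isClosed_le (by fun_prop) (by fun_prop))
  rw [Measure.volume_eq_prod, Measure.prod_apply hm]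
  have : ∀ x : ℝ, volume (Prod.mk x ⁻¹'
      {p : ℝ × ℝ × ℝ | 0 ≤ p.1 ∧ 0 ≤ p.2.1 ∧ 0 ≤ p.2.2 ∧ p.1 + p.2.1 + p.2.2 ≤ 1}) =
      (Icc 0 1).indicator (fun x => ENNReal.ofReal ((1 - x) ^ 2 / 2)) x := by
    intro x
    by_cases hx : x ∈ Icc (0 : ℝ) 1
    · rw [indicator_of_mem hx, ← volume_corner_triangle (by linarith [hx.2])]
      congr 1
      ext y; simp only [mem_preimage, mem_ofPred_eq, hx.1]; grind
    · rw [indicator_of_notMem hx]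
      convert measure_empty (μ := volume)
      ext y; simp only [mem_preimage, mem_ofPred_eq, mem_Icc] at hx ⊢; grind
  simp_rw [this]
  rw [lintegral_indicator measurableSet_Icc,
    lintegral_ofReal_polynomial (F := fun x => -(1 - x) ^ 3 / 6) zero_le_one (by fun_prop) _
      (fun x hx => by positivity)]
  · congr 1; norm_num
  · intro x
    have h1 : HasDerivAt (fun x : ℝ => 1 - x) (-1) x := by simpa using (hasDerivAt_id x).const_sub 1
    exact ((h1.pow 3).neg.div_const 6).congr_deriv (by norm_num; ring)

lemma volume_corner_tetrahedron :
    volume {y : Space 3 | 0 ≤ y 0 ∧ 0 ≤ y 1 ∧ 0 ≤ y 2 ∧ y 0 + y 1 + y 2 ≤ 1} =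
      ENNReal.ofReal (1 / 6) := by
  rw [← volume_corner_tetrahedron_prod]
  have e1 := PiLp.volume_preserving_ofLp (Fin 3)
  have e2 := volume_preserving_piFinSuccAbove (fun _ : Fin 3 => ℝ) 0
  have e3 := volume_preserving_finTwoArrow ℝ
  have e := ((MeasurePreserving.id volume).prod e3).comp (e2.comp e1)
  have hm : MeasurableSet
      {p : ℝ × ℝ × ℝ | 0 ≤ p.1 ∧ 0 ≤ p.2.1 ∧ 0 ≤ p.2.2 ∧ p.1 + p.2.1 + p.2.2 ≤ 1} := by
    apply IsClosed.measurableSet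
    apply IsClosed.and (isClosed_le (by fun_prop) (by fun_prop))
    apply IsClosed.and (isClosed_le (by fun_prop) (by fun_prop))
    apply IsClosed.and (isClosed_le (by fun_prop) (by fun_prop))
      (isClosed_le (by fun_prop) (by fun_prop))
  rw [Measure.volume_eq_prod, ← e.measure_preimage hm.nullMeasurableSet]
  rfl

/-- The determinant of three vectors of `3`-space. -/
def det3 (u v w : Space 3) : ℝ :=
  u 0 * (v 1 * w 2 - v 2 * w 1) - u 1 * (v 0 * w 2 - v 2 * w 0) + u 2 * (v 0 * w 1 - v 1 * w 0)

lemma mem_convexHull_range {ι E : Type*} [Fintype ι] [AddCommGroup E] [Module ℝ E] {f : ι → E}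
    {x : E} : x ∈ convexHull ℝ (range f) ↔
      ∃ w : ι → ℝ, (∀ i, 0 ≤ w i) ∧ ∑ i, w i = 1 ∧ ∑ i, w i • f i = x := by
  classical
  constructor
  · intro hx
    have hconv : Convex ℝ {x : E | ∃ w : ι → ℝ, (∀ i, 0 ≤ w i) ∧ ∑ i, w i = 1 ∧
        ∑ i, w i • f i = x} := by
      rintro _ ⟨v, hv0, hv1, rfl⟩ _ ⟨w, hw0, hw1, rfl⟩ a b ha hb hab
      refine ⟨fun i => a * v i + b * w i, fun i => ?_, ?_, ?_⟩
      · have := hv0 i; have := hw0 i; positivity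
      · rw [Finset.sum_add_distrib, ← Finset.mul_sum, ← Finset.mul_sum, hv1, hw1]; linarith
      · simp [add_smul, mul_smul, Finset.sum_add_distrib, Finset.smul_sum]
    refine convexHull_min ?_ hconv hx
    rintro _ ⟨i, rfl⟩
    exact ⟨Pi.single i 1, fun j => by by_cases h : j = i <;> simp [h],
      by simp, by simp [Pi.single_apply]⟩
  · rintro ⟨w, h0, h1, h2⟩
    exact mem_convexHull_of_exists_fintype w f h0 h1 (fun i => mem_range_self i) h2

lemma mem_convexHull_quad {E : Type*} [AddCommGroup E] [Module ℝ E] {p q a b x : E} :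
    x ∈ convexHull ℝ {p, q, a, b} ↔ ∃ α β γ δ : ℝ, 0 ≤ α ∧ 0 ≤ β ∧ 0 ≤ γ ∧ 0 ≤ δ ∧
      α + β + γ + δ = 1 ∧ α • p + β • q + γ • a + δ • b = x := by
  have : ({p, q, a, b} : Set E) = range ![p, q, a, b] := by
    ext y; simp [eq_comm]; tauto
  rw [this, mem_convexHull_range]
  constructor
  · rintro ⟨w, h0, h1, h2⟩
    exact ⟨w 0, w 1, w 2, w 3, h0 0, h0 1, h0 2, h0 3, by simpa [Fin.sum_univ_four] using h1,
      by simpa [Fin.sum_univ_four] using h2⟩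
  · rintro ⟨α, β, γ, δ, h1, h2, h3, h4, h5, h6⟩
    refine ⟨![α, β, γ, δ], ?_, by simp [Fin.sum_univ_four, h5], by simpa [Fin.sum_univ_four] using h6⟩
    intro i; fin_cases i <;> assumption

/-- The linear endomorphism of `3`-space with given columns. -/
noncomputable def ofColumns (u v w : Space 3) : Space 3 →ₗ[ℝ] Space 3 :=
  Matrix.toLin (EuclideanSpace.basisFun (Fin 3) ℝ).toBasis (EuclideanSpace.basisFun (Fin 3) ℝ).toBasis
    (Matrix.of fun i j => (![u, v, w] j) i)

lemma det_ofColumns (u v w : Space 3) : LinearMap.det (ofColumns u v w) = det3 u v w := by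
  rw [ofColumns, LinearMap.det_toLin, Matrix.det_fin_three]
  simp [det3]; ring

lemma ofColumns_apply (u v w y : Space 3) :
    ofColumns u v w y = y 0 • u + y 1 • v + y 2 • w := by
  ext i
  fin_cases i <;>
  · simp [ofColumns, Matrix.toLin_apply, Matrix.mulVec, dotProduct, Fin.sum_univ_three]
    ring

lemma convexHull_quad_eq_image (p q a b : Space 3) :
    convexHull ℝ {p, q, a, b} = (fun y => p + y) '' (ofColumns (q - p) (a - p) (b - p) ''
      {y : Space 3 | 0 ≤ y 0 ∧ 0 ≤ y 1 ∧ 0 ≤ y 2 ∧ y 0 + y 1 + y 2 ≤ 1}) := by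
  ext x
  rw [mem_convexHull_quad, image_image]
  constructor
  · rintro ⟨α, β, γ, δ, h1, h2, h3, h4, h5, rfl⟩
    refine ⟨!₂[β, γ, δ], by simp; exact ⟨h2, h3, h4, by linarith⟩, ?_⟩
    have : α = 1 - β - γ - δ := by linarith
    simp only [ofColumns_apply, Matrix.cons_val, this]
    module
  · rintro ⟨y, ⟨h1, h2, h3, h4⟩, rfl⟩
    refine ⟨1 - y 0 - y 1 - y 2, y 0, y 1, y 2, by linarith, h1, h2, h3, by ring, ?_⟩
    simp only [ofColumns_apply]
    module

lemma volume_convexHull_quad (p q a b : Space 3) :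
    volume.real (convexHull ℝ {p, q, a, b}) = |det3 (q - p) (a - p) (b - p)| / 6 := by
  rw [convexHull_quad_eq_image, measureReal_def, image_add_left, measure_preimage_add,
    Measure.addHaar_image_linearMap, volume_corner_tetrahedron, det_ofColumns,
    ENNReal.toReal_mul, ENNReal.toReal_ofReal (abs_nonneg _), ENNReal.toReal_ofReal (by norm_num)]
  ring

/-! ### Affine dependences of six points -/

/-- If the signs alternate there are five changes, so the ends differ. In the cyclic order of lines
through the origin the passage from last to first reverses orientation, so opposite signs are what
is wanted there. -/
lemma exists_adjacent_signs {b : Fin 6 → ℝ} (hb : ∀ i, b i ≠ 0) :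
    (∃ i j : Fin 6, i.val + 1 = j.val ∧ 0 < b i * b j) ∨ b 0 * b 5 < 0 := by
  by_contra! h
  obtain ⟨h1, h2⟩ := h
  have key : ∀ i j : Fin 6, i.val + 1 = j.val → b i * b j < 0 := fun i j hij =>
    lt_of_le_of_ne (h1 i j hij) (mul_ne_zero (hb i) (hb j))
  have h01 := key 0 1 rfl
  have h12 := key 1 2 rfl
  have h23 := key 2 3 rfl
  have h34 := key 3 4 rfl
  have h45 := key 4 5 rfl
  have e1 : 0 < (b 0 * b 1) * (b 1 * b 2) := mul_pos_of_neg_of_neg h01 h12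
  have e2 : 0 < (b 2 * b 3) * (b 3 * b 4) := mul_pos_of_neg_of_neg h23 h34
  have e3 := mul_pos e1 e2
  have e4 := mul_neg_of_pos_of_neg e3 h45
  have e5 : (b 1 * b 2 * b 3 * b 4) ^ 2 * (b 0 * b 5) < 0 := by
    calc _ = (b 0 * b 1) * (b 1 * b 2) * ((b 2 * b 3) * (b 3 * b 4)) * (b 4 * b 5) := by ring
      _ < 0 := e4
  have := mul_nonneg (sq_nonneg (b 1 * b 2 * b 3 * b 4)) h2
  linarith

/-- Only finitely many `M` make some coordinate of `e 0 + M * e 1` vanish. With all `b i` nonzero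
the ratios `a i / b i` order the coordinate functionals. -/
lemma exists_nonvanishing_basis {ι : Type*} [Finite ι] {D : Submodule ℝ (ι → ℝ)}
    (hD : Module.finrank ℝ D = 2) (h0 : ∀ i, ∃ l ∈ D, l i ≠ 0) :
    ∃ a b : ι → ℝ, (∀ i, b i ≠ 0) ∧ ∀ l ∈ D, ∃ s t : ℝ, ∀ i, l i = s * a i + t * b i := by
  classical
  have := Fintype.ofFinite ι
  let e := Module.finBasisOfFinrankEq ℝ D hD
  have hrep : ∀ l ∈ D, ∃ s t : ℝ, ∀ i, l i = s * (e 0 : ι → ℝ) i + t * (e 1 : ι → ℝ) i := by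
    intro l hl
    refine ⟨e.repr ⟨l, hl⟩ 0, e.repr ⟨l, hl⟩ 1, fun i => ?_⟩
    have h := e.sum_repr ⟨l, hl⟩
    rw [Fin.sum_univ_two] at h
    exact (congrArg (fun z : D => (z : ι → ℝ) i) h).symm
  obtain ⟨M, hM⟩ := Infinite.exists_notMem_finset
    (Finset.univ.image fun i => -(e 0 : ι → ℝ) i / (e 1 : ι → ℝ) i)
  refine ⟨(e 1 : ι → ℝ), fun i => (e 0 : ι → ℝ) i + M * (e 1 : ι → ℝ) i, fun i hi => ?_,
    fun l hl => ?_⟩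
  · beta_reduce at hi
    by_cases h1 : (e 1 : ι → ℝ) i = 0
    · obtain ⟨l, hl, hli⟩ := h0 i
      obtain ⟨s, t, hst⟩ := hrep l hl
      rw [h1, mul_zero, add_zero] at hi
      exact hli (by rw [hst, hi, h1]; ring)
    · apply hM
      simp only [Finset.mem_image, Finset.mem_univ, true_and]
      exact ⟨i, by field_simp; linarith⟩
  · obtain ⟨s, t, hst⟩ := hrep l hl
    exact ⟨t - s * M, s, fun i => by rw [hst]; ring⟩

/-- A dependence vanishing at `k` is `s * b i * (a i / b i - a k / b k)`. Two neighbours in the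
order of the ratios lie on the same side of every third ratio, so equal signs of `b` suffice for
them; the first and the last lie on opposite sides and need opposite signs. -/
lemma exists_star_pair {D : Submodule ℝ (Fin 6 → ℝ)} (hD : Module.finrank ℝ D = 2) :
    ∃ p q : Fin 6, p ≠ q ∧ ∀ l ∈ D, ∀ j, j ≠ p → j ≠ q → l j = 0 → 0 ≤ l p * l q := by
  by_cases h0 : ∀ i, ∃ l ∈ D, l i ≠ 0
  · obtain ⟨a, b, hb, hl⟩ := exists_nonvanishing_basis hD h0
    set σ := Tuple.sort fun i => a i / b i
    have hσ : Monotone ((fun i => a i / b i) ∘ σ) := Tuple.monotone_sort _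
    have key : ∀ l ∈ D, ∀ k, l (σ k) = 0 → ∃ s : ℝ, ∀ i,
        l (σ i) = s * b (σ i) * (a (σ i) / b (σ i) - a (σ k) / b (σ k)) := by
      intro l hlD k hk
      obtain ⟨s, t, hst⟩ := hl l hlD
      refine ⟨s, fun i => ?_⟩
      have hk' : t = -(s * (a (σ k) / b (σ k))) := by
        have := hst (σ k)
        rw [hk] at this
        field_simp [hb (σ k)]
        linarith
      rw [hst, hk']
      field_simp [hb (σ i)]
      ring
    rcases exists_adjacent_signs (b := b ∘ σ) (fun i => hb _) with ⟨i, j, hij, hpos⟩ | hneg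
    · refine ⟨σ i, σ j, fun h => by have := σ.injective h; omega, fun l hlD m hm1 hm2 hm => ?_⟩
      obtain ⟨k, rfl⟩ := σ.surjective m
      obtain ⟨s, hs⟩ := key l hlD k hm
      rw [hs i, hs j]
      have hprod : 0 ≤ (a (σ i) / b (σ i) - a (σ k) / b (σ k)) *
          (a (σ j) / b (σ j) - a (σ k) / b (σ k)) := by
        have hki : k ≠ i := fun h => hm1 (by rw [h])
        have hkj : k ≠ j := fun h => hm2 (by rw [h])
        rcases lt_or_ge k i with h | h
        · have h1 := hσ h.le
          have h2 := hσ (show k ≤ j by omega)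
          exact mul_nonneg (sub_nonneg.2 h1) (sub_nonneg.2 h2)
        · have h1 := hσ h
          have h2 := hσ (show j ≤ k by omega)
          exact mul_nonneg_of_nonpos_of_nonpos (sub_nonpos.2 h1) (sub_nonpos.2 h2)
      have := mul_nonneg (mul_nonneg (sq_nonneg s) hpos.le) hprod
      simp only [Function.comp] at this
      linarith
    · refine ⟨σ 0, σ 5, fun h => by simpa using σ.injective h, fun l hlD m hm1 hm2 hm => ?_⟩
      obtain ⟨k, rfl⟩ := σ.surjective m
      obtain ⟨s, hs⟩ := key l hlD k hm
      rw [hs 0, hs 5]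
      have h1 := hσ (show 0 ≤ k by omega)
      have h2 := hσ (show k ≤ 5 by omega)
      have := mul_nonneg (mul_nonneg (sq_nonneg s) (neg_nonneg.2 hneg.le))
        (mul_nonneg (sub_nonneg.2 h1) (sub_nonneg.2 h2))
      simp only [Function.comp] at this
      linarith
  -- A coordinate that vanishes on all of `D` makes the product zero, whatever its partner.
  · push Not at h0
    obtain ⟨i, hi⟩ := h0
    obtain ⟨p, hp⟩ : ∃ p : Fin 6, p ≠ i := exists_ne i
    exact ⟨p, i, hp, fun l hl j _ _ _ => by rw [hi l hl, mul_zero]⟩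

/-- The affine dependences of a finite family of points. -/
def dependences {ι : Type*} [Fintype ι] (X : ι → Space 3) : Submodule ℝ (ι → ℝ) :=
  LinearMap.ker ((Fintype.linearCombination ℝ X).prod (Fintype.linearCombination ℝ fun _ => (1 : ℝ)))

lemma mem_dependences {ι : Type*} [Fintype ι] {X : ι → Space 3} {l : ι → ℝ} :
    l ∈ dependences X ↔ ∑ i, l i • X i = 0 ∧ ∑ i, l i = 0 := by
  simp [dependences, Fintype.linearCombination_apply]

/-- In homogeneous coordinates the points span a space of dimension `4`: an interior point can be
displaced in every direction. The kernel has dimension `6 - 4`. -/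
lemma finrank_dependences {X : Fin 6 → Space 3} (hX : (interior (convexHull ℝ (range X))).Nonempty) :
    Module.finrank ℝ (dependences X) = 2 := by
  set T := (Fintype.linearCombination ℝ X).prod (Fintype.linearCombination ℝ fun _ => (1 : ℝ)) with hT
  have hmem : ∀ x ∈ convexHull ℝ (range X), (x, (1 : ℝ)) ∈ LinearMap.range T := by
    intro x hx
    obtain ⟨w, -, h1, h2⟩ := mem_convexHull_range.1 hx
    exact ⟨w, by simp [hT, Fintype.linearCombination_apply, h1, h2]⟩
  have hsurj : LinearMap.range T = ⊤ := by
    obtain ⟨x, hx⟩ := hX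
    have hvec : ∀ v : Space 3, (v, (0 : ℝ)) ∈ LinearMap.range T := by
      intro v
      have hcont : Filter.Tendsto (fun t : ℝ => x + t • v) (nhds 0) (nhds x) := by
        have : Continuous fun t : ℝ => x + t • v := by fun_prop
        simpa using this.tendsto 0
      have hev := hcont.eventually (isOpen_interior.mem_nhds hx)
      obtain ⟨t, ht, ht0⟩ := ((hev.filter_mono nhdsWithin_le_nhds).and
        (self_mem_nhdsWithin : {0}ᶜ ∈ nhdsWithin (0 : ℝ) {0}ᶜ)).exists
      have h1 := hmem _ (interior_subset ht)
      have h2 := hmem _ (interior_subset hx)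
      have h3 := (LinearMap.range T).smul_mem t⁻¹ (sub_mem h1 h2)
      have ht0' : t ≠ 0 := ht0
      convert h3 using 1
      simp [ht0']
    rw [eq_top_iff]
    rintro ⟨v, s⟩ -
    have h2 := (LinearMap.range T).smul_mem s (hmem _ (interior_subset hx))
    have h3 := add_mem (hvec (v - s • x)) h2
    simpa using h3
  have h := LinearMap.finrank_range_add_finrank_ker T
  rw [hsurj, finrank_top] at h
  simp only [Module.finrank_prod, finrank_euclideanSpace, Fintype.card_fin, Module.finrank_self,
    Module.finrank_fintype_fun_eq_card] at h
  change Module.finrank ℝ (LinearMap.ker T) = 2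
  omega

/-! ### Covering by tetrahedra with a common edge -/

lemma exists_perm_zero_one {p q : Fin 6} (h : p ≠ q) : ∃ σ : Equiv.Perm (Fin 6), σ 0 = p ∧ σ 1 = q := by
  refine ⟨Equiv.swap 0 p * Equiv.swap 1 (Equiv.swap 0 p q), ?_, ?_⟩
  · have h0 : (0 : Fin 6) ≠ Equiv.swap 0 p q := fun h0 =>
      h ((Equiv.swap 0 p).injective ((Equiv.swap_apply_right 0 p).trans h0))
    rw [Equiv.Perm.mul_apply, Equiv.swap_apply_of_ne_of_ne zero_ne_one h0, Equiv.swap_apply_left]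
  · simp

/-- The first two points form a pair that meets every facet: any dependence that vanishes at one of
the other points has coefficients of the same sign there. -/
def IsStarred (Y : Fin 6 → Space 3) : Prop :=
  ∀ l ∈ dependences Y, ∀ j, j ≠ 0 → j ≠ 1 → l j = 0 → 0 ≤ l 0 * l 1

lemma exists_isStarred_comp {X : Fin 6 → Space 3}
    (hX : (interior (convexHull ℝ (range X))).Nonempty) :
    ∃ σ : Equiv.Perm (Fin 6), IsStarred (X ∘ σ) := by
  obtain ⟨p, q, hpq, h⟩ := exists_star_pair (finrank_dependences hX)
  obtain ⟨σ, rfl, rfl⟩ := exists_perm_zero_one hpq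
  refine ⟨σ, fun l hl j hj0 hj1 hlj => ?_⟩
  have := h (l ∘ σ.symm) ?_ (σ j) (by simpa using hj0) (by simpa using hj1) (by simpa using hlj)
  · simpa using this
  · rw [mem_dependences] at hl ⊢
    refine ⟨?_, ?_⟩
    · rw [← hl.1, ← Equiv.sum_comp σ]; simp
    · rw [← hl.2, ← Equiv.sum_comp σ]; simp

lemma exists_dependence_vanishing {D : Submodule ℝ (Fin 6 → ℝ)} (hD : Module.finrank ℝ D = 2)
    (j : Fin 6) : ∃ l ∈ D, l ≠ 0 ∧ l j = 0 := by
  let f : D →ₗ[ℝ] ℝ := (LinearMap.proj j).comp D.subtype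
  have : LinearMap.ker f ≠ ⊥ := by
    apply LinearMap.ker_ne_bot_of_finrank_lt
    rw [hD]; simp
  obtain ⟨l, hl, hl0⟩ := Submodule.exists_mem_ne_zero_of_ne_bot this
  exact ⟨l, l.2, by simpa using hl0, hl⟩

/-- As `l` is nonzero with sum zero, it has negative entries; among these the smallest ratio `μ i /
-l i` tells when the first weight runs out. -/
lemma exists_first_vanishing {ι : Type*} [Fintype ι] {μ l : ι → ℝ} (hμ : ∀ i, 0 ≤ μ i)
    (hl : l ≠ 0) (hsum : ∑ i, l i = 0) :
    ∃ s : ℝ, 0 ≤ s ∧ (∀ i, 0 ≤ μ i + s * l i) ∧ ∃ i, l i < 0 ∧ μ i + s * l i = 0 := by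
  classical
  have hne : (Finset.univ.filter fun i => l i < 0).Nonempty := by
    by_contra h
    rw [Finset.not_nonempty_iff_eq_empty, Finset.filter_eq_empty_iff] at h
    push Not at h
    have := (Finset.sum_eq_zero_iff_of_nonneg fun i hi => h hi).1 hsum
    exact hl (funext fun i => this i (Finset.mem_univ i))
  obtain ⟨i, hi, hmin⟩ := Finset.exists_min_image _ (fun i => μ i / -l i) hne
  have hi' : l i < 0 := by simpa using hi
  have hs : 0 ≤ μ i / -l i := div_nonneg (hμ i) (by linarith)
  refine ⟨μ i / -l i, hs, fun j => ?_, i, hi', by field_simp [hi'.ne]; ring⟩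
  rcases lt_or_ge (l j) 0 with hj | hj
  · have h1 := hmin j (by simpa using hj)
    rw [le_div_iff₀ (by linarith)] at h1
    linarith
  · have := hμ j
    positivity

/-- Some nonzero dependence vanishes at `j`, and up to sign it is nonnegative at `0` and `1`. Moving
along it leaves the weight of `j` alone, and the weight that runs out belongs to none of `0`, `1`,
`j`. -/
lemma IsStarred.exists_move {Y : Fin 6 → Space 3} (hY : IsStarred Y)
    (hdim : Module.finrank ℝ (dependences Y) = 2) {μ : Fin 6 → ℝ} (hμ : ∀ i, 0 ≤ μ i) {j : Fin 6}
    (hj0 : j ≠ 0) (hj1 : j ≠ 1) :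
    ∃ ν : Fin 6 → ℝ, (∀ i, 0 ≤ ν i) ∧ ∑ i, ν i = ∑ i, μ i ∧ ∑ i, ν i • Y i = ∑ i, μ i • Y i ∧
      ν j = μ j ∧ ∃ i, i ≠ 0 ∧ i ≠ 1 ∧ i ≠ j ∧ ν i = 0 := by
  obtain ⟨l, hlD, hl0, hlj, h0, h1⟩ : ∃ l ∈ dependences Y, l ≠ 0 ∧ l j = 0 ∧ 0 ≤ l 0 ∧ 0 ≤ l 1 := by
    obtain ⟨l, hlD, hl0, hlj⟩ := exists_dependence_vanishing hdim j
    have hprod := hY l hlD j hj0 hj1 hlj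
    rcases mul_nonneg_iff.1 hprod with h | h
    · exact ⟨l, hlD, hl0, hlj, h⟩
    · exact ⟨-l, neg_mem hlD, neg_ne_zero.2 hl0, by simp [hlj], by simpa using h⟩
  obtain ⟨hD1, hD2⟩ := mem_dependences.1 hlD
  obtain ⟨s, hs, hnn, i, hi, hzero⟩ := exists_first_vanishing hμ hl0 hD2
  refine ⟨fun i => μ i + s * l i, hnn, ?_, ?_, by simp [hlj], i, ?_, ?_, ?_, hzero⟩
  · rw [Finset.sum_add_distrib, ← Finset.mul_sum, hD2]; simp
  · simp only [add_smul, mul_smul, Finset.sum_add_distrib, ← Finset.smul_sum, hD1]; simp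
  · rintro rfl; linarith
  · rintro rfl; linarith
  · rintro rfl; linarith

lemma IsStarred.cover {Y : Fin 6 → Space 3} (hY : IsStarred Y)
    (hdim : Module.finrank ℝ (dependences Y) = 2) {x : Space 3} (hx : x ∈ convexHull ℝ (range Y)) :
    ∃ i j : Fin 4, i < j ∧ x ∈ convexHull ℝ {Y 0, Y 1, Y (Fin.natAdd 2 i), Y (Fin.natAdd 2 j)} := by
  obtain ⟨μ, h0, h1, h2⟩ := mem_convexHull_range.1 hx
  obtain ⟨ν, hν0, hν1, hν2, -, a, ha0, ha1, -, haz⟩ :=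
    hY.exists_move hdim h0 (j := 2) (by decide) (by decide)
  -- Holding `a` fixed preserves the zero just created. The index `2` in the first move was
  -- arbitrary.
  obtain ⟨ξ, hξ0, hξ1, hξ2, hξa, b, hb0, hb1, hba, hbz⟩ := hY.exists_move hdim hν0 ha0 ha1
  have hsum : ∑ i, ξ i = 1 := by rw [hξ1, hν1, h1]
  have hx : ∑ i, ξ i • Y i = x := by rw [hξ2, hν2, h2]
  have haz' : ξ a = 0 := by rw [hξa, haz]
  obtain ⟨i, j, hij, hi, hj, hall⟩ : ∃ i j : Fin 4, i < j ∧ (Fin.natAdd 2 i ≠ a ∧ Fin.natAdd 2 i ≠ b) ∧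
      (Fin.natAdd 2 j ≠ a ∧ Fin.natAdd 2 j ≠ b) ∧
      ∀ k : Fin 6, k = 0 ∨ k = 1 ∨ k = Fin.natAdd 2 i ∨ k = Fin.natAdd 2 j ∨ k = a ∨ k = b := by
    clear * - ha0 ha1 hb0 hb1 hba
    revert a b
    decide
  refine ⟨i, j, hij, ?_⟩
  have : ∑ k ∈ ({0, 1, Fin.natAdd 2 i, Fin.natAdd 2 j} : Finset (Fin 6)), ξ k • Y k = x := by
    rw [← hx]
    apply Finset.sum_subset (Finset.subset_univ _)
    intro k _ hk
    simp only [Finset.mem_insert, Finset.mem_singleton, not_or] at hk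
    rcases hall k with h | h | h | h | h | h
    · exact absurd h hk.1
    · exact absurd h hk.2.1
    · exact absurd h hk.2.2.1
    · exact absurd h hk.2.2.2
    · rw [h, haz', zero_smul]
    · rw [h, hbz, zero_smul]
  have hs : ∑ k ∈ ({0, 1, Fin.natAdd 2 i, Fin.natAdd 2 j} : Finset (Fin 6)), ξ k = 1 := by
    rw [← hsum]
    apply Finset.sum_subset (Finset.subset_univ _)
    intro k _ hk
    simp only [Finset.mem_insert, Finset.mem_singleton, not_or] at hk
    rcases hall k with h | h | h | h | h | h
    · exact absurd h hk.1
    · exact absurd h hk.2.1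
    · exact absurd h hk.2.2.1
    · exact absurd h hk.2.2.2
    · rw [h, haz']
    · rw [h, hbz]
  rw [← this]
  apply (convex_convexHull ℝ _).sum_mem (fun k _ => hξ0 k) hs
  intro k hk
  apply subset_convexHull
  simp only [Finset.mem_insert, Finset.mem_singleton] at hk
  rcases hk with rfl | rfl | rfl | rfl <;> simp

/-! ### Ordering four vectors of the plane by angle -/

/-- Among vectors of the plane with mutual cross products `t`, four can be labelled in the order
of their angles: either within a half-plane, or all around the origin. -/
def HasAngularOrder {ι : Type*} (t : ι → ι → ℝ) : Prop :=
  ∃ a b c d : ι, [a, b, c, d].Nodup ∧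
    ((0 ≤ t a b ∧ 0 ≤ t a c ∧ 0 ≤ t a d ∧ 0 ≤ t b c ∧ 0 ≤ t b d ∧ 0 ≤ t c d) ∨
      (0 ≤ t a b ∧ 0 ≤ t b c ∧ 0 ≤ t c d ∧ 0 ≤ t d a))

/-- The vectors `a`, `b`, `c` go round the origin, and `d` is inserted into one of the three
sectors. This fails only if `d` has all three on one side, and then the Plücker relation is a
vanishing sum of nonnegative terms: it forces `t c a = 0` and a half-plane order. -/
lemma hasAngularOrder_of_cycle {ι : Type*} {t : ι → ι → ℝ} (hanti : ∀ i j, t j i = -t i j)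
    (hpl : ∀ i j k l, t i j * t k l - t i k * t j l + t i l * t j k = 0) {a b c d : ι}
    (hn : [a, b, c, d].Nodup) (hab : 0 ≤ t a b) (hbc : 0 ≤ t b c) (hca : 0 ≤ t c a) :
    HasAngularOrder t := by
  have hp := hpl d a b c
  have h1 := hanti a d
  have h2 := hanti b d
  have h3 := hanti c d
  have h4 := hanti c a
  have c1 : 0 ≤ t a d → 0 ≤ t d b → HasAngularOrder t := fun h h' =>
    ⟨a, d, b, c, by simp at hn ⊢; grind, Or.inr ⟨h, h', hbc, hca⟩⟩
  have c2 : 0 ≤ t b d → 0 ≤ t d c → HasAngularOrder t := fun h h' =>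
    ⟨b, d, c, a, by simp at hn ⊢; grind, Or.inr ⟨h, h', hca, hab⟩⟩
  have c3 : 0 ≤ t c d → 0 ≤ t d a → HasAngularOrder t := fun h h' =>
    ⟨c, d, a, b, by simp at hn ⊢; grind, Or.inr ⟨h, h', hab, hbc⟩⟩
  by_cases hall : 0 < t d a ∧ 0 < t d b ∧ 0 < t d c
  · obtain ⟨k1, k2, k3⟩ := hall
    have m1 := mul_nonneg k1.le hbc
    have m2 := mul_nonneg k2.le hca
    have m3 := mul_nonneg k3.le hab
    have hca0 : t c a = 0 := by
      have : t d b * t c a = 0 := by rw [h4] at hp; linarith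
      exact (mul_eq_zero.1 this).resolve_left k2.ne'
    exact ⟨d, a, b, c, by simp at hn ⊢; grind,
      Or.inl ⟨k1.le, k2.le, k3.le, hab, by linarith, hbc⟩⟩
  by_cases hall' : 0 < t a d ∧ 0 < t b d ∧ 0 < t c d
  · obtain ⟨k1, k2, k3⟩ := hall'
    have m1 := mul_nonneg k1.le hbc
    have m2 := mul_nonneg k2.le hca
    have m3 := mul_nonneg k3.le hab
    have hca0 : t c a = 0 := by
      have : t b d * t c a = 0 := by rw [h4, h1, h2, h3] at hp; linarith
      exact (mul_eq_zero.1 this).resolve_left k2.ne'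
    exact ⟨a, b, c, d, hn, Or.inl ⟨hab, by linarith, k1.le, hbc, k2.le, k3.le⟩⟩
  rcases le_total 0 (t a d) with ha | ha <;> rcases le_total 0 (t b d) with hb | hb <;>
    rcases le_total 0 (t c d) with hc | hc
  · by_cases e1 : t a d = 0
    · exact c3 hc (by linarith)
    by_cases e2 : t b d = 0
    · exact c1 ha (by linarith)
    by_cases e3 : t c d = 0
    · exact c2 hb (by linarith)
    exact absurd ⟨lt_of_le_of_ne ha (Ne.symm e1), lt_of_le_of_ne hb (Ne.symm e2),
      lt_of_le_of_ne hc (Ne.symm e3)⟩ hall'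
  · exact c2 hb (by linarith)
  · exact c1 ha (by linarith)
  · exact c1 ha (by linarith)
  · exact c3 hc (by linarith)
  · exact c2 hb (by linarith)
  · exact c3 hc (by linarith)
  · by_cases e1 : t a d = 0
    · exact c1 e1.ge (by linarith)
    by_cases e2 : t b d = 0
    · exact c2 e2.ge (by linarith)
    by_cases e3 : t c d = 0
    · exact c3 e3.ge (by linarith)
    refine absurd ⟨?_, ?_, ?_⟩ hall
    · linarith [lt_of_le_of_ne ha e1]
    · linarith [lt_of_le_of_ne hb e2]
    · linarith [lt_of_le_of_ne hc e3]

lemma hasAngularOrder_of_chain {ι : Type*} {t : ι → ι → ℝ} (hanti : ∀ i j, t j i = -t i j)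
    (hpl : ∀ i j k l, t i j * t k l - t i k * t j l + t i l * t j k = 0) {a b c d : ι}
    (hn : [a, b, c, d].Nodup) (hab : 0 ≤ t a b) (hbc : 0 ≤ t b c) (hac : 0 ≤ t a c) :
    HasAngularOrder t := by
  have flip : ∀ i j, t i j ≤ 0 → 0 ≤ t j i := fun i j h => by rw [hanti i j]; linarith
  rcases le_total 0 (t a d) with ha | ha <;> rcases le_total 0 (t b d) with hb | hb <;>
    rcases le_total 0 (t c d) with hc | hc
  · exact ⟨a, b, c, d, hn, Or.inl ⟨hab, hac, ha, hbc, hb, hc⟩⟩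
  · exact ⟨a, b, d, c, by simp at hn ⊢; grind, Or.inl ⟨hab, ha, hac, hb, hbc, flip _ _ hc⟩⟩
  · exact hasAngularOrder_of_cycle hanti hpl (a := d) (b := b) (c := c) (d := a)
      (by simp at hn ⊢; grind) (flip _ _ hb) hbc hc
  · exact ⟨a, d, b, c, by simp at hn ⊢; grind,
      Or.inl ⟨ha, hab, hac, flip _ _ hb, flip _ _ hc, hbc⟩⟩
  · exact ⟨d, a, b, c, by simp at hn ⊢; grind, Or.inr ⟨flip _ _ ha, hab, hbc, hc⟩⟩
  · exact hasAngularOrder_of_cycle hanti hpl (a := a) (b := b) (c := d) (d := c)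
      (by simp at hn ⊢; grind) hab hb (flip _ _ ha)
  · exact ⟨d, a, b, c, by simp at hn ⊢; grind, Or.inr ⟨flip _ _ ha, hab, hbc, hc⟩⟩
  · exact ⟨d, a, b, c, by simp at hn ⊢; grind,
      Or.inl ⟨flip _ _ ha, flip _ _ hb, flip _ _ hc, hab, hac, hbc⟩⟩

/-- Four vectors of the plane can be labelled in the order of their angles. -/
lemma hasAngularOrder {ι : Type*} {t : ι → ι → ℝ} (hanti : ∀ i j, t j i = -t i j)
    (hpl : ∀ i j k l, t i j * t k l - t i k * t j l + t i l * t j k = 0) {a b c d : ι}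
    (hn : [a, b, c, d].Nodup) :
    HasAngularOrder t := by
  have flip : ∀ i j, t i j ≤ 0 → 0 ≤ t j i := fun i j h => by rw [hanti i j]; linarith
  wlog hab : 0 ≤ t a b generalizing a b
  · exact this (a := b) (b := a) (by simp at hn ⊢; grind) (flip _ _ (le_of_not_ge hab))
  rcases le_total 0 (t b c) with hbc | hbc <;> rcases le_total 0 (t a c) with hac | hac
  · exact hasAngularOrder_of_chain hanti hpl hn hab hbc hac
  · exact hasAngularOrder_of_cycle hanti hpl hn hab hbc (flip _ _ hac)
  · exact hasAngularOrder_of_chain hanti hpl (a := a) (b := c) (c := b) (d := d)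
      (by simp at hn ⊢; grind) hac (flip _ _ hbc) hab
  · exact hasAngularOrder_of_chain hanti hpl (a := c) (b := a) (c := b) (d := d)
      (by simp at hn ⊢; grind) (flip _ _ hac) hab (flip _ _ hbc)

/-! ### Hexads with a common edge of all tetrahedra -/

/-- The cross product of the projections of two vectors along `v`, scaled by the length of `v`. -/
def tripleFrom (p q : Space 3) (y : Fin 4 → Space 3) (i j : Fin 4) : ℝ :=
  det3 (q - p) (y i - p) (y j - p)

/-- The points `p`, `q` and `y i` are in convex position, their convex hull is covered by
tetrahedra with the edge `p q`, and every facet contains `p` or `q`. -/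
structure IsStarHexad (p q : Space 3) (y : Fin 4 → Space 3) : Prop where
  cover : ∀ x ∈ convexHull ℝ (insert p (insert q (range y))), ∃ i j, i ≠ j ∧
    x ∈ convexHull ℝ {p, q, y i, y j}
  between : ∀ i j k, i ≠ j → i ≠ k → j ≠ k → 0 ≤ det3 (y i - p) (y j - p) (y k - p) *
    (tripleFrom p q y i j + tripleFrom p q y j k + tripleFrom p q y k i -
      det3 (y i - p) (y j - p) (y k - p))
  extreme : ∀ i j k, i ≠ k → j ≠ k → y k ∉ convexHull ℝ {p, q, y i, y j}

/-- The four other vertices are sorted by angle within a half-plane. -/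
def IsFan (p q : Space 3) (y : Fin 4 → Space 3) : Prop :=
  ∀ i j, i < j → 0 ≤ tripleFrom p q y i j

lemma IsStarHexad.comp {p q : Space 3} {y : Fin 4 → Space 3} (h : IsStarHexad p q y)
    {f : Fin 4 → Fin 4} (hf : Function.Injective f) : IsStarHexad p q (y ∘ f) where
  cover x hx := by
    have hs := Finite.surjective_of_injective hf
    rw [hs.range_comp] at hx
    obtain ⟨i, j, hij, hx⟩ := h.cover x hx
    obtain ⟨i, rfl⟩ := hs i
    obtain ⟨j, rfl⟩ := hs j
    exact ⟨i, j, fun e => hij (by rw [e]), hx⟩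
  between i j k hij hik hjk := h.between _ _ _ (hf.ne hij) (hf.ne hik) (hf.ne hjk)
  extreme i j k hik hjk := h.extreme _ _ _ (hf.ne hik) (hf.ne hjk)

/-- Cramer's rule. -/
lemma det3_relation (v a b c : Space 3) :
    det3 v b c • a + det3 v c a • b + det3 v a b • c = det3 a b c • v := by
  ext i
  fin_cases i <;> simp [det3] <;> ring

lemma det3_pluecker (v a b c d : Space 3) :
    det3 v a b * det3 v c d - det3 v a c * det3 v b d + det3 v a d * det3 v b c = 0 := by
  simp only [det3]; ring

lemma det3_swap (v a b : Space 3) : det3 v b a = -det3 v a b := by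
  simp only [det3]; ring

lemma tripleFrom_swap (p q : Space 3) (y : Fin 4 → Space 3) (i j : Fin 4) :
    tripleFrom p q y j i = -tripleFrom p q y i j := det3_swap _ _ _

/-- For distinct indices this is an affine dependence that omits the fourth `y`, so the sign
condition on `p` and `q` applies to it. -/
lemma triple_relation (p q : Space 3) (y : Fin 4 → Space 3) (i j k : Fin 4) :
    tripleFrom p q y j k • y i + tripleFrom p q y k i • y j + tripleFrom p q y i j • y k =
      det3 (y i - p) (y j - p) (y k - p) • q +
      (tripleFrom p q y i j + tripleFrom p q y j k + tripleFrom p q y k i -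
        det3 (y i - p) (y j - p) (y k - p)) • p := by
  have h := det3_relation (q - p) (y i - p) (y j - p) (y k - p)
  rw [← sub_eq_zero] at h ⊢
  rw [← h]
  simp only [tripleFrom]
  module

lemma isStarHexad_of_isStarred {Y : Fin 6 → Space 3} (hY : IsStarred Y)
    (hdim : Module.finrank ℝ (dependences Y) = 2)
    (hext : ∀ k, Y k ∉ convexHull ℝ (Y '' {k}ᶜ)) :
    IsStarHexad (Y 0) (Y 1) fun i => Y (Fin.natAdd 2 i) where
  cover x hx := by
    obtain ⟨i, j, hij, hx⟩ := hY.cover hdim (x := x) (by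
      convert hx using 2
      ext z
      simp only [mem_range, mem_insert_iff]
      constructor
      · rintro ⟨k, rfl⟩
        refine Fin.addCases (m := 2) (n := 4) (fun i => ?_) (fun i => ?_) k
        · fin_cases i
          · exact Or.inl rfl
          · exact Or.inr (Or.inl rfl)
        · exact Or.inr (Or.inr ⟨i, rfl⟩)
      · rintro (rfl | rfl | ⟨i, rfl⟩) <;> exact ⟨_, rfl⟩)
    exact ⟨i, j, hij.ne, hx⟩
  between i j k hij hik hjk := by
    set y : Fin 4 → Space 3 := fun i => Y (Fin.natAdd 2 i) with hy
    obtain ⟨m, hmi, hmj, hmk⟩ : ∃ m : Fin 4, m ≠ i ∧ m ≠ j ∧ m ≠ k := by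
      clear * -
      revert i j k; decide
    have hrel := triple_relation (Y 0) (Y 1) y i j k
    set d := det3 (y i - Y 0) (y j - Y 0) (y k - Y 0)
    set S := tripleFrom (Y 0) (Y 1) y i j + tripleFrom (Y 0) (Y 1) y j k + tripleFrom (Y 0) (Y 1) y k i
      with hS
    let w : Fin 4 → ℝ := Pi.single i (tripleFrom (Y 0) (Y 1) y j k) +
      Pi.single j (tripleFrom (Y 0) (Y 1) y k i) + Pi.single k (tripleFrom (Y 0) (Y 1) y i j)
    have hw1 : ∑ a, w a = S := by
      simp only [w, Pi.add_apply, Finset.sum_add_distrib, Finset.sum_pi_single', Finset.mem_univ,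
        if_true, hS]
      ring
    have hw2 : ∑ a, w a • y a = d • Y 1 + (S - d) • Y 0 := by
      rw [← hrel]
      simp [w, Pi.single_apply, add_smul, Finset.sum_add_distrib]
    -- `triple_relation` read as a dependence of all six points, with coefficient zero at `m`.
    have hD : Fin.cons (d - S) (Fin.cons (-d) w : Fin 5 → ℝ) ∈ dependences Y := by
      rw [mem_dependences]
      refine ⟨?_, ?_⟩
      · rw [Fin.sum_univ_succ, Fin.sum_univ_succ]
        simp only [Fin.cons_zero, Fin.cons_succ]
        have : ∑ a : Fin 4, w a • Y a.succ.succ = ∑ a, w a • y a := by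
          refine Finset.sum_congr rfl fun a _ => ?_
          congr 2
          ext; simp [Fin.natAdd]; omega
        rw [this, hw2]
        change (d - S) • Y 0 + ((-d) • Y 1 + _) = 0
        module
      · rw [Fin.sum_univ_succ, Fin.sum_univ_succ]
        simp only [Fin.cons_zero, Fin.cons_succ]
        rw [hw1]; ring
    have h := hY _ hD m.succ.succ (by simp) (by
        intro h
        have := congrArg Fin.val h
        simp at this) (by simp [w, hmi, hmj, hmk])
    have h' : 0 ≤ (d - S) * (-d) := h
    linarith
  extreme i j k hik hjk hmem := by
    apply hext (Fin.natAdd 2 k)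
    refine convexHull_mono ?_ hmem
    rintro z (rfl | rfl | rfl | rfl)
    · exact ⟨0, by simp [Fin.ext_iff]; omega, rfl⟩
    · exact ⟨1, by simp [Fin.ext_iff]; omega, rfl⟩
    · exact ⟨_, by simpa [Fin.ext_iff] using hik, rfl⟩
    · exact ⟨_, by simpa [Fin.ext_iff] using hjk, rfl⟩

namespace IsStarHexad
variable {p q : Space 3} {y : Fin 4 → Space 3}

/-- The projection of a vertex lies strictly beyond the line through its two neighbours. -/
lemma orientation_pos (h : IsStarHexad p q y) {i j k : Fin 4} (hij : i ≠ j) (hik : i ≠ k)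
    (hjk : j ≠ k) (h1 : 0 ≤ tripleFrom p q y i j) (h2 : 0 ≤ tripleFrom p q y j k)
    (h3 : 0 < tripleFrom p q y i k) :
    tripleFrom p q y i k < tripleFrom p q y i j + tripleFrom p q y j k := by
  by_contra! hcon
  have hb := h.between i j k hij hik hjk
  have hrel := triple_relation p q y i j k
  rw [tripleFrom_swap p q y i k] at hb hrel
  apply h.extreme i k j hij hjk.symm
  set d := det3 (y i - p) (y j - p) (y k - p)
  set a := tripleFrom p q y i j
  set b := tripleFrom p q y j k
  set c := tripleFrom p q y i k
  have hd : d ≤ 0 ∧ a + b + -c - d ≤ 0 := by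
    rcases mul_nonneg_iff.1 hb with hb | hb
    · exact ⟨by linarith [hb.1, hb.2], by linarith [hb.1, hb.2]⟩
    · exact hb
  -- Solving the relation for `y j` now gives nonnegative weights, against extremality.
  rw [mem_convexHull_quad]
  refine ⟨-(a + b + -c - d) / c, -d / c, b / c, a / c, div_nonneg (by linarith) h3.le,
    div_nonneg (by linarith) h3.le, div_nonneg h2 h3.le, div_nonneg h1 h3.le, by field_simp; ring, ?_⟩
  have : c • y j = b • y i + a • y k - d • q - (a + b + -c - d) • p := by
    rw [sub_sub, ← hrel]; module
  have hy : y j = c⁻¹ • (c • y j) := by rw [smul_smul, inv_mul_cancel₀ h3.ne', one_smul]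
  rw [hy, this]
  simp only [div_eq_inv_mul]
  module

/-- The relation expresses `y j` with positive sum of the coefficients of `p` and `q` moved across.
Trading weight of `y i` and `y k` for `y j` keeps all weights nonnegative until `y i` or `y k` is
used up; comparing `γ * a` with `δ * b` tells which comes first. -/
lemma subset_of_pos (h : IsStarHexad p q y) {i j k : Fin 4} (hij : i ≠ j) (hik : i ≠ k)
    (hjk : j ≠ k) (h1 : 0 ≤ tripleFrom p q y i j) (h2 : 0 ≤ tripleFrom p q y j k)
    (h3 : 0 < tripleFrom p q y i k) :
    convexHull ℝ {p, q, y i, y k} ⊆ convexHull ℝ {p, q, y i, y j} ∪ convexHull ℝ {p, q, y j, y k} := by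
  have hS := h.orientation_pos hij hik hjk h1 h2 h3
  have hb := h.between i j k hij hik hjk
  have hrel := triple_relation p q y i j k
  rw [tripleFrom_swap p q y i k] at hb hrel
  intro x hx
  set d := det3 (y i - p) (y j - p) (y k - p)
  set a := tripleFrom p q y i j
  set b := tripleFrom p q y j k
  set c := tripleFrom p q y i k
  have hd : 0 ≤ d ∧ 0 ≤ a + b + -c - d := by
    rcases mul_nonneg_iff.1 hb with hb | hb
    · exact hb
    · exact ⟨by linarith [hb.1, hb.2], by linarith [hb.1, hb.2]⟩
  have hyj : c • y j = b • y i + a • y k - d • q - (a + b + -c - d) • p := by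
    rw [sub_sub, ← hrel]; module
  obtain ⟨α, β, γ, δ, hα, hβ, hγ, hδ, hsum, rfl⟩ := mem_convexHull_quad.1 hx
  rcases hγ.eq_or_lt with rfl | hγ'
  · exact Or.inr (mem_convexHull_quad.2 ⟨α, β, 0, δ, hα, hβ, le_rfl, hδ, hsum, by module⟩)
  rcases hδ.eq_or_lt with rfl | hδ'
  · exact Or.inl (mem_convexHull_quad.2 ⟨α, β, γ, 0, hα, hβ, hγ, le_rfl, by linarith, by module⟩)
  rcases le_total (γ * a) (δ * b) with hle | hle
  · right
    have hbpos : 0 < b := by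
      by_contra! h0
      have ha : 0 < a := by linarith
      have := mul_pos hγ' ha
      have := mul_nonneg hδ (neg_nonneg.2 h0)
      linarith
    refine mem_convexHull_quad.2 ⟨α + γ / b * (a + b + -c - d), β + γ / b * d, γ / b * c, δ - γ / b * a,
      ?_, ?_, ?_, ?_, ?_, ?_⟩
    · have := div_nonneg hγ h2; have := mul_nonneg this hd.2; linarith
    · have := div_nonneg hγ h2; have := mul_nonneg this hd.1; linarith
    · have := div_nonneg hγ h2; positivity
    · rw [sub_nonneg, div_mul_eq_mul_div, div_le_iff₀ hbpos]; exact hle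
    · field_simp; linear_combination b * hsum
    · have e : (γ / b * c) • y j = (γ / b) • (c • y j) := by rw [smul_smul]
      have e2 : γ • y i = (γ / b) • (b • y i) := by rw [smul_smul, div_mul_cancel₀ _ hbpos.ne']
      rw [e, hyj, e2]
      module
  · left
    have hapos : 0 < a := by
      by_contra! h0
      have hb : 0 < b := by linarith
      have := mul_pos hδ' hb
      have := mul_nonneg hγ (neg_nonneg.2 h0)
      linarith
    refine mem_convexHull_quad.2 ⟨α + δ / a * (a + b + -c - d), β + δ / a * d, γ - δ / a * b, δ / a * c,
      ?_, ?_, ?_, ?_, ?_, ?_⟩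
    · have := div_nonneg hδ h1; have := mul_nonneg this hd.2; linarith
    · have := div_nonneg hδ h1; have := mul_nonneg this hd.1; linarith
    · rw [sub_nonneg, div_mul_eq_mul_div, div_le_iff₀ hapos]; exact hle
    · have := div_nonneg hδ h1; positivity
    · field_simp; linear_combination a * hsum
    · have e : (δ / a * c) • y j = (δ / a) • (c • y j) := by rw [smul_smul]
      have e2 : δ • y k = (δ / a) • (a • y k) := by rw [smul_smul, div_mul_cancel₀ _ hapos.ne']
      rw [e, hyj, e2]
      module

lemma volume_tetrahedron (p q : Space 3) (y : Fin 4 → Space 3) (i j : Fin 4) :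
    volume.real (convexHull ℝ {p, q, y i, y j}) = |tripleFrom p q y i j| / 6 :=
  volume_convexHull_quad p q (y i) (y j)

lemma volume_convexHull_finite_ne_top {s : Set (Space 3)} (hs : s.Finite) :
    volume (convexHull ℝ s) ≠ ⊤ :=
  (hs.isCompact_convexHull ℝ).measure_lt_top.ne

/-- The degenerate tetrahedra are negligible. -/
lemma volume_le_of_subset {K : Set (Space 3)} {s : Finset (Fin 4 × Fin 4)}
    (hK : ∀ x ∈ K, (∃ i j, tripleFrom p q y i j = 0 ∧ x ∈ convexHull ℝ {p, q, y i, y j}) ∨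
      ∃ a ∈ s, x ∈ convexHull ℝ {p, q, y a.1, y a.2}) :
    volume.real K ≤ (∑ a ∈ s, |tripleFrom p q y a.1 a.2|) / 6 := by
  classical
  set Z : Finset (Fin 4 × Fin 4) := Finset.univ.filter fun a => tripleFrom p q y a.1 a.2 = 0
  set T : Fin 4 × Fin 4 → Set (Space 3) := fun a => convexHull ℝ {p, q, y a.1, y a.2}
  have hfin : ∀ a, volume (T a) ≠ ⊤ := fun a => volume_convexHull_finite_ne_top (by simp)
  have hsub : K ⊆ ⋃ a ∈ Z ∪ s, T a := by
    intro x hx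
    simp only [mem_iUnion]
    rcases hK x hx with ⟨i, j, h0, hx⟩ | ⟨a, ha, hx⟩
    · exact ⟨(i, j), by simp [Z, h0], hx⟩
    · exact ⟨a, by simp [ha], hx⟩
  calc volume.real K ≤ volume.real (⋃ a ∈ Z ∪ s, T a) := measureReal_mono hsub
        ((measure_biUnion_lt_top (Finset.finite_toSet _) fun a _ => (hfin a).lt_top).ne)
    _ ≤ ∑ a ∈ Z ∪ s, volume.real (T a) := measureReal_biUnion_finset_le _ _
    _ ≤ ∑ a ∈ Z, volume.real (T a) + ∑ a ∈ s, volume.real (T a) := by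
        rw [← Finset.sum_union_inter]
        exact le_add_of_nonneg_right (Finset.sum_nonneg fun _ _ => measureReal_nonneg)
    _ = (∑ a ∈ s, |tripleFrom p q y a.1 a.2|) / 6 := by
        have : ∑ a ∈ Z, volume.real (T a) = 0 := by
          refine Finset.sum_eq_zero fun a ha => ?_
          have ha' : tripleFrom p q y a.1 a.2 = 0 := by simpa [Z] using ha
          simp only [T]
          rw [volume_tetrahedron, ha']; simp
        rw [this, zero_add, Finset.sum_div]
        exact Finset.sum_congr rfl fun a _ => volume_tetrahedron p q y a.1 a.2

lemma convexHull_quad_swap (p q a b : Space 3) :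
    convexHull ℝ {p, q, a, b} = convexHull ℝ {p, q, b, a} := by
  rw [Set.pair_comm a b]

/-- A tetrahedron over non-consecutive vertices is split at a vertex in between, or is flat and
hence negligible. -/
lemma volume_le_of_isFan (h : IsStarHexad p q y) (hf : IsFan p q y) :
    volume.real (convexHull ℝ (insert p (insert q (range y)))) ≤
      (tripleFrom p q y 0 1 + tripleFrom p q y 1 2 + tripleFrom p q y 2 3) / 6 := by
  have h01 := hf 0 1 (by decide)
  have h12 := hf 1 2 (by decide)
  have h23 := hf 2 3 (by decide)
  have key := volume_le_of_subset (p := p) (q := q) (y := y)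
    (K := convexHull ℝ (insert p (insert q (range y)))) (s := {(0, 1), (1, 2), (2, 3)}) ?_
  · simpa [abs_of_nonneg h01, abs_of_nonneg h12, abs_of_nonneg h23, add_assoc] using key
  have c02 : ∀ x ∈ convexHull ℝ {p, q, y 0, y 2}, tripleFrom p q y 0 2 = 0 ∨
      x ∈ convexHull ℝ {p, q, y 0, y 1} ∪ convexHull ℝ {p, q, y 1, y 2} := fun x hx => by
    rcases (hf 0 2 (by decide)).eq_or_lt with h0 | h0
    · exact Or.inl h0.symm
    · exact Or.inr (h.subset_of_pos (by decide) (by decide) (by decide) h01 h12 h0 hx)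
  have c13 : ∀ x ∈ convexHull ℝ {p, q, y 1, y 3}, tripleFrom p q y 1 3 = 0 ∨
      x ∈ convexHull ℝ {p, q, y 1, y 2} ∪ convexHull ℝ {p, q, y 2, y 3} := fun x hx => by
    rcases (hf 1 3 (by decide)).eq_or_lt with h0 | h0
    · exact Or.inl h0.symm
    · exact Or.inr (h.subset_of_pos (by decide) (by decide) (by decide) h12 h23 h0 hx)
  have c03 : ∀ x ∈ convexHull ℝ {p, q, y 0, y 3}, tripleFrom p q y 0 3 = 0 ∨
      x ∈ convexHull ℝ {p, q, y 0, y 1} ∪ convexHull ℝ {p, q, y 1, y 3} := fun x hx => by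
    rcases (hf 0 3 (by decide)).eq_or_lt with h0 | h0
    · exact Or.inl h0.symm
    · exact Or.inr (h.subset_of_pos (by decide) (by decide) (by decide) h01 (hf 1 3 (by decide)) h0 hx)
  have a01 : ∀ x ∈ convexHull ℝ {p, q, y 0, y 1},
      ∃ a ∈ ({(0, 1), (1, 2), (2, 3)} : Finset (Fin 4 × Fin 4)), x ∈ convexHull ℝ {p, q, y a.1, y a.2} :=
    fun x hx => ⟨(0, 1), by simp, hx⟩
  have a12 : ∀ x ∈ convexHull ℝ {p, q, y 1, y 2},
      ∃ a ∈ ({(0, 1), (1, 2), (2, 3)} : Finset (Fin 4 × Fin 4)), x ∈ convexHull ℝ {p, q, y a.1, y a.2} :=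
    fun x hx => ⟨(1, 2), by simp, hx⟩
  have a23 : ∀ x ∈ convexHull ℝ {p, q, y 2, y 3},
      ∃ a ∈ ({(0, 1), (1, 2), (2, 3)} : Finset (Fin 4 × Fin 4)), x ∈ convexHull ℝ {p, q, y a.1, y a.2} :=
    fun x hx => ⟨(2, 3), by simp, hx⟩
  intro x hx
  obtain ⟨i, j, hij, hx⟩ := h.cover x hx
  wlog hlt : i < j generalizing i j
  · exact this j i hij.symm (by rwa [convexHull_quad_swap]) (lt_of_le_of_ne (not_lt.1 hlt) hij.symm)
  have cases : (i = 0 ∧ j = 1) ∨ (i = 0 ∧ j = 2) ∨ (i = 0 ∧ j = 3) ∨ (i = 1 ∧ j = 2) ∨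
      (i = 1 ∧ j = 3) ∨ (i = 2 ∧ j = 3) := by
    clear * - hlt; revert i j; decide
  rcases cases with ⟨rfl, rfl⟩ | ⟨rfl, rfl⟩ | ⟨rfl, rfl⟩ | ⟨rfl, rfl⟩ | ⟨rfl, rfl⟩ | ⟨rfl, rfl⟩
  · exact Or.inr (a01 x hx)
  · rcases c02 x hx with h0 | h0 | h0
    · exact Or.inl ⟨0, 2, h0, hx⟩
    · exact Or.inr (a01 x h0)
    · exact Or.inr (a12 x h0)
  · rcases c03 x hx with h0 | h0 | h0
    · exact Or.inl ⟨0, 3, h0, hx⟩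
    · exact Or.inr (a01 x h0)
    rcases c13 x h0 with h1 | h1 | h1
    · exact Or.inl ⟨1, 3, h1, h0⟩
    · exact Or.inr (a12 x h1)
    · exact Or.inr (a23 x h1)
  · exact Or.inr (a12 x hx)
  · rcases c13 x hx with h1 | h1 | h1
    · exact Or.inl ⟨1, 3, h1, hx⟩
    · exact Or.inr (a12 x h1)
    · exact Or.inr (a23 x h1)
  · exact Or.inr (a23 x hx)

/-- The sign of the triple of `i` and `k` decides whether the diagonal tetrahedron is split at `j`
or at `m`. -/
lemma subset_of_cycle (h : IsStarHexad p q y) {i j k m : Fin 4} (hn : [i, j, k, m].Nodup)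
    (hij : 0 ≤ tripleFrom p q y i j) (hjk : 0 ≤ tripleFrom p q y j k)
    (hkm : 0 ≤ tripleFrom p q y k m) (hmi : 0 ≤ tripleFrom p q y m i) {x : Space 3}
    (hx : x ∈ convexHull ℝ {p, q, y i, y k}) :
    tripleFrom p q y i k = 0 ∨ x ∈ convexHull ℝ {p, q, y i, y j} ∨ x ∈ convexHull ℝ {p, q, y j, y k} ∨
      x ∈ convexHull ℝ {p, q, y k, y m} ∨ x ∈ convexHull ℝ {p, q, y m, y i} := by
  simp only [List.nodup_cons, List.mem_cons, List.not_mem_nil, not_or, or_false] at hn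
  rcases lt_trichotomy 0 (tripleFrom p q y i k) with h0 | h0 | h0
  · rcases h.subset_of_pos hn.1.1 hn.1.2.1 hn.2.1.1 hij hjk h0 hx with h1 | h1
    · exact Or.inr (Or.inl h1)
    · exact Or.inr (Or.inr (Or.inl h1))
  · exact Or.inl h0.symm
  · rw [convexHull_quad_swap] at hx
    have h0' : 0 < tripleFrom p q y k i := by rw [tripleFrom_swap]; linarith
    rcases h.subset_of_pos hn.2.2.1 (Ne.symm hn.1.2.1) (Ne.symm hn.1.2.2) hkm hmi h0' hx with h1 | h1
    · exact Or.inr (Or.inr (Or.inr (Or.inl h1)))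
    · exact Or.inr (Or.inr (Or.inr (Or.inr h1)))

/-- The four cross products round the cycle add up to the cross product of the two diagonals. -/
lemma volume_le_of_cycle (h : IsStarHexad p q y) (h01 : 0 ≤ tripleFrom p q y 0 1)
    (h12 : 0 ≤ tripleFrom p q y 1 2) (h23 : 0 ≤ tripleFrom p q y 2 3)
    (h30 : 0 ≤ tripleFrom p q y 3 0) :
    volume.real (convexHull ℝ (insert p (insert q (range y)))) ≤
      det3 (q - p) (y 0 - y 2) (y 1 - y 3) / 6 := by
  have key := volume_le_of_subset (p := p) (q := q) (y := y)
    (K := convexHull ℝ (insert p (insert q (range y)))) (s := {(0, 1), (1, 2), (2, 3), (3, 0)}) ?_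
  · have e : det3 (q - p) (y 0 - y 2) (y 1 - y 3) = tripleFrom p q y 0 1 + (tripleFrom p q y 1 2 +
        (tripleFrom p q y 2 3 + tripleFrom p q y 3 0)) := by
      simp only [tripleFrom, det3, PiLp.sub_apply]; ring
    rw [e]
    simpa [abs_of_nonneg h01, abs_of_nonneg h12, abs_of_nonneg h23, abs_of_nonneg h30] using key
  intro x hx
  have fin : (x ∈ convexHull ℝ {p, q, y 0, y 1} ∨ x ∈ convexHull ℝ {p, q, y 1, y 2} ∨
      x ∈ convexHull ℝ {p, q, y 2, y 3} ∨ x ∈ convexHull ℝ {p, q, y 3, y 0}) →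
      ∃ a ∈ ({(0, 1), (1, 2), (2, 3), (3, 0)} : Finset (Fin 4 × Fin 4)),
        x ∈ convexHull ℝ {p, q, y a.1, y a.2} := by
    rintro (h1 | h1 | h1 | h1)
    · exact ⟨(0, 1), by simp, h1⟩
    · exact ⟨(1, 2), by simp, h1⟩
    · exact ⟨(2, 3), by simp, h1⟩
    · exact ⟨(3, 0), by simp, h1⟩
  obtain ⟨i, j, hij, hx⟩ := h.cover x hx
  wlog hlt : i < j generalizing i j
  · exact this j i hij.symm (by rwa [convexHull_quad_swap]) (lt_of_le_of_ne (not_lt.1 hlt) hij.symm)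
  have cases : (i = 0 ∧ j = 1) ∨ (i = 0 ∧ j = 2) ∨ (i = 0 ∧ j = 3) ∨ (i = 1 ∧ j = 2) ∨
      (i = 1 ∧ j = 3) ∨ (i = 2 ∧ j = 3) := by
    clear * - hlt; revert i j; decide
  rcases cases with ⟨rfl, rfl⟩ | ⟨rfl, rfl⟩ | ⟨rfl, rfl⟩ | ⟨rfl, rfl⟩ | ⟨rfl, rfl⟩ | ⟨rfl, rfl⟩
  · exact Or.inr (fin (Or.inl hx))
  · rcases h.subset_of_cycle (i := 0) (j := 1) (k := 2) (m := 3) (by decide) h01 h12 h23 h30 hx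
      with h0 | h0
    · exact Or.inl ⟨0, 2, h0, hx⟩
    · exact Or.inr (fin h0)
  · rw [convexHull_quad_swap] at hx
    exact Or.inr (fin (Or.inr (Or.inr (Or.inr hx))))
  · exact Or.inr (fin (Or.inr (Or.inl hx)))
  · rcases h.subset_of_cycle (i := 1) (j := 2) (k := 3) (m := 0) (by decide) h12 h23 h30 h01 hx
      with h0 | h0
    · exact Or.inl ⟨1, 3, h0, hx⟩
    · exact Or.inr (fin (by tauto))
  · exact Or.inr (fin (Or.inr (Or.inr (Or.inl hx))))

end IsStarHexad
/-! ### Polytopes with six vertices -/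

lemma dist_sq_three (a b : Space 3) :
    dist a b ^ 2 = (a 0 - b 0) ^ 2 + (a 1 - b 1) ^ 2 + (a 2 - b 2) ^ 2 := by
  rw [EuclideanSpace.dist_eq, Real.sq_sqrt (by positivity), Fin.sum_univ_three]
  simp [Real.dist_eq, sq_abs]

lemma dist_le_one_iff {a b : Space 3} :
    dist a b ≤ 1 ↔ (a 0 - b 0) ^ 2 + (a 1 - b 1) ^ 2 + (a 2 - b 2) ^ 2 ≤ 1 := by
  rw [← dist_sq_three, sq_le_one_iff₀ dist_nonneg]

/-- Hadamard's inequality: Cauchy–Schwarz for `u` against the cross product, then Lagrange's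
identity. -/
lemma det3_sq_le (u v w : Space 3) :
    det3 u v w ^ 2 ≤ (u 0 ^ 2 + u 1 ^ 2 + u 2 ^ 2) * ((v 0 ^ 2 + v 1 ^ 2 + v 2 ^ 2) *
      (w 0 ^ 2 + w 1 ^ 2 + w 2 ^ 2)) := by
  have h1 : det3 u v w ^ 2 ≤ (u 0 ^ 2 + u 1 ^ 2 + u 2 ^ 2) * ((v 1 * w 2 - v 2 * w 1) ^ 2 +
      (v 0 * w 2 - v 2 * w 0) ^ 2 + (v 0 * w 1 - v 1 * w 0) ^ 2) := by
    simp only [det3]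
    linarith [sq_nonneg (u 0 * (v 0 * w 2 - v 2 * w 0) + u 1 * (v 1 * w 2 - v 2 * w 1)),
      sq_nonneg (u 0 * (v 0 * w 1 - v 1 * w 0) - u 2 * (v 1 * w 2 - v 2 * w 1)),
      sq_nonneg (u 1 * (v 0 * w 1 - v 1 * w 0) + u 2 * (v 0 * w 2 - v 2 * w 0))]
  refine h1.trans (mul_le_mul_of_nonneg_left ?_ (by positivity))
  linarith [sq_nonneg (v 0 * w 0 + v 1 * w 1 + v 2 * w 2)]

lemma det3_le_one {p q a b c d : Space 3} (h1 : dist p q ≤ 1) (h2 : dist a b ≤ 1)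
    (h3 : dist c d ≤ 1) : det3 (p - q) (a - b) (c - d) ≤ 1 := by
  rw [dist_le_one_iff] at h1 h2 h3
  have h := det3_sq_le (p - q) (a - b) (c - d)
  simp only [PiLp.sub_apply] at h
  have : det3 (p - q) (a - b) (c - d) ^ 2 ≤ 1 :=
    h.trans (mul_le_one₀ h1 (by positivity) (mul_le_one₀ h2 (by positivity) h3))
  exact (abs_le_of_sq_le_sq' (by linarith) zero_le_one).2

lemma notMem_convexHull_of_mem_vertices {n : ℕ} {K t : Set (Space n)} (hK : Convex ℝ K)
    {v : Space n} (hv : v ∈ vertices K) (ht : t ⊆ K) (hvt : v ∉ t) : v ∉ convexHull ℝ t := fun h =>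
  hvt (extremePoints_convexHull_subset
    (inter_extremePoints_subset_extremePoints_of_subset (convexHull_min ht hK) ⟨h, hv⟩))

lemma IsPolytope.finite_vertices {n : ℕ} {K : Set (Space n)} (hK : IsPolytope K) :
    (vertices K).Finite := by
  obtain ⟨⟨s, rfl⟩, -⟩ := hK
  exact s.finite_toSet.subset extremePoints_convexHull_subset

lemma IsPolytope.convex {n : ℕ} {K : Set (Space n)} (hK : IsPolytope K) : Convex ℝ K := by
  obtain ⟨⟨s, rfl⟩, -⟩ := hK
  exact convex_convexHull ℝ _

lemma IsPolytope.isCompact {n : ℕ} {K : Set (Space n)} (hK : IsPolytope K) : IsCompact K := by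
  obtain ⟨⟨s, rfl⟩, -⟩ := hK
  exact s.finite_toSet.isCompact_convexHull ℝ

lemma IsPolytope.convexHull_vertices {n : ℕ} {K : Set (Space n)} (hK : IsPolytope K) :
    convexHull ℝ (vertices K) = K := by
  rw [← (hK.finite_vertices.isCompact_convexHull ℝ).isClosed.closure_eq]
  exact closure_convexHull_extremePoints hK.isCompact hK.convex

/-- A polytope with vertices `p`, `q`, `y i`, where all tetrahedra share the edge `p q`. -/
structure IsStarPolytope (K : Set (Space 3)) (p q : Space 3) (y : Fin 4 → Space 3) : Prop where
  isStarHexad : IsStarHexad p q y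
  isPolytope : IsPolytope K
  vertices_eq : vertices K = insert p (insert q (range y))
  injective : Function.Injective y
  ne : p ≠ q
  ne_left : ∀ i, p ≠ y i
  ne_right : ∀ i, q ≠ y i

lemma IsStarPolytope.eq_convexHull {K : Set (Space 3)} {p q : Space 3} {y : Fin 4 → Space 3}
    (h : IsStarPolytope K p q y) : K = convexHull ℝ (insert p (insert q (range y))) := by
  rw [← h.vertices_eq, h.isPolytope.convexHull_vertices]

lemma IsStarPolytope.comp {K : Set (Space 3)} {p q : Space 3} {y : Fin 4 → Space 3}
    (h : IsStarPolytope K p q y) {f : Fin 4 → Fin 4} (hf : Function.Injective f) :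
    IsStarPolytope K p q (y ∘ f) where
  isStarHexad := h.isStarHexad.comp hf
  isPolytope := h.isPolytope
  vertices_eq := by rw [h.vertices_eq, (Finite.surjective_of_injective hf).range_comp]
  injective := h.injective.comp hf
  ne := h.ne
  ne_left i := h.ne_left _
  ne_right i := h.ne_right _

lemma exists_isStarPolytope {K : Set (Space 3)} (hK : IsPolytope K) (hcard : (vertices K).ncard = 6) :
    ∃ p q y, IsStarPolytope K p q y := by
  obtain ⟨X, hinj, hran⟩ : ∃ X : Fin 6 → Space 3, Function.Injective X ∧ range X = vertices K := by
    rw [Set.ncard_eq_toFinset_card _ hK.finite_vertices] at hcard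
    let e := (Finset.equivFinOfCardEq hcard).symm
    refine ⟨fun i => e i, Subtype.val_injective.comp e.injective, ?_⟩
    ext v
    constructor
    · rintro ⟨i, rfl⟩
      exact hK.finite_vertices.mem_toFinset.1 (e i).2
    · intro hv
      obtain ⟨i, hi⟩ := e.surjective ⟨v, hK.finite_vertices.mem_toFinset.2 hv⟩
      exact ⟨i, by simp [hi]⟩
  have hKX : convexHull ℝ (range X) = K := by rw [hran, hK.convexHull_vertices]
  obtain ⟨σ, hσ⟩ := exists_isStarred_comp (X := X) (by rw [hKX]; exact hK.2)
  set Y := X ∘ σ with hY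
  have hYran : range Y = vertices K := by rw [hY, σ.surjective.range_comp, hran]
  have hYinj : Function.Injective Y := hinj.comp σ.injective
  have hKY : convexHull ℝ (range Y) = K := by rw [hYran, hK.convexHull_vertices]
  have hsub : range Y ⊆ K := by rw [hYran]; exact extremePoints_subset
  refine ⟨Y 0, Y 1, fun i => Y (Fin.natAdd 2 i), isStarHexad_of_isStarred hσ
    (finrank_dependences (by rw [hKY]; exact hK.2)) fun k => ?_, hK, ?_, ?_, ?_, ?_, ?_⟩
  · refine notMem_convexHull_of_mem_vertices hK.convex (by rw [← hYran]; exact mem_range_self k)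
      ((image_subset_range _ _).trans hsub) ?_
    rintro ⟨j, hj, hjk⟩
    exact hj (hYinj hjk)
  · rw [← hYran]
    ext z
    simp only [mem_range, mem_insert_iff]
    constructor
    · rintro ⟨k, rfl⟩
      refine Fin.addCases (m := 2) (n := 4) (fun i => ?_) (fun i => ?_) k
      · fin_cases i
        · exact Or.inl rfl
        · exact Or.inr (Or.inl rfl)
      · exact Or.inr (Or.inr ⟨i, rfl⟩)
    · rintro (rfl | rfl | ⟨i, rfl⟩) <;> exact ⟨_, rfl⟩
  · intro i j hij
    have := hYinj hij
    simpa [Fin.ext_iff] using this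
  · exact hYinj.ne (by decide)
  · exact fun i => hYinj.ne (by simp [Fin.ext_iff]; omega)
  · exact fun i => hYinj.ne (by simp [Fin.ext_iff]; omega)

/-- A polytope with six vertices and diameter at most `1` either has volume at most `1 / 6`, or
it is a fan of tetrahedra. -/
lemma exists_isFan_or_volume_le {K : Set (Space 3)} (hK : K ∈ unitPolytopes 3 6) :
    (∃ p q y, IsStarPolytope K p q y ∧ IsFan p q y) ∨ volume.real K ≤ 1 / 6 := by
  obtain ⟨hP, hcard, hdiam⟩ := hK
  obtain ⟨p, q, y, h⟩ := exists_isStarPolytope hP hcard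
  obtain ⟨a, b, c, d, hn, hord⟩ := hasAngularOrder (t := tripleFrom p q y)
    (fun i j => tripleFrom_swap p q y i j)
    (fun i j k l => det3_pluecker (q - p) (y i - p) (y j - p) (y k - p) (y l - p))
    (show [(0 : Fin 4), 1, 2, 3].Nodup by decide)
  have hinj : Function.Injective ![a, b, c, d] := by
    simp only [List.nodup_cons, List.mem_cons, List.not_mem_nil, not_or, or_false] at hn
    intro i j hij
    fin_cases i <;> fin_cases j <;> simp at hij ⊢ <;> grind
  have hc := h.comp hinj
  rcases hord with ⟨h1, h2, h3, h4, h5, h6⟩ | ⟨h1, h2, h3, h4⟩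
  · refine Or.inl ⟨p, q, _, hc, fun i j hij => ?_⟩
    have cases : (i = 0 ∧ j = 1) ∨ (i = 0 ∧ j = 2) ∨ (i = 0 ∧ j = 3) ∨ (i = 1 ∧ j = 2) ∨
        (i = 1 ∧ j = 3) ∨ (i = 2 ∧ j = 3) := by
      clear * - hij; revert i j; decide
    rcases cases with ⟨rfl, rfl⟩ | ⟨rfl, rfl⟩ | ⟨rfl, rfl⟩ | ⟨rfl, rfl⟩ | ⟨rfl, rfl⟩ | ⟨rfl, rfl⟩ <;>
      assumption
  · right
    have hv := hc.isStarHexad.volume_le_of_cycle h1 h2 h3 h4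
    rw [← hc.eq_convexHull] at hv
    have hdist : ∀ u ∈ vertices K, ∀ v ∈ vertices K, dist u v ≤ 1 := fun u hu v hv => by
      rw [← hdiam]
      exact Metric.dist_le_diam_of_mem hP.isCompact.isBounded (extremePoints_subset hu)
        (extremePoints_subset hv)
    rw [hc.vertices_eq] at hdist
    have hp : p ∈ insert p (insert q (range (y ∘ ![a, b, c, d]))) := by simp
    have hq : q ∈ insert p (insert q (range (y ∘ ![a, b, c, d]))) := by simp
    have hy : ∀ i, (y ∘ ![a, b, c, d]) i ∈ insert p (insert q (range (y ∘ ![a, b, c, d]))) :=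
      fun i => Or.inr (Or.inr (mem_range_self i))
    have := det3_le_one (hdist _ hq _ hp) (hdist _ (hy 0) _ (hy 2)) (hdist _ (hy 1) _ (hy 3))
    linarith

/-! ### The volume of a fan -/

lemma fan_coordinate_bound {x₀ : ℝ} (hx₀ : x₀ ∈ Ioo (0 : ℝ) (1 / 2))
    (hmax : ∀ x ∈ Icc (0 : ℝ) (1 / 2), x ≠ x₀ → A (√3 / 2) x < A (√3 / 2) x₀)
    {h x m₁ m₂ a₁ b₁ a₄ b₄ : ℝ} (hh : 0 ≤ h) (hh1 : h ≤ 1) (hx : 0 ≤ x) (hx1 : x ≤ 1 / 2)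
    (hxm : 0 ≤ h * (x * m₂))
    (h2 : (m₁ + x) ^ 2 + m₂ ^ 2 ≤ 1 - h ^ 2 / 4) (h3 : (m₁ - x) ^ 2 + m₂ ^ 2 ≤ 1 - h ^ 2 / 4)
    (h13 : (a₁ - (m₁ - x)) ^ 2 + (b₁ - m₂) ^ 2 ≤ 1) (h24 : (a₄ - (m₁ + x)) ^ 2 + (b₄ - m₂) ^ 2 ≤ 1)
    (h14 : (a₁ - a₄) ^ 2 + (b₁ - b₄) ^ 2 ≤ 1) :
    h * ((a₁ - a₄) * m₂ - (b₁ - b₄) * m₁ - 2 * x * ((b₁ + b₄) / 2 - m₂)) ≤ 2 * A (√3 / 2) x₀ ∧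
    (h * ((a₁ - a₄) * m₂ - (b₁ - b₄) * m₁ - 2 * x * ((b₁ + b₄) / 2 - m₂)) = 2 * A (√3 / 2) x₀ →
      h = 1 ∧ x = x₀ ∧ m₁ = 0 ∧ m₂ = √(3 / 4 - x₀ ^ 2) ∧ a₁ = 1 / 2 ∧ a₄ = -(1 / 2) ∧
      b₁ = √(3 / 4 - x₀ ^ 2) - √(1 - (1 / 2 + x₀) ^ 2) ∧
      b₄ = √(3 / 4 - x₀ ^ 2) - √(1 - (1 / 2 + x₀) ^ 2)) := by
  have hA : 0 < A (√3 / 2) x₀ := by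
    have := two_mul_A_three_tenths_gt
    by_cases h : (0.3 : ℝ) = x₀
    · rw [← h]; linarith
    · linarith [hmax 0.3 (by norm_num) h]
  rcases hh.eq_or_lt with rfl | hpos
  · rw [zero_mul]
    exact ⟨by positivity, fun h => by linarith⟩
  have hxm' : 0 ≤ x * m₂ := nonneg_of_mul_nonneg_right hxm hpos
  -- The factor `s` shrinks the radius `√(1 - h ^ 2 / 4)` to `√3 / 2`; as `s ≤ 1`, the unit distance
  -- bounds survive.
  have key : ∀ s : ℝ, 0 < s → s ≤ 1 → s ^ 2 * (1 - h ^ 2 / 4) = 3 / 4 → _ := fun s hs hs1 hs2 =>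
    have hss : s ^ 2 ≤ 1 := by nlinarith
    pentagon_bound hx₀ hmax (x := s * x) (m₁ := s * m₁) (m₂ := s * m₂) (c₁ := s * (a₁ - a₄))
      (c₂ := s * (b₁ - b₄)) (n₁ := s * ((a₁ + a₄) / 2 - m₁)) (n₂ := s * ((b₁ + b₄) / 2 - m₂))
      (by positivity) (by nlinarith)
      (by
        have := mul_nonneg (sq_nonneg s) hxm'
        calc 0 ≤ s ^ 2 * (x * m₂) := this
          _ = _ := by ring)
      (by
        have := mul_le_mul_of_nonneg_left h2 (sq_nonneg s)
        calc _ = s ^ 2 * ((m₁ + x) ^ 2 + m₂ ^ 2) := by ring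
          _ ≤ _ := this.trans hs2.le)
      (by
        have := mul_le_mul_of_nonneg_left h3 (sq_nonneg s)
        calc _ = s ^ 2 * ((m₁ - x) ^ 2 + m₂ ^ 2) := by ring
          _ ≤ _ := this.trans hs2.le)
      (by
        have := mul_le_mul hss h13 (by positivity) zero_le_one
        calc _ = s ^ 2 * ((a₁ - (m₁ - x)) ^ 2 + (b₁ - m₂) ^ 2) := by ring
          _ ≤ _ := this.trans (by norm_num))
      (by
        have := mul_le_mul hss h24 (by positivity) zero_le_one
        calc _ = s ^ 2 * ((a₄ - (m₁ + x)) ^ 2 + (b₄ - m₂) ^ 2) := by ring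
          _ ≤ _ := this.trans (by norm_num))
      (by
        have := mul_le_mul hss h14 (by positivity) zero_le_one
        calc _ = s ^ 2 * ((a₁ - a₄) ^ 2 + (b₁ - b₄) ^ 2) := by ring
          _ ≤ _ := this.trans (by norm_num))
  rcases hh1.lt_or_eq with hlt | rfl
  · have hD : 0 < 1 - h ^ 2 / 4 := by nlinarith
    have hs2 : √(3 / 4 / (1 - h ^ 2 / 4)) ^ 2 = 3 / 4 / (1 - h ^ 2 / 4) := Real.sq_sqrt (by positivity)
    obtain ⟨h5, -⟩ := key √(3 / 4 / (1 - h ^ 2 / 4)) (Real.sqrt_pos.2 (by positivity))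
      (Real.sqrt_le_one.2 (by rw [div_le_one hD]; nlinarith)) (by rw [hs2, div_mul_cancel₀ _ hD.ne'])
    set s := √(3 / 4 / (1 - h ^ 2 / 4))
    set G := (a₁ - a₄) * m₂ - (b₁ - b₄) * m₁ - 2 * x * ((b₁ + b₄) / 2 - m₂) with hG
    have h6 : s ^ 2 * G ≤ 2 * A (√3 / 2) x₀ := by
      calc s ^ 2 * G = _ := by rw [hG]; ring
        _ ≤ _ := h5
    have h7 : G ≤ 2 * A (√3 / 2) x₀ * ((1 - h ^ 2 / 4) * (4 / 3)) := by
      have hs3 : s ^ 2 * (1 - h ^ 2 / 4) = 3 / 4 := by rw [hs2, div_mul_cancel₀ _ hD.ne']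
      have : G = s ^ 2 * G * ((1 - h ^ 2 / 4) * (4 / 3)) := by linear_combination (-(4 / 3) * G) * hs3
      rw [this]
      exact mul_le_mul_of_nonneg_right h6 (by positivity)
    -- From `3 - 4 * h + h ^ 3 = (1 - h) * (3 - h - h ^ 2)`.
    have h8 : h * ((1 - h ^ 2 / 4) * (4 / 3)) < 1 := by
      have : 0 < (1 - h) * (3 - h - h ^ 2) := mul_pos (by linarith) (by nlinarith)
      nlinarith
    have h9 : h * G < 2 * A (√3 / 2) x₀ := by
      calc h * G ≤ h * (2 * A (√3 / 2) x₀ * ((1 - h ^ 2 / 4) * (4 / 3))) :=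
            mul_le_mul_of_nonneg_left h7 hh
        _ = 2 * A (√3 / 2) x₀ * (h * ((1 - h ^ 2 / 4) * (4 / 3))) := by ring
        _ < 2 * A (√3 / 2) x₀ := by
          have := mul_lt_mul_of_pos_left h8 (show 0 < 2 * A (√3 / 2) x₀ by linarith)
          linarith
    exact ⟨h9.le, fun h => absurd h h9.ne⟩
  · obtain ⟨h5, h6⟩ := key 1 one_pos le_rfl (by norm_num)
    simp only [one_mul] at h5 h6 ⊢
    refine ⟨h5, fun h => ?_⟩
    obtain ⟨e1, e2, e3, e4, e5, e6, e7⟩ := h6 h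
    exact ⟨trivial, e1, e4, e5, by linarith, by linarith, by linarith, by linarith⟩

/-- The reflection of `3`-space that changes the sign of a coordinate. -/
noncomputable def coordFlip (i : Fin 3) : Space 3 ≃ₗᵢ[ℝ] Space 3 :=
  LinearIsometryEquiv.piLpCongrRight 2 fun j =>
    if j = i then LinearIsometryEquiv.neg ℝ else LinearIsometryEquiv.refl ℝ ℝ

lemma coordFlip_apply (i : Fin 3) (z : Space 3) (j : Fin 3) :
    coordFlip i z j = if j = i then -z j else z j := by
  simp only [coordFlip, LinearIsometryEquiv.piLpCongrRight_apply]
  split_ifs <;> simp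

lemma det3_coordFlip (i : Fin 3) (a b c : Space 3) :
    det3 (coordFlip i a) (coordFlip i b) (coordFlip i c) = -det3 a b c := by
  simp only [det3, coordFlip_apply]
  fin_cases i <;> simp <;> ring

/-- An isometry preserves the volume of the corner tetrahedron, so its determinant is `1` or `-1`.
-/
lemma det3_map (φ : Space 3 ≃ₗᵢ[ℝ] Space 3) :
    (∀ a b c, det3 (φ a) (φ b) (φ c) = det3 a b c) ∨
    (∀ a b c, det3 (φ a) (φ b) (φ c) = -det3 a b c) := by
  set D := LinearMap.det (φ.toLinearEquiv : Space 3 →ₗ[ℝ] Space 3)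
  have hmul : ∀ a b c, det3 (φ a) (φ b) (φ c) = D * det3 a b c := by
    intro a b c
    rw [← det_ofColumns, ← det_ofColumns, ← LinearMap.det_comp]
    congr 1
    ext y : 1
    simp [ofColumns_apply]
  have hD : |D| = 1 := by
    have h1 := volume_corner_tetrahedron
    set S := {y : Space 3 | 0 ≤ y 0 ∧ 0 ≤ y 1 ∧ 0 ≤ y 2 ∧ y 0 + y 1 + y 2 ≤ 1}
    have h2 := Measure.addHaar_image_linearMap volume (φ.toLinearEquiv : Space 3 →ₗ[ℝ] Space 3) S
    have h3 : volume (φ '' S) = volume S := by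
      rw [show φ '' S = φ.symm ⁻¹' S from φ.toEquiv.image_eq_preimage_symm S]
      exact MeasurePreserving.measure_preimage_equiv (f := φ.symm.toMeasurableEquiv)
        φ.symm.measurePreserving S
    have h4 : volume S = ENNReal.ofReal |D| * volume S := h3.symm.trans h2
    rw [h1, ← ENNReal.ofReal_mul (abs_nonneg _),
      ENNReal.ofReal_eq_ofReal_iff (by norm_num) (by positivity)] at h4
    linarith
  rcases abs_eq (zero_le_one) |>.1 hD with h | h
  · left; intro a b c; rw [hmul, h, one_mul]
  · right; intro a b c; rw [hmul, h, neg_one_mul]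

lemma exists_frame (v w : Space 3) : ∃ φ : Space 3 ≃ₗᵢ[ℝ] Space 3,
    φ v 0 = 0 ∧ φ v 1 = 0 ∧ 0 ≤ φ v 2 ∧ φ w 1 = 0 ∧ 0 ≤ φ w 0 ∧
      ∀ a b c, det3 (φ a) (φ b) (φ c) = det3 a b c := by
  obtain ⟨φ, h1, h2, h3⟩ : ∃ φ : Space 3 ≃ₗᵢ[ℝ] Space 3, φ v 0 = 0 ∧ φ v 1 = 0 ∧ φ w 1 = 0 := by
    let b := InnerProductSpace.gramSchmidtOrthonormalBasis (𝕜 := ℝ) (E := Space 3)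
      (by simp) ![v, w, 0]
    have e1 : b.repr v 1 = 0 :=
      InnerProductSpace.gramSchmidtOrthonormalBasis_inv_triangular' _ ![v, w, 0]
        (i := 0) (j := 1) (by decide)
    have e2 : b.repr v 2 = 0 :=
      InnerProductSpace.gramSchmidtOrthonormalBasis_inv_triangular' _ ![v, w, 0]
        (i := 0) (j := 2) (by decide)
    have e3 : b.repr w 2 = 0 :=
      InnerProductSpace.gramSchmidtOrthonormalBasis_inv_triangular' _ ![v, w, 0]
        (i := 1) (j := 2) (by decide)
    refine ⟨b.repr.trans (LinearIsometryEquiv.piLpCongrLeft 2 ℝ ℝ (finRotate 3).symm), ?_, ?_, ?_⟩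
    · simpa [LinearIsometryEquiv.piLpCongrLeft_apply, Equiv.piCongrLeft'] using e1
    · simpa [LinearIsometryEquiv.piLpCongrLeft_apply, Equiv.piCongrLeft'] using e2
    · simpa [LinearIsometryEquiv.piLpCongrLeft_apply, Equiv.piCongrLeft'] using e3
  wlog h4 : 0 ≤ φ v 2 generalizing φ
  · refine this (φ.trans (coordFlip 2)) ?_ ?_ ?_ ?_ <;> simp [coordFlip_apply, h1, h2, h3]
    linarith
  wlog h5 : 0 ≤ φ w 0 generalizing φ
  · refine this (φ.trans (coordFlip 0)) ?_ ?_ ?_ ?_ ?_ <;> simp [coordFlip_apply, h1, h2, h3, h4]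
    linarith
  -- The second coordinate vanishes on both images, so reversing it corrects the orientation at no
  -- cost.
  rcases det3_map φ with h6 | h6
  · exact ⟨φ, h1, h2, h4, h3, h5, h6⟩
  · refine ⟨φ.trans (coordFlip 1), ?_, ?_, ?_, ?_, ?_, fun a b c => ?_⟩
    any_goals simp [coordFlip_apply, h1, h2, h3, h4, h5]
    rw [det3_coordFlip, h6, neg_neg]

lemma unitPolytopes_dist_le {n k : ℕ} {K : Set (Space n)} (hK : K ∈ unitPolytopes n k)
    {u v : Space n} (hu : u ∈ vertices K) (hv : v ∈ vertices K) : dist u v ≤ 1 := by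
  rw [← hK.2.2]
  exact Metric.dist_le_diam_of_mem hK.1.isCompact.isBounded (extremePoints_subset hu)
    (extremePoints_subset hv)

lemma image_polyhedronOver (f : Space 3 ≃ᵢ Space 3) (h : ℝ) (P : Fin 5 → Space 2) :
    f '' polyhedronOver h P = convexHull ℝ {f (lift (P 4) (h / 2)), f (lift (P 4) (-(h / 2))),
      f (lift (P 0) 0), f (lift (P 1) 0), f (lift (P 2) 0), f (lift (P 3) 0)} := by
  have e := (f.toRealAffineIsometryEquiv.toAffineEquiv : Space 3 →ᵃ[ℝ] Space 3).image_convexHull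
    {lift (P 4) (h / 2), lift (P 4) (-(h / 2)), lift (P 0) 0, lift (P 1) 0, lift (P 2) 0,
      lift (P 3) 0}
  have hf : ⇑(f.toRealAffineIsometryEquiv.toAffineEquiv : Space 3 →ᵃ[ℝ] Space 3) = f := by
    ext x : 1; simp
  rw [hf] at e
  rw [polyhedronOver, e]
  simp only [image_insert_eq, image_singleton]

lemma insert_insert_range {E : Type*} (p q : E) (y : Fin 4 → E) :
    (insert p (insert q (range y)) : Set E) = {q, p, y 0, y 1, y 2, y 3} := by
  ext v
  constructor
  · rintro (rfl | rfl | ⟨i, rfl⟩)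
    · simp
    · simp
    · fin_cases i <;> simp
  · rintro (rfl | rfl | rfl | rfl | rfl | rfl) <;> simp

set_option maxHeartbeats 1000000 in
/-- The volume bound for fans, with the case of equality. -/
theorem volume_le_of_isFan {x₀ : ℝ} (hx₀ : x₀ ∈ Ioo (0 : ℝ) (1 / 2))
    (hmax : ∀ x ∈ Icc (0 : ℝ) (1 / 2), x ≠ x₀ → A (√3 / 2) x < A (√3 / 2) x₀)
    {K : Set (Space 3)} (hK : K ∈ unitPolytopes 3 6) {p q : Space 3} {y : Fin 4 → Space 3}
    (h : IsStarPolytope K p q y) (hf : IsFan p q y) :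
    volume.real K ≤ A (√3 / 2) x₀ / 3 ∧
    (volume.real K = A (√3 / 2) x₀ / 3 → ∃ f : Space 3 ≃ᵢ Space 3,
      f '' polyhedronOver 1 (symmetricPentagon (√3 / 2) x₀) = K) := by
  have hvol := h.isStarHexad.volume_le_of_isFan hf
  rw [← h.eq_convexHull] at hvol
  have hp : p ∈ vertices K := by rw [h.vertices_eq]; simp
  have hq : q ∈ vertices K := by rw [h.vertices_eq]; simp
  have hy : ∀ i, y i ∈ vertices K := fun i => by rw [h.vertices_eq]; simp
  obtain ⟨φ, v0, v1, v2, w1, w0, hdet⟩ := exists_frame (q - p) (y 1 - y 2)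
  set a : Fin 4 → Space 3 := fun i => φ (y i - p) with ha
  set H := φ (q - p) 2 with hH
  have hw : φ (y 1 - y 2) = a 1 - a 2 := by simp only [ha, ← map_sub]; congr 1; abel
  rw [hw] at w1 w0
  simp only [PiLp.sub_apply] at w1 w0
  have htr : ∀ i j, tripleFrom p q y i j = H * (a i 0 * a j 1 - a i 1 * a j 0) := by
    intro i j
    rw [tripleFrom, ← hdet, det3, v0, v1]
    simp only [ha]
    ring
  have hya : ∀ i j, (a i 0 - a j 0) ^ 2 + (a i 1 - a j 1) ^ 2 + (a i 2 - a j 2) ^ 2 ≤ 1 := by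
    intro i j
    rw [← dist_le_one_iff]
    simp only [ha, φ.dist_map, dist_sub_right]
    exact unitPolytopes_dist_le hK (hy i) (hy j)
  have hpa : ∀ i, a i 0 ^ 2 + a i 1 ^ 2 + a i 2 ^ 2 ≤ 1 := by
    intro i
    have e := unitPolytopes_dist_le hK (hy i) hp
    rw [← dist_sub_right _ _ p, ← φ.dist_map, sub_self, map_zero, dist_le_one_iff] at e
    change (a i 0 - 0) ^ 2 + (a i 1 - 0) ^ 2 + (a i 2 - 0) ^ 2 ≤ 1 at e
    simpa only [sub_zero] using e
  have hqa : ∀ i, a i 0 ^ 2 + a i 1 ^ 2 + (a i 2 - H) ^ 2 ≤ 1 := by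
    intro i
    have e := unitPolytopes_dist_le hK (hy i) hq
    rw [← dist_sub_right _ _ p, ← φ.dist_map, dist_le_one_iff, v0, v1] at e
    change (a i 0 - 0) ^ 2 + (a i 1 - 0) ^ 2 + (a i 2 - H) ^ 2 ≤ 1 at e
    simpa only [sub_zero] using e
  have hH1 : H ≤ 1 := by
    have e := unitPolytopes_dist_le hK hq hp
    rw [← dist_sub_right _ _ p, ← φ.dist_map, sub_self, map_zero, dist_le_one_iff, v0, v1] at e
    simp only [PiLp.zero_apply, sub_zero] at e
    exact (abs_le_of_sq_le_sq' (by linarith) zero_le_one).2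
  -- The mean of the distance bounds to `p` and `q`, that is, the median from `y i`.
  have hr : ∀ i, a i 0 ^ 2 + a i 1 ^ 2 ≤ 1 - H ^ 2 / 4 := by
    intro i
    linarith [hpa i, hqa i, sq_nonneg (a i 2 - H / 2)]
  have h12 := hf 1 2 (by decide)
  rw [htr] at h12
  have hy12 : a 2 1 = a 1 1 := by linarith
  have key := fan_coordinate_bound hx₀ hmax (h := H) (x := (a 1 0 - a 2 0) / 2)
    (m₁ := (a 1 0 + a 2 0) / 2) (m₂ := a 1 1) (a₁ := a 0 0) (b₁ := a 0 1) (a₄ := a 3 0) (b₄ := a 3 1)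
    v2 hH1 (by linarith)
    (by
      have := hya 1 2
      have : a 1 0 - a 2 0 ≤ 1 := (abs_le_of_sq_le_sq' (by
        linarith [sq_nonneg (a 1 1 - a 2 1), sq_nonneg (a 1 2 - a 2 2)]) zero_le_one).2
      linarith)
    (by rw [hy12] at h12; linarith)
    (by have := hr 1; convert this using 2; ring)
    (by have := hr 2; rw [hy12] at this; convert this using 2; ring)
    (by
      have := hya 0 2
      rw [hy12] at this
      have e : a 0 0 - ((a 1 0 + a 2 0) / 2 - (a 1 0 - a 2 0) / 2) = a 0 0 - a 2 0 := by ring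
      rw [e]; linarith [sq_nonneg (a 0 2 - a 2 2)])
    (by
      have := hya 3 1
      have e : a 3 0 - ((a 1 0 + a 2 0) / 2 + (a 1 0 - a 2 0) / 2) = a 3 0 - a 1 0 := by ring
      rw [e]; linarith [sq_nonneg (a 3 2 - a 1 2)])
    (by have := hya 0 3; linarith [sq_nonneg (a 0 2 - a 3 2)])
  rw [htr, htr, htr, hy12] at hvol
  obtain ⟨k1, k2⟩ := key
  refine ⟨by linarith, fun heq => ?_⟩
  obtain ⟨e1, e2, e3, e4, e5, e6, e7, e8⟩ := k2 (le_antisymm k1 (by linarith))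
  have hx0 := hx₀.1
  have hx1 := hx₀.2
  have hz2 := Real.sq_sqrt (show 0 ≤ 3 / 4 - x₀ ^ 2 by nlinarith)
  have hy2 := Real.sq_sqrt (show 0 ≤ 1 - (1 / 2 + x₀) ^ 2 by nlinarith)
  have hzdef : √((√3 / 2) ^ 2 - x₀ ^ 2) = √(3 / 4 - x₀ ^ 2) := by rw [sqrt_three_half_sq]
  set z := √(3 / 4 - x₀ ^ 2)
  set t := √(1 - (1 / 2 + x₀) ^ 2)
  have a10 : a 1 0 = x₀ := by linarith
  have a20 : a 2 0 = -x₀ := by linarith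
  have a21 : a 2 1 = z := by linarith
  -- The horizontal distance from the axis is already `√3 / 2`, so both unit bounds are tight only
  -- at height `1 / 2`. For `a 0` and `a 3` the horizontal distance to `a 2`, `a 1` is already `1`.
  have a12 : a 1 2 = 1 / 2 := by
    have i1 := hpa 1
    have i2 := hqa 1
    rw [a10, e4, e1] at *
    have : (a 1 2 - 1 / 2) ^ 2 ≤ 0 := by linarith
    linarith [pow_eq_zero_iff two_ne_zero |>.1 (le_antisymm this (sq_nonneg _))]
  have a22 : a 2 2 = 1 / 2 := by
    have i1 := hpa 2
    have i2 := hqa 2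
    rw [a20, a21, e1] at *
    have : (a 2 2 - 1 / 2) ^ 2 ≤ 0 := by linarith
    linarith [pow_eq_zero_iff two_ne_zero |>.1 (le_antisymm this (sq_nonneg _))]
  have a02 : a 0 2 = 1 / 2 := by
    have i1 := hya 0 2
    rw [e5, e7, a20, a21, a22] at i1
    have : (a 0 2 - 1 / 2) ^ 2 ≤ 0 := by linarith
    linarith [pow_eq_zero_iff two_ne_zero |>.1 (le_antisymm this (sq_nonneg _))]
  have a32 : a 3 2 = 1 / 2 := by
    have i1 := hya 3 1
    rw [e6, e8, a10, e4, a12] at i1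
    have : (a 3 2 - 1 / 2) ^ 2 ≤ 0 := by linarith
    linarith [pow_eq_zero_iff two_ne_zero |>.1 (le_antisymm this (sq_nonneg _))]
  -- In the frame the pentagon is upside down, with `P₅` at the origin and the midplane at height `1
  -- / 2`.
  let f : Space 3 ≃ᵢ Space 3 := (((coordFlip 1).toIsometryEquiv.trans
    (IsometryEquiv.addRight (!₂[0, z, 1 / 2] : Space 3))).trans φ.symm.toIsometryEquiv).trans
    (IsometryEquiv.addRight p)
  have hfv : ∀ u v, coordFlip 1 u + !₂[0, z, 1 / 2] = φ (v - p) → f u = v := by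
    intro u v huv
    change φ.symm (coordFlip 1 u + !₂[0, z, 1 / 2]) + p = v
    rw [huv, φ.symm_apply_apply, sub_add_cancel]
  refine ⟨f, ?_⟩
  have f1 : f (lift (symmetricPentagon (√3 / 2) x₀ 4) (1 / 2)) = q := by
    apply hfv
    have hqp : φ (q - p) = !₂[0, 0, 1] := by
      ext i; fin_cases i
      exacts [v0, v1, hH.symm.trans e1]
    rw [hqp]
    ext i; fin_cases i <;> simp [coordFlip_apply, lift, symmetricPentagon, hzdef]
    norm_num
  have f2 : f (lift (symmetricPentagon (√3 / 2) x₀ 4) (-(1 / 2))) = p := by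
    apply hfv
    ext i; fin_cases i <;> simp [coordFlip_apply, lift, symmetricPentagon, hzdef]
  have f3 : f (lift (symmetricPentagon (√3 / 2) x₀ 0) 0) = y 0 := by
    apply hfv
    change _ = a 0
    ext i; fin_cases i <;> simp [coordFlip_apply, lift, symmetricPentagon, e5, e7, a02]
    rw [← sub_eq_neg_add, sub_right_inj]
    norm_num [t]
  have f4 : f (lift (symmetricPentagon (√3 / 2) x₀ 1) 0) = y 1 := by
    apply hfv
    change _ = a 1
    ext i; fin_cases i <;> simp [coordFlip_apply, lift, symmetricPentagon, a10, e4, a12]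
  have f5 : f (lift (symmetricPentagon (√3 / 2) x₀ 2) 0) = y 2 := by
    apply hfv
    change _ = a 2
    ext i; fin_cases i <;> simp [coordFlip_apply, lift, symmetricPentagon, a20, a21, a22]
  have f6 : f (lift (symmetricPentagon (√3 / 2) x₀ 3) 0) = y 3 := by
    apply hfv
    change _ = a 3
    ext i; fin_cases i <;> simp [coordFlip_apply, lift, symmetricPentagon, e6, e8, a32]
    rw [← sub_eq_neg_add, sub_right_inj]
    norm_num [t]
  rw [image_polyhedronOver, f1, f2, f3, f4, f5, f6, h.eq_convexHull, insert_insert_range]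

/-! ### Faces and valences -/

/-- The affine function with the given coefficients. -/
noncomputable def affineForm (a b c d : ℝ) : Space 3 →ᵃ[ℝ] ℝ where
  toFun x := a * x 0 + b * x 1 + c * x 2 + d
  linear := IsLinearMap.mk' (fun x : Space 3 => a * x 0 + b * x 1 + c * x 2)
    ⟨fun x y => by simp; ring, fun r x => by simp; ring⟩
  map_vadd' x v := by simp; ring

lemma affineForm_apply (a b c d : ℝ) (x : Space 3) :
    affineForm a b c d x = a * x 0 + b * x 1 + c * x 2 + d := rfl

lemma exists_affine_det3 (u v p : Space 3) :
    ∃ f : Space 3 →ᵃ[ℝ] ℝ, ∀ x, f x = det3 u v (x - p) := by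
  refine ⟨affineForm (u 1 * v 2 - u 2 * v 1) (u 2 * v 0 - u 0 * v 2) (u 0 * v 1 - u 1 * v 0)
    (-((u 1 * v 2 - u 2 * v 1) * p 0 + (u 2 * v 0 - u 0 * v 2) * p 1 +
      (u 0 * v 1 - u 1 * v 0) * p 2)), fun x => ?_⟩
  simp only [affineForm_apply, det3, PiLp.sub_apply]
  ring

section Faces

variable {n : ℕ} {S : Set (Space n)} {f : Space n →ᵃ[ℝ] ℝ}

lemma affine_apply_combo (f : Space n →ᵃ[ℝ] ℝ) {a b : ℝ} (hab : a + b = 1) (x y : Space n) :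
    f (a • x + b • y) = a * f x + b * f y := by
  have := Convex.combo_affine_apply (f := f) (x := x) (y := y) hab
  simpa using this

lemma convexHull_nonneg (hf : ∀ s ∈ S, 0 ≤ f s) {x : Space n} (hx : x ∈ convexHull ℝ S) :
    0 ≤ f x :=
  convexHull_min (t := f ⁻¹' Ici 0) hf ((convex_Ici 0).affine_preimage f) hx

lemma convexHull_eq_zero (hf : ∀ s ∈ S, f s = 0) {x : Space n} (hx : x ∈ convexHull ℝ S) :
    f x = 0 :=
  convexHull_min (t := f ⁻¹' {0}) hf ((convex_singleton 0).affine_preimage f) hx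

/-- The points with `0 < f` together with the hull of the zeros in `S` form a convex set containing
`S`, hence containing the whole hull. -/
lemma convexHull_zero_set (hf : ∀ s ∈ S, 0 ≤ f s) :
    {x ∈ convexHull ℝ S | f x = 0} = convexHull ℝ {s ∈ S | f s = 0} := by
  apply Subset.antisymm
  · rintro x ⟨hx, hx0⟩
    have hZ : ∀ y ∈ convexHull ℝ {s ∈ S | f s = 0}, f y = 0 := fun y hy =>
      convexHull_eq_zero (fun s hs => hs.2) hy
    have hsub : convexHull ℝ S ⊆ {x | 0 < f x} ∪ convexHull ℝ {s ∈ S | f s = 0} := by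
      refine convexHull_min (fun s hs => ?_) ?_
      · rcases (hf s hs).eq_or_lt with h | h
        · exact Or.inr (subset_convexHull ℝ _ ⟨hs, h.symm⟩)
        · exact Or.inl h
      · have hpos : ∀ y ∈ {x | 0 < f x} ∪ convexHull ℝ {s ∈ S | f s = 0}, 0 ≤ f y := by
          rintro y (h | h)
          · exact le_of_lt h
          · exact (hZ y h).ge
        rw [convex_iff_forall_pos]
        rintro y hy z hz a b ha hb hab
        by_cases h : 0 < f y ∨ 0 < f z
        · left
          change 0 < f _
          rw [affine_apply_combo f hab]
          have h1 := hpos y hy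
          have h2 := hpos z hz
          rcases h with h | h <;> positivity
        · push Not at h
          rcases hy with hy | hy
          · exact absurd hy (not_lt.2 h.1)
          rcases hz with hz | hz
          · exact absurd hz (not_lt.2 h.2)
          exact Or.inr (convex_convexHull ℝ _ hy hz ha.le hb.le hab)
    rcases hsub hx with h | h
    · exact absurd hx0 (ne_of_gt h)
    · exact h
  · intro x hx
    exact ⟨convexHull_mono (fun s hs => hs.1) hx, convexHull_eq_zero (fun s hs => hs.2) hx⟩

lemma isExposed_zero_set {K : Set (Space n)} (hf : ∀ x ∈ K, 0 ≤ f x) :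
    IsExposed ℝ K {x ∈ K | f x = 0} := by
  rintro ⟨x₀, hx₀, h0⟩
  refine ⟨LinearMap.toContinuousLinearMap (-f.linear), ?_⟩
  have hl : ∀ x, f.linear x = f x - f 0 := fun x => by
    have := f.linearMap_vsub x 0
    simpa using this
  ext x
  simp only [mem_ofPred_eq, LinearMap.coe_toContinuousLinearMap', LinearMap.neg_apply, hl,
    neg_le_neg_iff, sub_le_sub_iff_right]
  constructor
  · rintro ⟨hx, hx0⟩
    exact ⟨hx, fun y hy => by rw [hx0]; exact hf y hy⟩
  · rintro ⟨hx, h⟩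
    exact ⟨hx, le_antisymm (h0 ▸ h x₀ hx₀) (hf x hx)⟩

lemma isExposed_convexHull (hf : ∀ s ∈ S, 0 ≤ f s) :
    IsExposed ℝ (convexHull ℝ S) (convexHull ℝ {s ∈ S | f s = 0}) := by
  rw [← convexHull_zero_set hf]
  exact isExposed_zero_set fun x hx => convexHull_nonneg hf hx

lemma mem_vertices_of_nonneg (hf : ∀ s ∈ S, 0 ≤ f s) {v : Space n} (hv : v ∈ S)
    (h : ∀ s ∈ S, f s = 0 ↔ s = v) : v ∈ vertices (convexHull ℝ S) := by
  have hexp := isExposed_convexHull hf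
  have hZ : {s ∈ S | f s = 0} = {v} := by
    ext s
    simp only [mem_ofPred_eq, mem_singleton_iff]
    exact ⟨fun hs => (h s hs.1).1 hs.2, fun hs => by subst hs; exact ⟨hv, (h s hv).2 rfl⟩⟩
  rw [hZ, convexHull_singleton] at hexp
  exact hexp.isExtreme.mem_extremePoints

lemma isEdge_of_nonneg {K : Set (Space n)} (hK : convexHull ℝ (vertices K) = K)
    (hf : ∀ s ∈ vertices K, 0 ≤ f s) {u v : Space n} (hu : u ∈ vertices K) (hv : v ∈ vertices K)
    (huv : u ≠ v) (h : ∀ s ∈ vertices K, f s = 0 ↔ s = u ∨ s = v) : IsEdge K u v := by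
  refine ⟨hu, hv, huv, ?_⟩
  have hexp := isExposed_convexHull hf
  have hZ : {s ∈ vertices K | f s = 0} = {u, v} := by
    ext s
    simp only [mem_ofPred_eq, mem_insert_iff, mem_singleton_iff]
    refine ⟨fun hs => (h s hs.1).1 hs.2, fun hs => ?_⟩
    have : s ∈ vertices K := by rcases hs with rfl | rfl <;> assumption
    exact ⟨this, (h s this).2 hs⟩
  rwa [hZ, convexHull_pair, hK] at hexp

end Faces

lemma not_collinear_of_vertices {n : ℕ} {K : Set (Space n)} {a b c : Space n}
    (ha : a ∈ vertices K) (hb : b ∈ vertices K) (hc : c ∈ vertices K) (hab : a ≠ b) (hac : a ≠ c)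
    (hbc : b ≠ c) : ¬ Collinear ℝ {a, b, c} := by
  have key : ∀ {a b c : Space n}, a ∈ vertices K → b ∈ vertices K → c ∈ vertices K → a ≠ b →
      b ≠ c → ¬ Wbtw ℝ a b c := by
    intro a b c ha hb hc hab hbc h
    rcases (mem_extremePoints_iff_forall_segment.1 hb).2 a ha.1 c hc.1 h.mem_segment with h | h
    · exact hab h
    · exact hbc h.symm
  intro h
  rcases h.wbtw_or_wbtw_or_wbtw with h | h | h
  · exact key ha hb hc hab hbc h
  · exact key hb hc ha hbc hac.symm h
  · exact key hc ha hb hac.symm hab h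

lemma finrank_vectorSpan_le_two {F : Set (Space 3)} {f : Space 3 →ᵃ[ℝ] ℝ} (hF : ∀ x ∈ F, f x = 0)
    {s : Space 3} (hs : f s ≠ 0) : Module.finrank ℝ (vectorSpan ℝ F) ≤ 2 := by
  rcases F.eq_empty_or_nonempty with rfl | ⟨x₀, hx₀⟩
  · rw [vectorSpan_empty, finrank_bot]
    omega
  have hle : vectorSpan ℝ F ≤ LinearMap.ker f.linear := by
    rw [vectorSpan_def, Submodule.span_le]
    rintro _ ⟨x, hx, y, hy, rfl⟩
    have := f.linearMap_vsub x y
    simp [hF x hx, hF y hy] at this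
    simpa using this
  have hne : LinearMap.ker f.linear ≠ ⊤ := by
    intro h
    have h1 : s - x₀ ∈ LinearMap.ker f.linear := by rw [h]; trivial
    have := f.linearMap_vsub s x₀
    rw [LinearMap.mem_ker] at h1
    simp [hF x₀ hx₀] at this h1
    exact hs (by rw [← this, h1])
  have h1 := Submodule.finrank_mono hle
  have h2 := Submodule.finrank_lt hne
  simp at h2
  omega

/-- A supporting plane of a polytope with triangular faces contains at most three vertices. -/
lemma HasTriangularFaces.ncard_le {K : Set (Space 3)} (hT : HasTriangularFaces K)
    (hK : convexHull ℝ (vertices K) = K) (hfin : (vertices K).Finite) {f : Space 3 →ᵃ[ℝ] ℝ}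
    (hf : ∀ s ∈ vertices K, 0 ≤ f s) (hf0 : ∃ s ∈ vertices K, f s ≠ 0) :
    {s ∈ vertices K | f s = 0}.ncard ≤ 3 := by
  by_contra! h
  set Z := {s ∈ vertices K | f s = 0} with hZ
  have hexp := isExposed_convexHull hf
  rw [hK, ← hZ] at hexp
  have hver : vertices (convexHull ℝ Z) = Z := by
    apply Subset.antisymm
    · exact extremePoints_convexHull_subset
    · intro s hs
      rw [vertices, hexp.isExtreme.extremePoints_eq]
      exact ⟨subset_convexHull ℝ _ hs, hs.1⟩
  have hfacet : IsFacet K (convexHull ℝ Z) := by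
    obtain ⟨s, hs, hs0⟩ := hf0
    refine ⟨hexp, fun heq => ?_, ?_⟩
    · exact hs0 (convexHull_eq_zero (fun s hs => hs.2) (heq.symm ▸ hs.1 : s ∈ convexHull ℝ Z))
    · have hZfin : Z.Finite := hfin.subset fun s hs => hs.1
      obtain ⟨a, b, c, ha, hb, hc, hab, hac, hbc⟩ := (Set.two_lt_ncard_iff hZfin).1 (by omega)
      apply le_antisymm
      · exact finrank_vectorSpan_le_two (fun x hx => convexHull_eq_zero (fun s hs => hs.2) hx) hs0
      · by_contra! hlt
        have hcol : Collinear ℝ (convexHull ℝ Z) :=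
          collinear_iff_finrank_le_one.2 (Nat.lt_succ_iff.1 hlt)
        refine not_collinear_of_vertices ha.1 hb.1 hc.1 hab hac hbc (hcol.subset ?_)
        rintro x (rfl | rfl | rfl) <;> apply subset_convexHull <;> assumption
  have := hT _ hfacet
  rw [hver] at this
  omega

lemma hasTriangularFaces_of_ncard_le {K : Set (Space 3)} (hK : convexHull ℝ (vertices K) = K)
    (hfin : (vertices K).Finite)
    (h : ∀ f : Space 3 →ᵃ[ℝ] ℝ, (∀ s ∈ vertices K, 0 ≤ f s) → (∃ s ∈ vertices K, f s ≠ 0) →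
      {s ∈ vertices K | f s = 0}.ncard ≤ 3) : HasTriangularFaces K := by
  rintro F ⟨hexp, hne, hrank⟩
  have hF0 : F.Nonempty := by
    by_contra! h0
    rw [h0, vectorSpan_empty, finrank_bot] at hrank
    omega
  obtain ⟨x₀, hx₀⟩ := hF0
  obtain ⟨l, hl⟩ := hexp ⟨x₀, hx₀⟩
  let f : Space 3 →ᵃ[ℝ] ℝ := AffineMap.const ℝ (Space 3) (l x₀) - l.toLinearMap.toAffineMap
  have hfx : ∀ x, f x = l x₀ - l x := fun x => rfl
  rw [hl] at hx₀
  have hf : ∀ s ∈ vertices K, 0 ≤ f s := fun s hs => by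
    rw [hfx]
    linarith [hx₀.2 s hs.1]
  have hFf : F = convexHull ℝ {s ∈ vertices K | f s = 0} := by
    rw [← convexHull_zero_set hf, hK, hl]
    ext x
    simp only [mem_ofPred_eq, hfx, sub_eq_zero]
    constructor
    · rintro ⟨hx, hy⟩
      exact ⟨hx, le_antisymm (hy x₀ hx₀.1) (hx₀.2 x hx)⟩
    · rintro ⟨hx, hy⟩
      exact ⟨hx, fun z hz => by rw [← hy]; exact hx₀.2 z hz⟩
  set Z := {s ∈ vertices K | f s = 0} with hZ
  have hZfin : Z.Finite := hfin.subset fun s hs => hs.1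
  have hver : vertices F = Z := by
    apply Subset.antisymm
    · rw [hFf]
      exact extremePoints_convexHull_subset
    · intro s hs
      rw [vertices, hexp.isExtreme.extremePoints_eq]
      exact ⟨hFf ▸ subset_convexHull ℝ _ hs, hs.1⟩
  rw [hver]
  apply le_antisymm
  · apply h f hf
    by_contra! h0
    apply hne
    rw [hFf, hZ]
    conv_rhs => rw [← hK]
    congr 1
    ext s
    exact ⟨fun hs => hs.1, fun hs => ⟨hs, h0 s hs⟩⟩
  · by_contra! hlt
    have hspan : vectorSpan ℝ F = vectorSpan ℝ Z := by
      rw [hFf, ← direction_affineSpan, affineSpan_convexHull, direction_affineSpan]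
    have hcol : Collinear ℝ Z := by
      rcases Nat.lt_or_ge Z.ncard 2 with h1 | h1
      · have hsub : Z.Subsingleton := fun a ha b hb =>
          (ncard_le_one hZfin).1 (Nat.lt_succ_iff.1 h1) a ha b hb
        rcases hsub.eq_empty_or_singleton with h2 | ⟨a, h2⟩
        · rw [h2]; exact collinear_empty ℝ _
        · rw [h2]; exact collinear_singleton ℝ _
      · obtain ⟨a, b, -, hab⟩ := ncard_eq_two.1 (le_antisymm (Nat.lt_succ_iff.1 hlt) h1)
        rw [hab]
        exact collinear_pair ℝ a b
    rw [hspan] at hrank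
    have := collinear_iff_finrank_le_one.1 hcol
    omega

variable {K : Set (Space 3)} {p q : Space 3} {y : Fin 4 → Space 3}

lemma IsStarPolytope.forall_vertices (h : IsStarPolytope K p q y) {P : Space 3 → Prop} :
    (∀ s ∈ vertices K, P s) ↔ P p ∧ P q ∧ ∀ i, P (y i) := by
  rw [h.vertices_eq]
  simp

lemma IsStarPolytope.eq_zero_iff (h : IsStarPolytope K p q y) (hT : HasTriangularFaces K)
    {f : Space 3 →ᵃ[ℝ] ℝ} (hf : ∀ s ∈ vertices K, 0 ≤ f s) (hf0 : ∃ s ∈ vertices K, f s ≠ 0)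
    {a b c : Space 3} (ha : a ∈ vertices K) (hb : b ∈ vertices K) (hc : c ∈ vertices K)
    (hab : a ≠ b) (hac : a ≠ c) (hbc : b ≠ c) (fa : f a = 0) (fb : f b = 0) (fc : f c = 0)
    {s : Space 3} (hs : s ∈ vertices K) : f s = 0 ↔ s = a ∨ s = b ∨ s = c := by
  constructor
  · intro fs
    by_contra! hne
    have hcard := hT.ncard_le h.isPolytope.convexHull_vertices h.isPolytope.finite_vertices hf hf0
    have hsub : ({s, a, b, c} : Set (Space 3)) ⊆ {s ∈ vertices K | f s = 0} := by
      rintro x (rfl | rfl | rfl | rfl) <;> constructor <;> assumption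
    have h1 := ncard_le_ncard hsub (h.isPolytope.finite_vertices.subset fun s hs => hs.1)
    rw [ncard_insert_of_notMem (by simp [hne]), ncard_eq_three.2 ⟨a, b, c, hab, hac, hbc, rfl⟩] at h1
    omega
  · rintro (rfl | rfl | rfl) <;> assumption

lemma IsStarPolytope.volume_pos (h : IsStarPolytope K p q y) : 0 < volume.real K := by
  refine ENNReal.toReal_pos (Measure.measure_pos_of_nonempty_interior volume h.isPolytope.2).ne' ?_
  exact h.isPolytope.isCompact.measure_lt_top.ne

/-- In a fan with `y i` on the line `p q`, every vertex would lie on one plane. -/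
lemma IsStarPolytope.exists_tripleFrom_ne_zero (h : IsStarPolytope K p q y) (hf : IsFan p q y)
    (i : Fin 4) : ∃ j, tripleFrom p q y i j ≠ 0 := by
  by_contra! h0
  have hpos := h.volume_pos
  rw [h.eq_convexHull] at hpos
  have hvol := h.isStarHexad.volume_le_of_isFan hf
  obtain ⟨j, k, hij, hik, hjk, hjk0⟩ : ∃ j k, i ≠ j ∧ i ≠ k ∧ j ≠ k ∧ 0 < tripleFrom p q y j k := by
    by_contra! hle
    have key : ∀ j k, j < k → tripleFrom p q y j k ≤ 0 := fun j k hjk => by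
      rcases eq_or_ne i j with rfl | hij
      · exact (h0 k).le
      rcases eq_or_ne i k with rfl | hik
      · rw [tripleFrom_swap, h0 j, neg_zero]
      exact hle j k hij hik hjk.ne
    linarith [key 0 1 (by decide), key 1 2 (by decide), key 2 3 (by decide)]
  have hrel := triple_relation p q y i j k
  have hb := h.isStarHexad.between i j k hij hik hjk
  have hki : tripleFrom p q y k i = 0 := by rw [tripleFrom_swap, h0, neg_zero]
  rw [h0 j, hki] at hrel hb
  simp only [zero_smul, add_zero, zero_add] at hrel hb
  -- With two triples zero the relation places `y i` on the segment from `p` to `q`.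
  refine h.isStarHexad.extreme j k i hij.symm hik.symm ?_
  set d := det3 (y i - p) (y j - p) (y k - p)
  set t := tripleFrom p q y j k
  have hd : 0 ≤ d ∧ 0 ≤ t - d := by
    constructor <;> nlinarith
  have hyi : y i = ((t - d) / t) • p + (d / t) • q := by
    have : t⁻¹ • (t • y i) = t⁻¹ • (d • q + (t - d) • p) := by rw [hrel]
    rw [smul_smul, inv_mul_cancel₀ hjk0.ne', one_smul, smul_add, smul_smul, smul_smul] at this
    rw [this, div_eq_inv_mul, div_eq_inv_mul, add_comm]
  have hseg : y i ∈ segment ℝ p q := ⟨(t - d) / t, d / t, div_nonneg hd.2 hjk0.le,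
    div_nonneg hd.1 hjk0.le, by field_simp; ring, hyi.symm⟩
  rw [← convexHull_pair] at hseg
  exact convexHull_mono (by intro x; simp; tauto) hseg

/-- The sign condition makes the plane through `p`, `q`, `y i` a supporting plane, with `ε`
orienting it; triangularity excludes further vertices on it. -/
lemma IsStarPolytope.wedge_eq_zero_iff (h : IsStarPolytope K p q y) (hf : IsFan p q y)
    (hT : HasTriangularFaces K) {i : Fin 4} (ε : ℝ) (hε : ε ≠ 0)
    (hi : ∀ j, 0 ≤ ε * tripleFrom p q y i j) {s : Space 3} (hs : s ∈ vertices K) :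
    0 ≤ ε * det3 (q - p) (y i - p) (s - p) ∧
    (ε * det3 (q - p) (y i - p) (s - p) = 0 ↔ s = p ∨ s = q ∨ s = y i) := by
  obtain ⟨g, hg⟩ := exists_affine_det3 (q - p) (y i - p) p
  have hg' : ∀ x, (ε • g) x = ε * det3 (q - p) (y i - p) (x - p) := fun x => by simp [hg]
  have hyv := h.forall_vertices (P := fun s => s ∈ vertices K)
  have hmem := hyv.1 fun _ => id
  have hnn : ∀ s ∈ vertices K, 0 ≤ (ε • g) s := by
    rw [h.forall_vertices]
    simp only [hg']
    refine ⟨by simp [det3], by apply le_of_eq; simp [det3]; ring_nf; simp, hi⟩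
  simp only [← hg']
  refine ⟨hnn s hs, h.eq_zero_iff hT hnn ?_ hmem.1 hmem.2.1 (hmem.2.2 i) h.ne (h.ne_left i)
    (h.ne_right i) ?_ ?_ ?_ hs⟩
  · obtain ⟨j, hj⟩ := h.exists_tripleFrom_ne_zero hf i
    exact ⟨y j, hmem.2.2 j, by rw [hg']; exact mul_ne_zero hε hj⟩
  all_goals rw [hg']; simp [det3]; try ring_nf
  all_goals tauto

lemma IsStarPolytope.tripleFrom_pos (h : IsStarPolytope K p q y) (hf : IsFan p q y)
    (hT : HasTriangularFaces K) (i j : Fin 4) (hij : i < j) : 0 < tripleFrom p q y i j := by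
  have hmem := (h.forall_vertices (P := fun s => s ∈ vertices K)).1 fun _ => id
  have h0 : ∀ j, 0 < j → 0 < tripleFrom p q y 0 j := fun j hj => by
    refine (hf 0 j hj).lt_of_ne' fun h0 => ?_
    have := (h.wedge_eq_zero_iff hf hT (i := 0) 1 one_ne_zero (fun j => ?_) (hmem.2.2 j)).2.1
      (by rw [one_mul]; exact h0)
    · rcases this with h1 | h1 | h1
      · exact h.ne_left j h1.symm
      · exact h.ne_right j h1.symm
      · exact hj.ne' (h.injective h1)
    · rcases eq_or_ne j 0 with rfl | hj
      · simp [tripleFrom, det3]; ring_nf; simp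
      · rw [one_mul]; exact hf 0 j (Fin.pos_of_ne_zero hj)
  have h3 : ∀ j, j < 3 → 0 < tripleFrom p q y j 3 := fun j hj => by
    refine (hf j 3 hj).lt_of_ne' fun h0 => ?_
    have := (h.wedge_eq_zero_iff hf hT (i := 3) (-1) (by norm_num) (fun j => ?_)
      (hmem.2.2 j)).2.1
      (by change -1 * tripleFrom p q y 3 j = 0; rw [tripleFrom_swap, h0]; ring)
    · rcases this with h1 | h1 | h1
      · exact h.ne_left j h1.symm
      · exact h.ne_right j h1.symm
      · exact hj.ne (h.injective h1)
    · rw [tripleFrom_swap, neg_one_mul, neg_neg]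
      rcases (Fin.le_last j).eq_or_lt with rfl | hj
      · simp [tripleFrom, det3]; ring_nf; simp
      · exact hf j 3 hj
  -- If this triple vanished, `y 1` and `y 2` would project to one ray, and `orientation_pos` in two
  -- positions would put each strictly nearer to the axis than the other. The Plücker relation turns
  -- this into a contradiction.
  have h12 : 0 < tripleFrom p q y 1 2 := by
    refine (hf 1 2 (by decide)).lt_of_ne' fun h12 => ?_
    have hpl := det3_pluecker (q - p) (y 0 - p) (y 1 - p) (y 2 - p) (y 3 - p)
    have h21 : tripleFrom p q y 2 1 = 0 := by rw [tripleFrom_swap, h12, neg_zero]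
    have i1 := h.isStarHexad.orientation_pos (i := 0) (j := 2) (k := 1) (by decide) (by decide)
      (by decide) (h0 2 (by decide)).le h21.ge (h0 1 (by decide))
    have i2 := h.isStarHexad.orientation_pos (i := 2) (j := 1) (k := 3) (by decide) (by decide)
      (by decide) h21.ge (h3 1 (by decide)).le (h3 2 (by decide))
    change tripleFrom p q y 0 1 * tripleFrom p q y 2 3 - tripleFrom p q y 0 2 *
      tripleFrom p q y 1 3 + tripleFrom p q y 0 3 * tripleFrom p q y 1 2 = 0 at hpl
    rw [h12] at hpl
    rw [h21] at i1 i2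
    nlinarith [h0 1 (by decide), h3 2 (by decide)]
  fin_cases i <;> fin_cases j <;> simp at hij ⊢
  all_goals first | exact h12 | exact h0 _ (by decide) | exact h3 _ (by decide)

/-- Round `p` there are the facets through `q, y 0`, then `y 0, y 1`, `y 1, y 2`, `y 2, y 3`, and `y
3, q`. Consecutive ones meet in an edge, so `p` is joined to all five other vertices. -/
lemma IsStarPolytope.four_lt_valence (h : IsStarPolytope K p q y) (hf : IsFan p q y)
    (hT : HasTriangularFaces K) : 4 < valence K p := by
  have hmem := (h.forall_vertices (P := fun s => s ∈ vertices K)).1 fun _ => id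
  have hpos := h.tripleFrom_pos hf hT
  have hnn : ∀ i j, i ≤ j → 0 ≤ tripleFrom p q y i j := fun i j hij => by
    rcases hij.eq_or_lt with rfl | hij
    · simp [tripleFrom, det3]; ring_nf; simp
    · exact (hpos i j hij).le
  have hd : ∀ i j k, i < j → j < k → 0 ≤ det3 (y i - p) (y j - p) (y k - p) :=
    fun i j k hij hjk => by
      have hS := h.isStarHexad.orientation_pos hij.ne (hij.trans hjk).ne hjk.ne (hnn i j hij.le)
        (hnn j k hjk.le) (hpos i k (hij.trans hjk))
      have hb := h.isStarHexad.between i j k hij.ne (hij.trans hjk).ne hjk.ne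
      rw [tripleFrom_swap p q y i k] at hb
      by_contra! hneg
      nlinarith
  have hstrip : ∀ i j, i < j → (∀ k, 0 ≤ det3 (y i - p) (y j - p) (y k - p)) →
      ∃ f : Space 3 →ᵃ[ℝ] ℝ, ∀ s ∈ vertices K, 0 ≤ f s ∧ (f s = 0 ↔ s = p ∨ s = y i ∨ s = y j) := by
    intro i j hij hk
    obtain ⟨f, hfd⟩ := exists_affine_det3 (y i - p) (y j - p) p
    have hq : f q = tripleFrom p q y i j := by
      rw [hfd]
      simp only [tripleFrom, det3]
      ring
    have hnn' : ∀ s ∈ vertices K, 0 ≤ f s := by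
      rw [h.forall_vertices]
      refine ⟨by rw [hfd]; simp [det3], by rw [hq]; exact hnn i j hij.le, fun k => ?_⟩
      rw [hfd]
      exact hk k
    refine ⟨f, fun s hs => ⟨hnn' s hs, ?_⟩⟩
    refine h.eq_zero_iff hT hnn' ⟨q, hmem.2.1, by rw [hq]; exact (hpos i j hij).ne'⟩ hmem.1
      (hmem.2.2 i) (hmem.2.2 j) (h.ne_left i) (h.ne_left j) (h.injective.ne hij.ne) ?_ ?_ ?_ hs
    all_goals rw [hfd]; simp only [det3, PiLp.sub_apply]; ring
  have hend : ∀ i : Fin 4, i = 0 ∨ i = 3 → ∃ f : Space 3 →ᵃ[ℝ] ℝ,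
      ∀ s ∈ vertices K, 0 ≤ f s ∧ (f s = 0 ↔ s = p ∨ s = q ∨ s = y i) := by
    intro i hi
    obtain ⟨g, hg⟩ := exists_affine_det3 (q - p) (y i - p) p
    obtain ⟨ε, hε, hi⟩ : ∃ ε : ℝ, ε ≠ 0 ∧ ∀ j, 0 ≤ ε * tripleFrom p q y i j := by
      rcases hi with rfl | rfl
      · exact ⟨1, one_ne_zero, fun j => by rw [one_mul]; exact hnn 0 j (Fin.zero_le _)⟩
      · refine ⟨-1, by norm_num, fun j => ?_⟩
        rw [tripleFrom_swap, neg_one_mul, neg_neg]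
        exact hnn j 3 (Fin.le_last _)
    refine ⟨ε • g, fun s hs => ?_⟩
    have := h.wedge_eq_zero_iff hf hT ε hε hi hs
    simpa [hg] using this
  obtain ⟨f0, hf0⟩ := hend 0 (Or.inl rfl)
  obtain ⟨f3, hf3⟩ := hend 3 (Or.inr rfl)
  have hrot : ∀ a b c : Space 3, det3 b c a = det3 a b c := fun a b c => by simp only [det3]; ring
  have hdd : ∀ a b : Space 3, det3 a b a = 0 ∧ det3 a b b = 0 := fun a b => by
    simp only [det3]; constructor <;> ring
  obtain ⟨f01, hf01⟩ := hstrip 0 1 (by decide) (fun k => by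
    fin_cases k
    exacts [(hdd _ _).1.ge, (hdd _ _).2.ge, hd 0 1 2 (by decide) (by decide),
      hd 0 1 3 (by decide) (by decide)])
  obtain ⟨f12, hf12⟩ := hstrip 1 2 (by decide) (fun k => by
    fin_cases k
    exacts [(hrot _ _ _).ge.trans' (hd 0 1 2 (by decide) (by decide)), (hdd _ _).1.ge,
      (hdd _ _).2.ge, hd 1 2 3 (by decide) (by decide)])
  obtain ⟨f23, hf23⟩ := hstrip 2 3 (by decide) (fun k => by
    fin_cases k
    exacts [(hrot _ _ _).ge.trans' (hd 0 2 3 (by decide) (by decide)),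
      (hrot _ _ _).ge.trans' (hd 1 2 3 (by decide) (by decide)), (hdd _ _).1.ge, (hdd _ _).2.ge])
  -- The sum of the supporting forms of two adjacent facets vanishes exactly at their common
  -- vertices.
  have hedge : ∀ {f g : Space 3 →ᵃ[ℝ] ℝ} {a b v : Space 3}, v ∈ vertices K → p ≠ v → a ≠ b →
      a ≠ v → b ≠ v → (∀ s ∈ vertices K, 0 ≤ f s ∧ (f s = 0 ↔ s = p ∨ s = a ∨ s = v)) →
      (∀ s ∈ vertices K, 0 ≤ g s ∧ (g s = 0 ↔ s = p ∨ s = v ∨ s = b)) → IsEdge K p v := by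
    intro f g a b v hv hpv hab hav hbv hf hg
    refine isEdge_of_nonneg (f := f + g) h.isPolytope.convexHull_vertices
      (fun s hs => add_nonneg (hf s hs).1 (hg s hs).1) hmem.1 hv hpv fun s hs => ?_
    have h1 := hf s hs
    have h2 := hg s hs
    have h3 : (f + g) s = 0 ↔ f s = 0 ∧ g s = 0 := by
      change f s + g s = 0 ↔ _
      constructor
      · intro h; constructor <;> linarith
      · rintro ⟨h, h'⟩; rw [h, h', add_zero]
    rw [h3, h1.2, h2.2]
    constructor
    · rintro ⟨h4, h5⟩
      rcases h4 with h4 | h4 | h4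
      · exact Or.inl h4
      · rcases h5 with h5 | h5 | h5
        · exact Or.inl h5
        · exact Or.inr h5
        · exact absurd (h4.symm.trans h5) hab
      · exact Or.inr h4
    · tauto
  have hinj : ∀ {i j : Fin 4}, i ≠ j → y i ≠ y j := fun hij => h.injective.ne hij
  have swap : ∀ {f : Space 3 →ᵃ[ℝ] ℝ} {a b : Space 3},
      (∀ s ∈ vertices K, 0 ≤ f s ∧ (f s = 0 ↔ s = p ∨ s = a ∨ s = b)) →
      (∀ s ∈ vertices K, 0 ≤ f s ∧ (f s = 0 ↔ s = p ∨ s = b ∨ s = a)) := fun hf s hs =>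
    ⟨(hf s hs).1, by rw [(hf s hs).2]; tauto⟩
  have hq : IsEdge K p q := hedge hmem.2.1 h.ne (hinj (by decide)) (h.ne_right 0).symm
    (h.ne_right 3).symm (swap hf0) hf3
  have h0 : IsEdge K p (y 0) := hedge (hmem.2.2 0) (h.ne_left 0) (h.ne_right 1) (h.ne_right 0)
    (hinj (by decide)) hf0 hf01
  have h1 : IsEdge K p (y 1) := hedge (hmem.2.2 1) (h.ne_left 1) (hinj (by decide))
    (hinj (by decide)) (hinj (by decide)) hf01 hf12
  have h2 : IsEdge K p (y 2) := hedge (hmem.2.2 2) (h.ne_left 2) (hinj (by decide))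
    (hinj (by decide)) (hinj (by decide)) hf12 hf23
  have h3 : IsEdge K p (y 3) := hedge (hmem.2.2 3) (h.ne_left 3) (h.ne_right 2).symm
    (hinj (by decide)) (h.ne_right 3) hf23 (swap hf3)
  have hsub : insert q (range y) ⊆ {v | IsEdge K p v} := by
    rintro v (rfl | ⟨i, rfl⟩)
    · exact hq
    · fin_cases i <;> assumption
  have hcard : (insert q (range y)).ncard = 5 := by
    rw [ncard_insert_of_notMem (by rintro ⟨i, hi⟩; exact h.ne_right i hi.symm),
      ← image_univ, ncard_image_of_injective _ h.injective, ncard_univ, Nat.card_fin]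
  have := ncard_le_ncard hsub (h.isPolytope.finite_vertices.subset fun v hv => hv.2.1)
  rw [hcard] at this
  exact this

/-- A polyhedron of octahedral type with six vertices and diameter `1` has volume at most
`1 / 6`. -/
lemma volume_le_of_isOctahedral (hK : K ∈ unitPolytopes 3 6) (hO : IsOctahedral K) :
    volume.real K ≤ 1 / 6 := by
  rcases exists_isFan_or_volume_le hK with ⟨p, q, y, h, hf⟩ | h
  · have hmem := (h.forall_vertices (P := fun s => s ∈ vertices K)).1 fun _ => id
    exact absurd (hO.2 p hmem.1) (not_le.2 (h.four_lt_valence hf hO.1))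
  · exact h

/-! ### The maximal polyhedron -/

/-- The six vertices of the polyhedron over a pentagon with parameters `x`, `t`, `z`. -/
noncomputable def pyramidPoint (x t z : ℝ) : Fin 6 → Space 3 :=
  ![!₂[0, z, 1 / 2], !₂[0, z, -(1 / 2)], !₂[1 / 2, t, 0], !₂[x, 0, 0], !₂[-x, 0, 0],
    !₂[-(1 / 2), t, 0]]

/-- The parameters `x`, `t`, `z` of a symmetric pentagon with `r = √3 / 2`. -/
structure IsPentagonData (x t z : ℝ) : Prop where
  x_pos : 0 < x
  x_lt : x < 1 / 2
  t_pos : 0 < t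
  t_lt : t < z
  t_sq : t ^ 2 = 1 - (1 / 2 + x) ^ 2
  z_sq : z ^ 2 = 3 / 4 - x ^ 2

namespace IsPentagonData

variable {x t z : ℝ}

/-- Keeps `P₁` and `P₄` strictly within `√3 / 2` of `P₅`, hence within `1` of the apexes. -/
lemma sub_sq_lt (h : IsPentagonData x t z) : (z - t) ^ 2 < 1 / 2 := by
  nlinarith [h.x_pos, h.x_lt, h.t_pos, h.t_lt, h.t_sq, h.z_sq]

lemma of_mem_Ioo (hx : x ∈ Ioo (0 : ℝ) (1 / 2)) :
    IsPentagonData x √(1 - (1 / 2 + x) ^ 2) √(3 / 4 - x ^ 2) where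
  x_pos := hx.1
  x_lt := hx.2
  t_pos := Real.sqrt_pos.2 (by nlinarith [hx.1, hx.2])
  t_lt := Real.sqrt_lt_sqrt (by nlinarith [hx.1, hx.2]) (by nlinarith [hx.1, hx.2])
  t_sq := Real.sq_sqrt (by nlinarith [hx.1, hx.2])
  z_sq := Real.sq_sqrt (by nlinarith [hx.1, hx.2])

lemma exists_support (h : IsPentagonData x t z) (i : Fin 6) : ∃ f : Space 3 →ᵃ[ℝ] ℝ,
    f (pyramidPoint x t z i) = 0 ∧ ∀ j, j ≠ i → 0 < f (pyramidPoint x t z j) := by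
  obtain ⟨hx, hx', ht, htz, -, -⟩ := h
  have hz : 0 < z := ht.trans htz
  have h1 := mul_pos ht hx
  fin_cases i
  on_goal 1 => refine ⟨affineForm 0 0 (-1) (1 / 2), ?_, fun j hj => ?_⟩
  on_goal 3 => refine ⟨affineForm 0 0 1 (1 / 2), ?_, fun j hj => ?_⟩
  on_goal 5 => refine ⟨affineForm (-1) 0 0 (1 / 2), ?_, fun j hj => ?_⟩
  on_goal 7 => refine ⟨affineForm (-t) 1 0 (t * x), ?_, fun j hj => ?_⟩
  on_goal 9 => refine ⟨affineForm t 1 0 (t * x), ?_, fun j hj => ?_⟩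
  on_goal 11 => refine ⟨affineForm 1 0 0 (1 / 2), ?_, fun j hj => ?_⟩
  all_goals first
    | (simp [affineForm_apply, pyramidPoint]; done)
    | (fin_cases j <;> simp [affineForm_apply, pyramidPoint] at hj ⊢ <;> nlinarith)

/-- Up to scaling, each form is the sum of the equations of the two facets along the edge. For
instance, `-t, 1 / 2 - x, -2 * (t * x + (1 / 2 - x) * z), t * x` is the facet through the upper
apex, `P₁` and `P₂`. -/
lemma exists_coefficients_edge (h : IsPentagonData x t z) {j : Fin 6} (hj : j ≠ 0) :
    ∃ a b c d : ℝ, affineForm a b c d (pyramidPoint x t z 0) = 0 ∧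
      affineForm a b c d (pyramidPoint x t z j) = 0 ∧
      ∀ k, k ≠ 0 → k ≠ j → 0 < affineForm a b c d (pyramidPoint x t z k) := by
  obtain ⟨hx, hx', ht, htz, -, -⟩ := h
  have hz : 0 < z := ht.trans htz
  have h1 := mul_pos ht hx
  have h2 := mul_pos hx hz
  have h3 : 0 < (1 / 2 - x) * z := mul_pos (by linarith) hz
  have h4 : 0 < (1 / 2 - x) * t := mul_pos (by linarith) ht
  fin_cases j
  · simp at hj
  on_goal 1 => refine ⟨0, -1, 0, z, ?_, ?_, fun k hk hk' => ?_⟩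
  on_goal 4 => refine ⟨-2 * (z - t) - t, -1 + (1 / 2 - x), -2 * (t * x + (1 / 2 - x) * z),
    z + t * x, ?_, ?_, fun k hk hk' => ?_⟩
  on_goal 7 => refine ⟨-t, 1 + (1 / 2 - x), -2 * z - 2 * (t * x + (1 / 2 - x) * z), t * x,
    ?_, ?_, fun k hk hk' => ?_⟩
  on_goal 10 => refine ⟨t, 1 + (1 / 2 - x), -2 * z - 2 * (t * x + (1 / 2 - x) * z), t * x,
    ?_, ?_, fun k hk hk' => ?_⟩
  on_goal 13 => refine ⟨2 * (z - t) + t, -1 + (1 / 2 - x), -2 * (t * x + (1 / 2 - x) * z),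
    z + t * x, ?_, ?_, fun k hk hk' => ?_⟩
  all_goals first
    | (simp [affineForm_apply, pyramidPoint]; done)
    | (simp [affineForm_apply, pyramidPoint]; ring; done)
    | (fin_cases k <;> simp [affineForm_apply, pyramidPoint] at hk hk' ⊢ <;> linarith)

/-- The edges of the polyhedron that contain one of the apexes. -/
lemma exists_support_edge (h : IsPentagonData x t z) {i j : Fin 6} (hi : i = 0 ∨ i = 1)
    (hij : i ≠ j) : ∃ f : Space 3 →ᵃ[ℝ] ℝ,
    f (pyramidPoint x t z i) = 0 ∧ f (pyramidPoint x t z j) = 0 ∧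
    ∀ k, k ≠ i → k ≠ j → 0 < f (pyramidPoint x t z k) := by
  rcases hi with rfl | rfl
  · obtain ⟨a, b, c, d, hf⟩ := h.exists_coefficients_edge hij.symm
    exact ⟨_, hf⟩
  · have hswap : ∀ k, k ≠ 1 → Equiv.swap 0 1 k ≠ (0 : Fin 6) := by decide
    -- Reflection in the plane of the pentagon exchanges the apexes and fixes the other vertices.
    have hflip : ∀ a b c d k, affineForm a b (-c) d (pyramidPoint x t z k) =
        affineForm a b c d (pyramidPoint x t z (Equiv.swap 0 1 k)) := fun a b c d k => by
      fin_cases k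
      · change _ = affineForm a b c d (pyramidPoint x t z 1)
        simp [affineForm_apply, pyramidPoint]
      · change _ = affineForm a b c d (pyramidPoint x t z 0)
        simp [affineForm_apply, pyramidPoint]
      · change _ = affineForm a b c d (pyramidPoint x t z 2)
        simp [affineForm_apply, pyramidPoint]
      · change _ = affineForm a b c d (pyramidPoint x t z 3)
        simp [affineForm_apply, pyramidPoint]
      · change _ = affineForm a b c d (pyramidPoint x t z 4)
        simp [affineForm_apply, pyramidPoint]
      · change _ = affineForm a b c d (pyramidPoint x t z 5)
        simp [affineForm_apply, pyramidPoint]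
    obtain ⟨a, b, c, d, h0, h1, hf⟩ := h.exists_coefficients_edge (hswap j hij.symm)
    refine ⟨affineForm a b (-c) d, ?_, ?_, fun k hk hk' => ?_⟩
    · rw [hflip, Equiv.swap_apply_right, h0]
    · rw [hflip, h1]
    · rw [hflip]
      exact hf _ (hswap k hk) ((Equiv.swap 0 1).injective.ne hk')

lemma injective (h : IsPentagonData x t z) : Function.Injective (pyramidPoint x t z) := by
  intro i j hij
  by_contra hne
  obtain ⟨f, h0, hf⟩ := h.exists_support i
  exact (hf j (Ne.symm hne)).ne' (hij ▸ h0)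

lemma vertices_eq (h : IsPentagonData x t z) :
    vertices (convexHull ℝ (range (pyramidPoint x t z))) = range (pyramidPoint x t z) := by
  apply Subset.antisymm extremePoints_convexHull_subset
  rintro _ ⟨i, rfl⟩
  obtain ⟨f, h0, hf⟩ := h.exists_support i
  refine mem_vertices_of_nonneg (f := f) ?_ (mem_range_self i) ?_
  · rintro _ ⟨j, rfl⟩
    rcases eq_or_ne j i with rfl | hj
    exacts [h0.ge, (hf j hj).le]
  · rintro _ ⟨j, rfl⟩
    rcases eq_or_ne j i with rfl | hj
    · simp [h0]
    · simp [(hf j hj).ne', h.injective.ne hj]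

lemma isEdge (h : IsPentagonData x t z) {i j : Fin 6} (hi : i = 0 ∨ i = 1) (hij : i ≠ j) :
    IsEdge (convexHull ℝ (range (pyramidPoint x t z))) (pyramidPoint x t z i)
      (pyramidPoint x t z j) := by
  obtain ⟨f, h0, h0', hf⟩ := h.exists_support_edge hi hij
  have hf' : ∀ k, 0 ≤ f (pyramidPoint x t z k) ∧ (f (pyramidPoint x t z k) = 0 ↔ k = i ∨ k = j) := by
    intro k
    rcases eq_or_ne k i with rfl | hki
    · simp [h0]
    rcases eq_or_ne k j with rfl | hkj
    · simp [h0']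
    exact ⟨(hf k hki hkj).le, by simp [(hf k hki hkj).ne', hki, hkj]⟩
  refine isEdge_of_nonneg (f := f) (by rw [h.vertices_eq]) ?_ ?_ ?_ (h.injective.ne hij) ?_
  all_goals rw [h.vertices_eq]
  · rintro _ ⟨k, rfl⟩
    exact (hf' k).1
  · exact mem_range_self i
  · exact mem_range_self j
  · rintro _ ⟨k, rfl⟩
    rw [(hf' k).2, h.injective.eq_iff, h.injective.eq_iff]

/-- The two affine dependences between the vertices. -/
lemma affine_relations (x t z : ℝ) (f : Space 3 →ᵃ[ℝ] ℝ) :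
    2 * x * (f (pyramidPoint x t z 2) - f (pyramidPoint x t z 5)) =
      f (pyramidPoint x t z 3) - f (pyramidPoint x t z 4) ∧
    z * (f (pyramidPoint x t z 2) + f (pyramidPoint x t z 5)) =
      (z - t) * (f (pyramidPoint x t z 3) + f (pyramidPoint x t z 4)) +
      t * (f (pyramidPoint x t z 0) + f (pyramidPoint x t z 1)) := by
  have key : ∀ u, f u = f.linear u + f 0 := fun u => by
    have := f.linearMap_vsub u 0
    simp at this
    rw [this]; ring
  have e1 : (2 * x) • (pyramidPoint x t z 2 - pyramidPoint x t z 5) =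
      pyramidPoint x t z 3 - pyramidPoint x t z 4 := by
    ext i; fin_cases i <;> simp [pyramidPoint]; ring
  have e2 : z • (pyramidPoint x t z 2 + pyramidPoint x t z 5) =
      (z - t) • (pyramidPoint x t z 3 + pyramidPoint x t z 4) +
      t • (pyramidPoint x t z 0 + pyramidPoint x t z 1) := by
    ext i; fin_cases i <;> simp [pyramidPoint]; ring
  have e1 := congrArg f.linear e1
  have e2 := congrArg f.linear e2
  simp only [map_smul, map_sub, map_add, smul_eq_mul] at e1 e2
  simp only [key (pyramidPoint x t z _)]
  constructor <;> linarith

/-- Applied to the values of a supporting form: three nonzero values leave at most three vertices on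
a face. With at most two nonzero values, the cases on `a 2` and `a 5` contradict the relations
because `2 * x < 1` and `0 < t < z`. -/
lemma exists_three_ne_zero (h : IsPentagonData x t z) {a : Fin 6 → ℝ} (ha : ∀ i, 0 ≤ a i)
    (ha0 : ∃ i, a i ≠ 0) (r1 : 2 * x * (a 2 - a 5) = a 3 - a 4)
    (r2 : z * (a 2 + a 5) = (z - t) * (a 3 + a 4) + t * (a 0 + a 1)) :
    ∃ i j k, i ≠ j ∧ i ≠ k ∧ j ≠ k ∧ a i ≠ 0 ∧ a j ≠ 0 ∧ a k ≠ 0 := by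
  have hx := h.x_pos
  have hx' := h.x_lt
  have ht := h.t_pos
  have htz := sub_pos.2 h.t_lt
  by_contra! hno
  have hlast : ∀ i j, i ≠ j → a i ≠ 0 → a j ≠ 0 → ∀ k, i ≠ k → j ≠ k → a k = 0 :=
    fun i j hij hi hj k hik hjk => hno i j k hij hik hjk hi hj
  rcases (ha 2).eq_or_lt with h2 | h2 <;> rcases (ha 5).eq_or_lt with h5 | h5
  · rw [← h2, ← h5, add_zero, mul_zero] at r2
    have i1 := mul_nonneg htz.le (ha 3)
    have i2 := mul_nonneg htz.le (ha 4)
    have i3 := mul_nonneg ht.le (ha 0)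
    have i4 := mul_nonneg ht.le (ha 1)
    have e1 : a 3 = 0 := (mul_eq_zero.1 (by linarith : (z - t) * a 3 = 0)).resolve_left htz.ne'
    have e2 : a 4 = 0 := (mul_eq_zero.1 (by linarith : (z - t) * a 4 = 0)).resolve_left htz.ne'
    have e3 : a 0 = 0 := (mul_eq_zero.1 (by linarith : t * a 0 = 0)).resolve_left ht.ne'
    have e4 : a 1 = 0 := (mul_eq_zero.1 (by linarith : t * a 1 = 0)).resolve_left ht.ne'
    obtain ⟨i, hi⟩ := ha0
    fin_cases i
    exacts [hi e3, hi e4, hi h2.symm, hi e1, hi e2, hi h5.symm]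
  · rw [← h2] at r1 r2
    have i1 := mul_pos hx h5
    have h4 : 0 < a 4 := by linarith [ha 3]
    have h0 := hlast 4 5 (by decide) h4.ne' h5.ne'
    rw [h0 3 (by decide) (by decide)] at r1 r2
    rw [h0 0 (by decide) (by decide), h0 1 (by decide) (by decide)] at r2
    have e : a 4 = 2 * x * a 5 := by linarith
    rw [e] at r2
    nlinarith [mul_pos ht h5, mul_pos htz h5, mul_pos (mul_pos htz h5) (sub_pos.2 hx')]
  · rw [← h5] at r1 r2
    have i1 := mul_pos hx h2
    have h3 : 0 < a 3 := by linarith [ha 4]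
    have h0 := hlast 2 3 (by decide) h2.ne' h3.ne'
    rw [h0 4 (by decide) (by decide)] at r1 r2
    rw [h0 0 (by decide) (by decide), h0 1 (by decide) (by decide)] at r2
    have e : a 3 = 2 * x * a 2 := by linarith
    rw [e] at r2
    nlinarith [mul_pos ht h2, mul_pos htz h2, mul_pos (mul_pos htz h2) (sub_pos.2 hx')]
  · have h0 := hlast 2 5 (by decide) h2.ne' h5.ne'
    rw [h0 3 (by decide) (by decide), h0 4 (by decide) (by decide), h0 0 (by decide) (by decide),
      h0 1 (by decide) (by decide)] at r2
    nlinarith [mul_pos (ht.trans h.t_lt) (add_pos h2 h5)]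

lemma ncard_zero_set_le (h : IsPentagonData x t z) {f : Space 3 →ᵃ[ℝ] ℝ}
    (hf : ∀ i, 0 ≤ f (pyramidPoint x t z i)) (hf0 : ∃ i, f (pyramidPoint x t z i) ≠ 0) :
    {s ∈ range (pyramidPoint x t z) | f s = 0}.ncard ≤ 3 := by
  obtain ⟨r1, r2⟩ := affine_relations x t z f
  have hx := h.x_pos
  have ht := h.t_pos
  have htz := sub_pos.2 h.t_lt
  obtain ⟨i, j, k, hij, hik, hjk, hi, hj, hk⟩ : ∃ i j k, i ≠ j ∧ i ≠ k ∧ j ≠ k ∧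
      f (pyramidPoint x t z i) ≠ 0 ∧ f (pyramidPoint x t z j) ≠ 0 ∧
      f (pyramidPoint x t z k) ≠ 0 := by
    exact exists_three_ne_zero h (a := fun i => f (pyramidPoint x t z i)) hf hf0 r1 r2
  have hsub : {s ∈ range (pyramidPoint x t z) | f s = 0} ⊆
      pyramidPoint x t z '' ((Finset.univ \ {i, j, k} : Finset (Fin 6)) : Set (Fin 6)) := by
    rintro _ ⟨⟨m, rfl⟩, hm⟩
    refine ⟨m, ?_, rfl⟩
    simp only [Finset.coe_sdiff, Finset.coe_univ, mem_sdiff, mem_univ, true_and, Finset.mem_coe,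
      Finset.mem_insert, Finset.mem_singleton]
    rintro (rfl | rfl | rfl) <;> contradiction
  refine (ncard_le_ncard hsub (toFinite _)).trans ((ncard_image_le (toFinite _)).trans ?_)
  rw [ncard_coe_finset, Finset.card_sdiff_of_subset (Finset.subset_univ _),
    Finset.card_eq_three.2 ⟨i, j, k, hij, hik, hjk, rfl⟩]
  simp

lemma hasTriangularFaces (h : IsPentagonData x t z) :
    HasTriangularFaces (convexHull ℝ (range (pyramidPoint x t z))) := by
  refine hasTriangularFaces_of_ncard_le (by rw [h.vertices_eq])
    (by rw [h.vertices_eq]; exact finite_range _) fun f hf hf0 => ?_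
  rw [h.vertices_eq] at *
  exact h.ncard_zero_set_le (fun i => hf _ (mem_range_self i)) (by simpa using hf0)

lemma dist_le_one (h : IsPentagonData x t z) (i j : Fin 6) :
    dist (pyramidPoint x t z i) (pyramidPoint x t z j) ≤ 1 := by
  have h0 := h.sub_sq_lt
  obtain ⟨hx, hx', ht, htz, ht2, hz2⟩ := h
  rw [dist_le_one_iff]
  fin_cases i <;> fin_cases j <;> simp [pyramidPoint]
  all_goals first
    | nlinarith
    | (rw [abs_le]; constructor <;> linarith)

lemma diam_eq (h : IsPentagonData x t z) :
    Metric.diam (convexHull ℝ (range (pyramidPoint x t z))) = 1 := by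
  rw [convexHull_diam]
  apply le_antisymm
  · refine Metric.diam_le_of_forall_dist_le zero_le_one ?_
    rintro _ ⟨i, rfl⟩ _ ⟨j, rfl⟩
    exact h.dist_le_one i j
  · have := Metric.dist_le_diam_of_mem (finite_range (pyramidPoint x t z)).isBounded
      (mem_range_self 0) (mem_range_self 1)
    have h1 := dist_sq_three (pyramidPoint x t z 0) (pyramidPoint x t z 1)
    simp [pyramidPoint] at h1
    norm_num at h1
    have : dist (pyramidPoint x t z 0) (pyramidPoint x t z 1) = 1 := by
      simpa [pyramidPoint] using h1
    linarith

/-- A form exposing the segment would also vanish at vertex `k`, which would then lie on the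
segment. It excludes the diagonals of the trapezoid `P₁P₂P₃P₄`. -/
lemma not_isEdge_of_relation (h : IsPentagonData x t z) {i j k l : Fin 6} (hki : k ≠ i)
    (hkj : k ≠ j) {u v : ℝ} (hu : 0 < u) (hv : 0 ≤ v)
    (hrel : ∀ f : Space 3 →ᵃ[ℝ] ℝ, f (pyramidPoint x t z i) = 0 → f (pyramidPoint x t z j) = 0 →
      u * f (pyramidPoint x t z k) + v * f (pyramidPoint x t z l) = 0) :
    ¬ IsEdge (convexHull ℝ (range (pyramidPoint x t z))) (pyramidPoint x t z i)
      (pyramidPoint x t z j) := by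
  rintro ⟨-, -, -, hexp⟩
  have hi := left_mem_segment ℝ (pyramidPoint x t z i) (pyramidPoint x t z j)
  have hj := right_mem_segment ℝ (pyramidPoint x t z i) (pyramidPoint x t z j)
  obtain ⟨g, hg⟩ := hexp ⟨_, hi⟩
  have hmem : ∀ m, pyramidPoint x t z m ∈ convexHull ℝ (range (pyramidPoint x t z)) := fun m =>
    subset_convexHull ℝ _ (mem_range_self m)
  have hi' := hi
  rw [hg] at hi' hj
  set f : Space 3 →ᵃ[ℝ] ℝ := AffineMap.const ℝ (Space 3) (g (pyramidPoint x t z i)) -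
    g.toLinearMap.toAffineMap
  have hf : ∀ s, f s = g (pyramidPoint x t z i) - g s := fun s => rfl
  have := hrel f (by rw [hf, sub_self])
    (by rw [hf]; linarith [hi'.2 _ (hmem j), hj.2 _ (hmem i)])
  have fk : 0 ≤ f (pyramidPoint x t z k) := by rw [hf]; linarith [hi'.2 _ (hmem k)]
  have fl : 0 ≤ f (pyramidPoint x t z l) := by rw [hf]; linarith [hi'.2 _ (hmem l)]
  have fk0 : f (pyramidPoint x t z k) = 0 := by
    have := mul_nonneg hv fl
    by_contra hne
    have := mul_pos hu (lt_of_le_of_ne' fk hne)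
    linarith
  have hk : pyramidPoint x t z k ∈ segment ℝ (pyramidPoint x t z i) (pyramidPoint x t z j) := by
    rw [hg]
    rw [hf, sub_eq_zero] at fk0
    exact ⟨hmem k, fun y hy => by rw [← fk0]; exact hi'.2 y hy⟩
  have hver : pyramidPoint x t z k ∈ vertices (convexHull ℝ (range (pyramidPoint x t z))) := by
    rw [h.vertices_eq]
    exact mem_range_self k
  rcases (mem_extremePoints_iff_forall_segment.1 hver).2 _ (hmem i) _ (hmem j) hk with h1 | h1
  · exact hki (h.injective h1.symm)
  · exact hkj (h.injective h1.symm)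

lemma valence_eq_five_iff (h : IsPentagonData x t z) (i : Fin 6) :
    valence (convexHull ℝ (range (pyramidPoint x t z))) (pyramidPoint x t z i) = 5 ↔
      i = 0 ∨ i = 1 := by
  have hsub : {v | IsEdge (convexHull ℝ (range (pyramidPoint x t z))) (pyramidPoint x t z i) v} ⊆
      pyramidPoint x t z '' {i}ᶜ := by
    rintro v ⟨-, hv, hne, -⟩
    rw [h.vertices_eq] at hv
    obtain ⟨j, rfl⟩ := hv
    exact ⟨j, fun hj => hne (by rw [hj]), rfl⟩
  have hcard : (pyramidPoint x t z '' {i}ᶜ).ncard = 5 := by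
    rw [ncard_image_of_injective _ h.injective, ← Finset.coe_singleton, ← Finset.coe_compl,
      ncard_coe_finset, Finset.card_compl]
    simp
  constructor
  · intro hval
    have heq := eq_of_subset_of_ncard_le hsub (by rw [hcard]; exact hval.ge) (toFinite _)
    have hedge : ∀ j, j ≠ i → IsEdge (convexHull ℝ (range (pyramidPoint x t z)))
        (pyramidPoint x t z i) (pyramidPoint x t z j) := fun j hj => by
      have : pyramidPoint x t z j ∈ pyramidPoint x t z '' {i}ᶜ := ⟨j, hj, rfl⟩
      rwa [← heq] at this
    have hx := h.x_pos
    by_contra! hi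
    have cases : i = 2 ∨ i = 3 ∨ i = 4 ∨ i = 5 := by omega
    rcases cases with rfl | rfl | rfl | rfl
    · refine h.not_isEdge_of_relation (k := 3) (l := 5) (u := 1) (v := 2 * x) (by decide)
        (by decide) one_pos (by linarith) (fun f h1 h2 => ?_) (hedge 4 (by decide))
      have := (affine_relations x t z f).1
      rw [h1, h2] at this
      linarith
    · refine h.not_isEdge_of_relation (k := 4) (l := 2) (u := 1) (v := 2 * x) (by decide)
        (by decide) one_pos (by linarith) (fun f h1 h2 => ?_) (hedge 5 (by decide))
      have := (affine_relations x t z f).1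
      rw [h1, h2] at this
      linarith
    · refine h.not_isEdge_of_relation (k := 3) (l := 5) (u := 1) (v := 2 * x) (by decide)
        (by decide) one_pos (by linarith) (fun f h1 h2 => ?_) (hedge 2 (by decide))
      have := (affine_relations x t z f).1
      rw [h1, h2] at this
      linarith
    · refine h.not_isEdge_of_relation (k := 4) (l := 2) (u := 1) (v := 2 * x) (by decide)
        (by decide) one_pos (by linarith) (fun f h1 h2 => ?_) (hedge 3 (by decide))
      have := (affine_relations x t z f).1
      rw [h1, h2] at this
      linarith
  · intro hi
    rw [valence, ← hcard]
    congr 1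
    refine hsub.antisymm ?_
    rintro _ ⟨j, hj, rfl⟩
    exact h.isEdge hi (Ne.symm hj)

/-! ### Volume of the maximal polyhedron. -/

lemma volume_union_of_separated {s u : Set (Space 3)} (hs : IsCompact s) (hu : IsCompact u)
    {f : Space 3 →ᵃ[ℝ] ℝ} {w : Space 3} (hw : f w ≠ 0) (h1 : ∀ x ∈ s, 0 ≤ f x)
    (h2 : ∀ x ∈ u, 0 ≤ (-f) x) :
    volume.real (s ∪ u) = volume.real s + volume.real u := by
  have hnull : volume (s ∩ u) = 0 := by
    let H : AffineSubspace ℝ (Space 3) := (AffineSubspace.mk' (0 : ℝ) ⊥).comap f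
    have hH : ∀ x, x ∈ H ↔ f x = 0 := fun x => by simp [H]
    refine measure_mono_null (t := (H : Set (Space 3))) ?_ (Measure.addHaar_affineSubspace _ H ?_)
    · rintro x ⟨hx, hx'⟩
      have h3 : 0 ≤ -f x := h2 x hx'
      exact (hH x).2 (le_antisymm (by linarith) (h1 x hx))
    · intro htop
      exact hw ((hH w).1 (by rw [htop]; trivial))
  exact measureReal_union₀ hu.measurableSet.nullMeasurableSet hnull
    hs.measure_lt_top.ne hu.measure_lt_top.ne

/-- Three tetrahedra on the edge between the apexes, separated by the planes through that edge and
`P₂` or `P₃`. The reverse inequality comes from the general bound for fans. -/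
lemma le_volume (h : IsPentagonData x t z) : (z + 2 * x * t) / 6 ≤
    volume.real (convexHull ℝ (range (pyramidPoint x t z))) := by
  obtain ⟨hx, hx', ht, htz, ht2, hz2⟩ := h
  have hz : 0 < z := ht.trans htz
  have h1 := mul_pos ht hx
  have h2 := mul_pos hx hz
  have h3 : 0 < (1 / 2 - x) * z := mul_pos (by linarith) hz
  set X := pyramidPoint x t z with hX
  set T : Fin 6 → Fin 6 → Set (Space 3) := fun i j => convexHull ℝ {X 0, X 1, X i, X j} with hT
  have hTc : ∀ i j, IsCompact (T i j) := fun i j => (toFinite _).isCompact_convexHull ℝ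
  have hTX : ∀ i j, T i j ⊆ convexHull ℝ (range X) := fun i j => by
    apply convexHull_mono
    rintro v (rfl | rfl | rfl | rfl) <;> exact mem_range_self _
  have hnn : ∀ (f : Space 3 →ᵃ[ℝ] ℝ) i j, 0 ≤ f (X 0) → 0 ≤ f (X 1) → 0 ≤ f (X i) → 0 ≤ f (X j) →
      ∀ v ∈ T i j, 0 ≤ f v := fun f i j f0 f1 fi fj v hv => by
    refine convexHull_nonneg ?_ hv
    rintro v (rfl | rfl | rfl | rfl) <;> assumption
  have v1 : volume.real (T 2 3) = (z / 2 - x * z + x * t) / 6 := by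
    rw [hT, volume_convexHull_quad, abs_of_nonneg]
    all_goals simp [det3, hX, pyramidPoint]; ring_nf
    linarith
  have v2 : volume.real (T 3 4) = (2 * x * z) / 6 := by
    rw [hT, volume_convexHull_quad, abs_of_nonneg]
    all_goals simp [det3, hX, pyramidPoint]; ring_nf
    linarith
  have v3 : volume.real (T 4 5) = (z / 2 - x * z + x * t) / 6 := by
    rw [hT, volume_convexHull_quad, abs_of_nonneg]
    all_goals simp [det3, hX, pyramidPoint]; ring_nf
    linarith
  have u1 : volume.real (T 2 3 ∪ (T 3 4 ∪ T 4 5)) =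
      volume.real (T 2 3) + volume.real (T 3 4 ∪ T 4 5) := by
    refine volume_union_of_separated (hTc _ _) ((hTc _ _).union (hTc _ _))
      (f := affineForm z x 0 (-(x * z))) (w := X 4) ?_ (hnn _ _ _ ?_ ?_ ?_ ?_) ?_
    on_goal 6 => rintro v (hv | hv)
    on_goal 6 => refine hnn _ 3 4 ?_ ?_ ?_ ?_ v hv
    on_goal 10 => refine hnn _ 4 5 ?_ ?_ ?_ ?_ v hv
    all_goals first
      | (simp [affineForm_apply, hX, pyramidPoint]; done)
      | (simp [affineForm_apply, hX, pyramidPoint]; nlinarith)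
  have u2 : volume.real (T 3 4 ∪ T 4 5) = volume.real (T 3 4) + volume.real (T 4 5) := by
    refine volume_union_of_separated (hTc _ _) (hTc _ _)
      (f := affineForm z (-x) 0 (x * z)) (w := X 3) ?_ (hnn _ _ _ ?_ ?_ ?_ ?_)
      (hnn _ _ _ ?_ ?_ ?_ ?_)
    all_goals first
      | (simp [affineForm_apply, hX, pyramidPoint]; done)
      | (simp [affineForm_apply, hX, pyramidPoint]; nlinarith)
  have hle : volume.real (T 2 3 ∪ (T 3 4 ∪ T 4 5)) ≤ volume.real (convexHull ℝ (range X)) :=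
    measureReal_mono (union_subset (hTX _ _) (union_subset (hTX _ _) (hTX _ _)))
      ((finite_range X).isCompact_convexHull ℝ).measure_lt_top.ne
  rw [u1, u2, v1, v2, v3] at hle
  linarith

lemma mem_unitPolytopes (h : IsPentagonData x t z) :
    convexHull ℝ (range (pyramidPoint x t z)) ∈ unitPolytopes 3 6 := by
  refine ⟨⟨⟨Finset.univ.image (pyramidPoint x t z), by simp⟩, ?_⟩, ?_, h.diam_eq⟩
  -- A convex set has a null frontier, so positive volume forces an interior point.
  · by_contra! hint
    have hpos : 0 < volume.real (convexHull ℝ (range (pyramidPoint x t z))) :=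
      lt_of_lt_of_le (by have := mul_pos h.x_pos h.t_pos; linarith [h.t_pos, h.t_lt]) h.le_volume
    have h0 := (convex_convexHull ℝ (range (pyramidPoint x t z))).addHaar_frontier volume
    have hsub : convexHull ℝ (range (pyramidPoint x t z)) ⊆
        frontier (convexHull ℝ (range (pyramidPoint x t z))) := by
      rw [frontier, hint, sdiff_empty]
      exact subset_closure
    rw [measureReal_def, measure_mono_null hsub h0] at hpos
    simp at hpos
  · rw [h.vertices_eq, ← image_univ, ncard_image_of_injective _ h.injective, ncard_univ,
      Nat.card_fin]

end IsPentagonData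

end SmallPolytope

namespace SmallPolytope

/-! ### The diameter graph and the conclusion. -/

lemma polyhedronOver_symmetricPentagon (x : ℝ) :
    polyhedronOver 1 (symmetricPentagon (√3 / 2) x) =
      convexHull ℝ (range (pyramidPoint x √(1 - (1 / 2 + x) ^ 2) √(3 / 4 - x ^ 2))) := by
  rw [polyhedronOver]
  congr 1
  ext v
  simp only [mem_insert_iff, mem_singleton_iff, mem_range, Fin.exists_fin_succ, lift,
    symmetricPentagon, pyramidPoint, sqrt_three_half_sq]
  simp [eq_comm]

lemma dist_sq_two (a b : Space 2) : dist a b ^ 2 = (a 0 - b 0) ^ 2 + (a 1 - b 1) ^ 2 := by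
  rw [EuclideanSpace.dist_eq, Real.sq_sqrt (by positivity), Fin.sum_univ_two]
  simp [Real.dist_eq, sq_abs]

lemma diameterGraph_eq_starGraph {x : ℝ} (hx : x ∈ Ioo (0 : ℝ) (1 / 2)) :
    diameterGraph (√3 / 2) (symmetricPentagon (√3 / 2) x) = starGraph := by
  have h := IsPentagonData.of_mem_Ioo hx
  have hs := h.sub_sq_lt
  obtain ⟨hx, hx', ht, htz, ht2, hz2⟩ := h
  have hP : symmetricPentagon (√3 / 2) x = ![!₂[1 / 2, √(1 - (1 / 2 + x) ^ 2)], !₂[x, 0],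
      !₂[-x, 0], !₂[-(1 / 2), √(1 - (1 / 2 + x) ^ 2)], !₂[0, √(3 / 4 - x ^ 2)]] := by
    rw [symmetricPentagon, sqrt_three_half_sq]
  rw [hP]
  generalize √(1 - (1 / 2 + x) ^ 2) = t at *
  generalize √(3 / 4 - x ^ 2) = z at *
  have key : ∀ (a b : Space 2) (i j : Fin 5), dist a b = (if i = 4 ∨ j = 4 then √3 / 2 else 1) ↔
      (a 0 - b 0) ^ 2 + (a 1 - b 1) ^ 2 = if i = 4 ∨ j = 4 then 3 / 4 else 1 := fun a b i j => by
    rw [← dist_sq_two, ← sq_eq_sq₀ dist_nonneg (by split_ifs <;> positivity)]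
    split_ifs
    · rw [sqrt_three_half_sq]
    · rw [one_pow]
  ext i j
  simp only [diameterGraph, key, starGraph, SimpleGraph.fromEdgeSet_adj]
  fin_cases i <;> fin_cases j <;> simp
  all_goals first
    | nlinarith
    | (constructor <;> intro hc <;> linarith)
    | norm_num

end SmallPolytope

open SmallPolytope in
theorem mainTheorem3 :
    -- the maximum exists and equals `0.1954…`
    IsGreatest ((fun K : Set (Space 3) => volume.real K) '' unitPolytopes 3 6) (V 3 6) ∧
    0.1954 ≤ V 3 6 ∧ V 3 6 < 0.1955 ∧
    -- the maximizer: pyramidal, with `h = 1`, over the symmetric pentagon with star diameter graph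
    (∃ x₀ ∈ Ioo (0 : ℝ) (1 / 2),
      (∀ x ∈ Icc (0 : ℝ) (1 / 2), x ≠ x₀ → A (√3 / 2) x < A (√3 / 2) x₀) ∧
      diameterGraph (√3 / 2) (symmetricPentagon (√3 / 2) x₀) = starGraph ∧
      polyhedronOver 1 (symmetricPentagon (√3 / 2) x₀) ∈ unitPolytopes 3 6 ∧
      IsPyramidal (polyhedronOver 1 (symmetricPentagon (√3 / 2) x₀)) ∧
      {u ∈ vertices (polyhedronOver 1 (symmetricPentagon (√3 / 2) x₀)) |
          valence (polyhedronOver 1 (symmetricPentagon (√3 / 2) x₀)) u = 5} =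
        {lift (symmetricPentagon (√3 / 2) x₀ 4) (1 / 2),
          lift (symmetricPentagon (√3 / 2) x₀ 4) (-(1 / 2))} ∧
      V 3 6 = volume.real (polyhedronOver 1 (symmetricPentagon (√3 / 2) x₀)) ∧
      V 3 6 = A (√3 / 2) x₀ / 3 ∧
      -- uniqueness up to congruence
      ∀ K ∈ unitPolytopes 3 6, volume.real K = V 3 6 →
        ∃ f : Space 3 ≃ᵢ Space 3,
          f '' polyhedronOver 1 (symmetricPentagon (√3 / 2) x₀) = K) ∧
    -- the octahedral type
    (∀ K ∈ unitPolytopes 3 6, IsOctahedral K → volume.real K ≤ 1 / 6) := by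
  obtain ⟨x₀, hx₀, hmax⟩ := exists_A_maximizer
  set K₀ := polyhedronOver 1 (symmetricPentagon (√3 / 2) x₀) with hK₀
  have hd := IsPentagonData.of_mem_Ioo hx₀
  have hK₀' := polyhedronOver_symmetricPentagon x₀
  have hA := two_mul_A (x := x₀)
  have hA1 : 1.1724 < 2 * A (√3 / 2) x₀ := by
    have h3 := two_mul_A_three_tenths_gt
    by_cases h : (0.3 : ℝ) = x₀
    · rwa [← h]
    · linarith [hmax 0.3 (by norm_num) h]
  have hA2 := two_mul_A_lt (Ioo_subset_Icc_self hx₀)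
  have hbound : ∀ K ∈ unitPolytopes 3 6, volume.real K ≤ A (√3 / 2) x₀ / 3 ∧
      (volume.real K = A (√3 / 2) x₀ / 3 → ∃ f : Space 3 ≃ᵢ Space 3, f '' K₀ = K) := by
    intro K hK
    rcases exists_isFan_or_volume_le hK with ⟨p, q, y, h, hf⟩ | h
    · exact volume_le_of_isFan hx₀ hmax hK h hf
    -- The cyclic case is never optimal, as `2 * A (√3 / 2) x₀ > 1`.
    · exact ⟨by linarith, fun heq => by linarith⟩
  have hmem : K₀ ∈ unitPolytopes 3 6 := by
    rw [hK₀, hK₀']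
    exact hd.mem_unitPolytopes
  have hvol : volume.real K₀ = A (√3 / 2) x₀ / 3 := by
    refine le_antisymm (hbound K₀ hmem).1 ?_
    have := hd.le_volume
    rw [← hK₀', ← hK₀] at this
    linarith
  have hgreat : IsGreatest ((fun K : Set (Space 3) => volume.real K) '' unitPolytopes 3 6)
      (A (√3 / 2) x₀ / 3) :=
    ⟨⟨K₀, hmem, hvol⟩, by rintro _ ⟨K, hK, rfl⟩; exact (hbound K hK).1⟩
  have hV : V 3 6 = A (√3 / 2) x₀ / 3 := hgreat.csSup_eq
  have hval : {u ∈ vertices K₀ | valence K₀ u = 5} =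
      {lift (symmetricPentagon (√3 / 2) x₀ 4) (1 / 2),
        lift (symmetricPentagon (√3 / 2) x₀ 4) (-(1 / 2))} := by
    have e0 : lift (symmetricPentagon (√3 / 2) x₀ 4) (1 / 2) =
        pyramidPoint x₀ √(1 - (1 / 2 + x₀) ^ 2) √(3 / 4 - x₀ ^ 2) 0 := by
      simp [lift, symmetricPentagon, pyramidPoint, sqrt_three_half_sq]
    have e1 : lift (symmetricPentagon (√3 / 2) x₀ 4) (-(1 / 2)) =
        pyramidPoint x₀ √(1 - (1 / 2 + x₀) ^ 2) √(3 / 4 - x₀ ^ 2) 1 := by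
      simp [lift, symmetricPentagon, pyramidPoint, sqrt_three_half_sq]
    rw [e0, e1, hK₀, hK₀', hd.vertices_eq]
    ext u
    constructor
    · rintro ⟨⟨i, rfl⟩, hi⟩
      rcases (hd.valence_eq_five_iff i).1 hi with rfl | rfl
      exacts [Or.inl rfl, Or.inr rfl]
    · rintro (rfl | rfl)
      · exact ⟨mem_range_self _, (hd.valence_eq_five_iff 0).2 (Or.inl rfl)⟩
      · exact ⟨mem_range_self _, (hd.valence_eq_five_iff 1).2 (Or.inr rfl)⟩
  refine ⟨hV ▸ hgreat, by rw [hV]; linarith, by rw [hV]; linarith,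
    ⟨x₀, hx₀, hmax, diameterGraph_eq_starGraph hx₀, hmem, ⟨?_, ?_⟩, hval, by rw [hV, hvol], hV,
      fun K hK heq => (hbound K hK).2 (heq.trans hV)⟩, fun K hK => volume_le_of_isOctahedral hK⟩
  · rw [hK₀']
    exact hd.hasTriangularFaces
  · have : lift (symmetricPentagon (√3 / 2) x₀ 4) (1 / 2) ∈
        {u ∈ vertices K₀ | valence K₀ u = 5} := by
      rw [hval]
      exact Or.inl rfl
    exact ⟨_, this⟩
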